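/- Let $d\ge 1$ and $\chi\in(0,1)$. Let $\mathcal V=B(0,V_0)\subset\mathbb R^d$ be the centered ball of unit volume, and let $K(x,v)=1+\chi\,\mathrm{sign}(x\cdot v)$. Consider the linear run-and-tumble equation $$\partial_t f=\mathcal L f:=-v\cdot\nabla_x f+\int_{\mathcal V}\bigl(K(x,v')f(t,x,v')-K(x,v)f(t,x,v)\bigr)\,dv'\qquad\text{on }(0,\infty)\times\mathbb R^d\times\mathcal V .$$ There is a constant $\gamma^*>0$, depending only on $d$ and $\chi$, such that for every $\gamma\in(0,\gamma^*)$ the following holds with $m(x)=\exp\bigl(\gamma\sqrt{1+|x|^2}\bigr)$ and $X=L^1(m)\cap L^\infty(m)$, normed by $\|f\|_X=\|mf\|_{L^1(\mathbb R^d\times\mathcal V)}+\|mf\|_{L^\infty(\mathbb R^d\times\mathcal V)}$. (i) The equation generates a semigroup $(S_{\mathcal L}(t))_{t\ge0}$ of linear operators on $X$, and this semigroup is bounded: there is a constant $C$ with $$\|S_{\mathcal L}(t)f_0\|_X\le C\,\|f_0\|_X\qquad\text{for all }t\ge0,\ f_0\in X .$$ Here $t\mapsto S_{\mathcal L}(t)f_0$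 is the unique weak (distributional) solution with initial datum $f_0$ that belongs to $C([0,T);L^1_{loc})\cap L^\infty(0,T;L^1(m))$ for all $T>0$; it is continuous in $t$ for the norm of $L^1(m)$ and for the weak-$*$ topology of $L^\infty(m)$. (ii) There is at least one stationary state $G\in X$ with $G\ge0$, $\int_{\mathbb R^d\times\mathcal V}G\,dx\,dv=1$ and, for every $R\in SO(d)$, $G(Rx,Rv)=G(x,v)$ for almost every $(x,v)$; that is, $\mathcal L G=0$ in the sense of distributions and $S_{\mathcal L}(t)G=G$ for all $t\ge0$. -/

import Mathlib

open MeasureTheory Filter Topology Set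

namespace RunTumble

noncomputable section

/-- The Euclidean space of dimension `d`. -/
abbrev E (d : ℕ) : Type := EuclideanSpace ℝ (Fin d)

/-- The velocity set: the centered open ball of radius `V₀`. -/
def velocities (d : ℕ) (V₀ : ℝ) : Set (E d) := Metric.ball 0 V₀

/-- Lebesgue measure `dx dv` on the phase space (position in the whole space, velocity in the
velocity ball), seen as a measure on pairs `(x, v)`. -/
def phase (d : ℕ) (V₀ : ℝ) : Measure (E d × E d) :=
  (volume : Measure (E d)).prod ((volume : Measure (E d)).restrict (velocities d V₀))

/-- The turning kernel `K(x, v) = 1 + χ sign (x · v)`. -/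
def turning {d : ℕ} (χ : ℝ) (x v : E d) : ℝ := 1 + χ * Real.sign (inner ℝ x v)

/-- The exponential weight `m(x) = exp (γ ⟨x⟩)`, where `⟨x⟩ = (1 + |x|²)^(1/2)`. -/
def weight {d : ℕ} (γ : ℝ) (x : E d) : ℝ := Real.exp (γ * Real.sqrt (1 + ‖x‖ ^ 2))

/-- The function `m f` on the phase space. -/
def weighted {d : ℕ} (γ : ℝ) (f : E d × E d → ℝ) : E d × E d → ℝ :=
  fun z => weight γ z.1 * f z

lemma weighted_add {d : ℕ} (γ : ℝ) (f g : E d × E d → ℝ) :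
    weighted γ (f + g) = weighted γ f + weighted γ g := by
  funext z
  simp [weighted, mul_add]

lemma weighted_smul {d : ℕ} (γ c : ℝ) (f : E d × E d → ℝ) :
    weighted γ (c • f) = c • weighted γ f := by
  funext z
  simp [weighted, mul_left_comm]

lemma weighted_congr {d : ℕ} {μ : Measure (E d × E d)} (γ : ℝ) {f g : E d × E d → ℝ}
    (h : f =ᵐ[μ] g) : weighted γ f =ᵐ[μ] weighted γ g := by
  filter_upwards [h] with z hz
  simp [weighted, hz]

/-- The space `X = L¹(m) ∩ L^∞(m)`, as a space of classes of functions modulo equality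
almost everywhere. -/
def X (d : ℕ) (V₀ γ : ℝ) : Submodule ℝ (E d × E d →ₘ[phase d V₀] ℝ) where
  carrier := {f | MemLp (weighted γ f) 1 (phase d V₀) ∧ MemLp (weighted γ f) ⊤ (phase d V₀)}
  add_mem' := by
    rintro f g ⟨hf1, hf2⟩ ⟨hg1, hg2⟩
    have h := weighted_congr γ (AEEqFun.coeFn_add f g)
    rw [weighted_add] at h
    exact ⟨(memLp_congr_ae h).2 (hf1.add hg1), (memLp_congr_ae h).2 (hf2.add hg2)⟩
  zero_mem' := by
    have h : weighted γ (0 : E d × E d →ₘ[phase d V₀] ℝ) =ᵐ[phase d V₀]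
        (0 : E d × E d → ℝ) := by
      filter_upwards [AEEqFun.coeFn_zero (β := ℝ) (μ := phase d V₀)] with z hz
      simp [weighted, hz]
    exact ⟨(memLp_congr_ae h).2 MemLp.zero, (memLp_congr_ae h).2 MemLp.zero⟩
  smul_mem' := by
    rintro c f ⟨hf1, hf2⟩
    have h := weighted_congr γ (AEEqFun.coeFn_smul c f)
    rw [weighted_smul] at h
    exact ⟨(memLp_congr_ae h).2 (hf1.const_smul c), (memLp_congr_ae h).2 (hf2.const_smul c)⟩

/-- The norm of `X`: `‖m f‖_{L¹} + ‖m f‖_{L^∞}` (with value in `[0, ∞]`; it is finite on `X`). -/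
def normX {d : ℕ} {V₀ : ℝ} (γ : ℝ) (f : E d × E d →ₘ[phase d V₀] ℝ) : ENNReal :=
  eLpNorm (weighted γ f) 1 (phase d V₀) + eLpNorm (weighted γ f) ⊤ (phase d V₀)

/-- Test functions: `C¹` functions with compact support in the open set of all `(x, v)` with `v` in
the velocity ball. -/
structure IsTest (d : ℕ) (V₀ : ℝ) (φ : E d × E d → ℝ) : Prop where
  contDiff : ContDiff ℝ 1 φ
  compact : HasCompactSupport φ
  support : tsupport φ ⊆ univ ×ˢ velocities d V₀

/-- The formal adjoint of the run-and-tumble operator: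
`(L* φ)(x, v) = v · ∇ₓ φ(x, v) + K(x, v) ∫ (φ(x, v') - φ(x, v)) dv'`. -/
def adjointOp {d : ℕ} (V₀ χ : ℝ) (φ : E d × E d → ℝ) (z : E d × E d) : ℝ :=
  fderiv ℝ φ z (z.2, 0) +
    turning χ z.1 z.2 * ∫ v' in velocities d V₀, (φ (z.1, v') - φ z)

/-- `f` is a weak (distributional) solution on `[0, ∞)` of
`∂ₜ f = - v · ∇ₓ f + ∫ (K(x, v') f(t, x, v') - K(x, v) f(t, x, v)) dv'` with `f(0) = f₀`, in the class
`C([0, T); L¹_loc) ∩ L^∞(0, T; L¹(m))` for all `T`. Only times `t ≥ 0` matter. -/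
structure IsWeakSolution {d : ℕ} (V₀ χ γ : ℝ) (f₀ : E d × E d →ₘ[phase d V₀] ℝ)
    (f : ℝ → (E d × E d →ₘ[phase d V₀] ℝ)) : Prop where
  bounded : ∀ T : ℝ, ∃ M : NNReal, ∀ t ∈ Icc 0 T,
    eLpNorm (weighted γ (f t)) 1 (phase d V₀) ≤ M
  continuous : ∀ A : Set (E d × E d), IsCompact A → A ⊆ univ ×ˢ velocities d V₀ →
    ∀ t : ℝ, 0 ≤ t →
      Tendsto (fun s => eLpNorm (f s - f t : E d × E d →ₘ[phase d V₀] ℝ) 1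
        ((phase d V₀).restrict A)) (𝓝[Ici 0] t) (𝓝 0)
  initial : f 0 = f₀
  equation : ∀ φ, IsTest d V₀ φ → ∀ t : ℝ, 0 ≤ t →
    ∫ z, f t z * φ z ∂(phase d V₀) = ∫ z, f₀ z * φ z ∂(phase d V₀) +
      ∫ s in (0 : ℝ)..t, ∫ z, f s z * adjointOp V₀ χ φ z ∂(phase d V₀)

/-- `S` is the semigroup on `X` associated with the linear run-and-tumble equation: `t ↦ S t f₀` is
the unique weak solution with initial datum `f₀`, the semigroup law holds, and the trajectories are
continuous for the norm of `L¹(m)` and for the weak-star topology of `L^∞(m)`. -/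
structure IsFlow {d : ℕ} (V₀ χ γ : ℝ) (S : ℝ → (X d V₀ γ →ₗ[ℝ] X d V₀ γ)) : Prop where
  solution : ∀ f₀ : X d V₀ γ, IsWeakSolution V₀ χ γ f₀ (fun t => (S t f₀).1)
  unique : ∀ (f₀ : X d V₀ γ) (g : ℝ → (E d × E d →ₘ[phase d V₀] ℝ)),
    IsWeakSolution V₀ χ γ f₀ g → ∀ t : ℝ, 0 ≤ t → g t = (S t f₀).1
  zero : S 0 = LinearMap.id
  add : ∀ s t : ℝ, 0 ≤ s → 0 ≤ t → S (s + t) = S s ∘ₗ S t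
  strong : ∀ (f₀ : X d V₀ γ) (t : ℝ), 0 ≤ t →
    Tendsto (fun s => eLpNorm (weighted γ (S s f₀ - S t f₀ : X d V₀ γ).1) 1 (phase d V₀))
      (𝓝[Ici 0] t) (𝓝 0)
  weakStar : ∀ (f₀ : X d V₀ γ) (ψ : E d × E d → ℝ),
    Integrable (fun z => (weight γ z.1)⁻¹ * ψ z) (phase d V₀) →
      ContinuousOn (fun t => ∫ z, (S t f₀).1 z * ψ z ∂(phase d V₀)) (Ici 0)

/-- Invariance by rotation: `f(R x, R v) = f(x, v)` for all rotations `R`, that is, for all linear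
isometries of determinant `1`. -/
def RotationInvariant {d : ℕ} {V₀ : ℝ} (f : E d × E d →ₘ[phase d V₀] ℝ) : Prop :=
  ∀ R : E d ≃ₗᵢ[ℝ] E d, LinearMap.det (R.toLinearEquiv : E d →ₗ[ℝ] E d) = 1 →
    ∀ᵐ z ∂(phase d V₀), f (R z.1, R z.2) = f z

/-- `- v · ∇ₓ G + ∫ (K(x, v') G(x, v') - K(x, v) G(x, v)) dv' = 0` in the sense of distributions. -/
def IsStationary {d : ℕ} (V₀ χ : ℝ) (G : E d × E d →ₘ[phase d V₀] ℝ) : Prop :=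
  ∀ φ, IsTest d V₀ φ → ∫ z, G z * adjointOp V₀ χ φ z ∂(phase d V₀) = 0

end

end RunTumble

/-! Everything is done for the density `g = m f` in the unweighted space `L¹(dx dv)`. Conjugated
with the weight, free transport is a strongly continuous group of growth `exp(γ V₀ |t|)`, because
the bracket is 1-Lipschitz and speeds are at most `V₀`. The collision operator is bounded and
commutes with the weight, which depends on `x` only. The solution is therefore a Dyson series in the
interaction picture. It is nonnegative for nonnegative data: transport is positive, and so is the
collision operator plus 2, since `K ≤ 2`.

The uniform `L¹(m)` bound expresses confinement: particles moving inwards turn less often. The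
weight alone does not show it, because `v · ∇ₓ m = γ m (x · v)/⟨x⟩` has no sign and mean zero in
`v`. The weight is corrected to `w = m (1 + γ p)`, where `p` is such that `K p` cancels `(x ·
v)/⟨x⟩` up to `O(1/⟨x⟩)`. The identity `(1 + χ sign s)(s - χ|s|) = (1 - χ²) s` dictates `p`, and the
velocity average of `p` is then negative and bounded away from zero at infinity. So the adjoint
generator sends `w` below `-α w + β` (`exists_lyapunov`). As the mass of `f` is conserved,
Gronwall's inequality bounds the integral of `w f` for all times.

The uniform `L^∞(m)` bound comes from Duhamel's formula with the damping `1 - χ` taken out of the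
loss term; for small `γ` it beats the growth of the transport. Gain, transport for a time `r` and
gain again map `L¹` to `L^∞` with norm of order `r^{-d}`, by the change of variables `y = x - r v`
(`gainOp_transOp_gainOp_le`). This is not integrable at `r = 0`, so for short times a provisional
sup bound `P` on the gain is used instead; its contribution is at most `P/2`. Iterating removes `P`
and leaves a bound by the data (`gainOp_sol_le`).

Uniqueness is a duality argument: against a test function carried along the flow, the transport
terms cancel and only the bounded collision term remains, so an iterated Gronwall estimate in `L¹`
gives zero (`IsWeakCurve.eq_zero`). Linearity, the semigroup law and rotation invariance of the flow
all follow from uniqueness.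

The stationary state is obtained as in Krylov and Bogoliubov: time means of a trajectory with radial
datum are bounded in `L¹ ∩ L^∞`, hence in `L²`, and converge weakly along an ultrafilter. Since
`1/m` is in `L²`, every bounded function is an admissible test function for `f`. In particular no
mass escapes, and the limit is stationary because the generator applied to a time mean is `O(1/T)`.
-/

namespace RunTumble

/-! ### Dyson series for linear equations with strongly continuous coefficients -/

section Dyson

variable {F : Type*} [NormedAddCommGroup F] [NormedSpace ℝ F]

/-- The terms of the Dyson series of the linear equation `z' = C(t) z`, `z(0) = g`. -/
noncomputable def dysonTerm (C : ℝ → F →L[ℝ] F) (g : F) : ℕ → ℝ → F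
  | 0 => fun _ => g
  | n + 1 => fun t => ∫ s in (0 : ℝ)..t, C s (dysonTerm C g n s)

/-- The sum of the Dyson series. -/
noncomputable def dyson (C : ℝ → F →L[ℝ] F) (g : F) (t : ℝ) : F := ∑' n, dysonTerm C g n t

/-- Each integration raises the power of `|t|` by one and divides by `n + 1`; repeated, this
produces the factorials of the Dyson series. Both signs of `t` are covered, so that the series can
be differentiated at `t = 0`. -/
lemma norm_integral_le_of_pow {G : Type*} [NormedAddCommGroup G] [NormedSpace ℝ G]
    {f : ℝ → G} {c t : ℝ} {n : ℕ} (h : ∀ s, |s| ≤ |t| → ‖f s‖ ≤ c * |s| ^ n) :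
    ‖∫ s in (0 : ℝ)..t, f s‖ ≤ c * (|t| ^ (n + 1) / (n + 1)) := by
  have key : ∀ {f : ℝ → G} {t : ℝ}, 0 ≤ t → (∀ s, |s| ≤ |t| → ‖f s‖ ≤ c * |s| ^ n) →
      ‖∫ s in (0 : ℝ)..t, f s‖ ≤ c * (|t| ^ (n + 1) / (n + 1)) := by
    intro f t ht h
    have h1 : ‖∫ s in (0 : ℝ)..t, f s‖ ≤ ∫ s in (0 : ℝ)..t, c * s ^ n := by
      refine intervalIntegral.norm_integral_le_of_norm_le ht ?_ ?_
      · refine Eventually.of_forall fun s hs => ?_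
        have := h s (by rw [abs_of_nonneg hs.1.le, abs_of_nonneg ht]; exact hs.2)
        rwa [abs_of_nonneg hs.1.le] at this
      · exact (Continuous.intervalIntegrable (by fun_prop) _ _)
    rw [intervalIntegral.integral_const_mul, integral_pow] at h1
    simpa [abs_of_nonneg ht] using h1
  rcases le_total 0 t with ht | ht
  · exact key ht h
  · have h2 := key (f := fun s => f (-s)) (t := -t) (by linarith)
      (fun s hs => by simpa using h (-s) (by simpa using hs))
    rw [intervalIntegral.integral_comp_neg] at h2
    rw [intervalIntegral.integral_symm, norm_neg]
    simpa using h2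

/-- Strong continuity and locally bounded norms replace norm continuity, which fails for the
transport group. -/
lemma continuous_apply_of_strong {C : ℝ → F →L[ℝ] F} (hC : ∀ g, Continuous fun t => C t g)
    {K : ℝ → ℝ} (hK : ∀ T, ∀ t, |t| ≤ T → ‖C t‖ ≤ K T) {h : ℝ → F} (hh : Continuous h) :
    Continuous fun t => C t (h t) := by
  rw [continuous_iff_continuousAt]
  intro t
  have h1 : Tendsto (fun s => C s (h s - h t)) (𝓝 t) (𝓝 0) := by
    refine squeeze_zero_norm' (a := fun s => K (|t| + 1) * ‖h s - h t‖) ?_ ?_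
    · filter_upwards [Metric.ball_mem_nhds t one_pos] with s hs
      refine (C s).le_of_opNorm_le (hK _ s ?_) _
      rw [Metric.mem_ball, Real.dist_eq] at hs
      calc |s| = |t + (s - t)| := by ring_nf
        _ ≤ |t| + |s - t| := abs_add_le _ _
        _ ≤ _ := by linarith
    · have : Tendsto (fun s => ‖h s - h t‖) (𝓝 t) (𝓝 ‖h t - h t‖) :=
        ((hh.tendsto t).sub_const _).norm
      simpa using this.const_mul (K (|t| + 1))
  have h2 := h1.add ((hC (h t)).tendsto t)
  simpa [ContinuousAt] using h2

variable {C : ℝ → F →L[ℝ] F} {K : ℝ → ℝ}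

lemma continuous_dysonTerm (hC : ∀ g, Continuous fun t => C t g)
    (hK : ∀ T, ∀ t, |t| ≤ T → ‖C t‖ ≤ K T)
    (g : F) (n : ℕ) : Continuous (dysonTerm C g n) := by
  induction n with
  | zero => exact continuous_const
  | succ n ih =>
    exact intervalIntegral.continuous_primitive
      (fun a b => (continuous_apply_of_strong hC hK ih).intervalIntegrable a b) 0

lemma hasDerivAt_dysonTerm [CompleteSpace F]
    (hC : ∀ g, Continuous fun t => C t g)
    (hK : ∀ T, ∀ t, |t| ≤ T → ‖C t‖ ≤ K T)
    (g : F) (n : ℕ) (t : ℝ) :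
    HasDerivAt (dysonTerm C g (n + 1)) (C t (dysonTerm C g n t)) t := by
  have h := continuous_apply_of_strong hC hK (continuous_dysonTerm hC hK g n)
  exact intervalIntegral.integral_hasDerivAt_right (h.intervalIntegrable _ _)
    h.stronglyMeasurable.stronglyMeasurableAtFilter h.continuousAt

lemma norm_dysonTerm_le (hK : ∀ T, ∀ t, |t| ≤ T → ‖C t‖ ≤ K T)
    (g : F) (n : ℕ) (T t : ℝ) (ht : |t| ≤ T) :
    ‖dysonTerm C g n t‖ ≤ ‖g‖ * K T ^ n / n.factorial * |t| ^ n := by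
  induction n generalizing t with
  | zero => simp [dysonTerm]
  | succ n ih =>
    have h := norm_integral_le_of_pow (f := fun s => C s (dysonTerm C g n s)) (t := t)
      (c := K T * (‖g‖ * K T ^ n / n.factorial)) (n := n) (fun s hs => by
        have h1 := (C s).le_of_opNorm_le (hK T s (hs.trans ht)) (dysonTerm C g n s)
        refine h1.trans ?_
        rw [mul_assoc]
        exact mul_le_mul_of_nonneg_left (ih s (hs.trans ht))
          ((norm_nonneg _).trans (hK T s (hs.trans ht))))
    refine h.trans (le_of_eq ?_)
    rw [Nat.factorial_succ]
    push_cast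
    have : (n.factorial : ℝ) ≠ 0 := by positivity
    field_simp
    ring

lemma summable_dyson_bound (a k T : ℝ) :
    Summable fun n : ℕ => a * k ^ n / n.factorial * T ^ n := by
  have := (Real.summable_pow_div_factorial (k * T)).mul_left a
  refine this.congr fun n => ?_
  rw [mul_pow]
  ring

lemma summable_dysonTerm [CompleteSpace F]
    (hK : ∀ T, ∀ t, |t| ≤ T → ‖C t‖ ≤ K T)
    (g : F) (t : ℝ) :
    Summable fun n => dysonTerm C g n t :=
  Summable.of_norm_bounded (summable_dyson_bound ‖g‖ (K |t|) |t|)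
    (fun n => norm_dysonTerm_le hK g n |t| t le_rfl)

lemma dyson_zero (g : F) : dyson C g 0 = g := by
  rw [dyson, tsum_eq_single 0]
  · rfl
  · intro n hn
    obtain ⟨m, rfl⟩ := Nat.exists_eq_succ_of_ne_zero hn
    simp [dysonTerm]

/-- The series is differentiated term by term on `(-T, T)`, where the derivatives are dominated by
an exponential series. The term of index 0 is constant and is split off, so that the derivative of
term `n + 1` is `C t` applied to term `n`. -/
theorem hasDerivAt_dyson [CompleteSpace F]
    (hC : ∀ g, Continuous fun t => C t g)
    (hK : ∀ T, ∀ t, |t| ≤ T → ‖C t‖ ≤ K T)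
    (g : F) (t : ℝ) :
    HasDerivAt (dyson C g) (C t (dyson C g t)) t := by
  set T := |t| + 1
  have hT : ∀ y ∈ Ioo (-T) T, |y| ≤ T := fun y hy => (abs_lt.2 hy).le
  have hK0 : 0 ≤ K T := (norm_nonneg _).trans (hK T 0 (by simp [T]; positivity))
  have htT : t ∈ Ioo (-T) T := abs_lt.1 (by simp [T])
  have h := hasDerivAt_tsum_of_isPreconnected (g := fun n => dysonTerm C g (n + 1))
    (g' := fun n y => C y (dysonTerm C g n y))
    (u := fun n => K T * (‖g‖ * K T ^ n / n.factorial * T ^ n))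
    ((summable_dyson_bound _ _ _).mul_left _) (isOpen_Ioo (a := -T) (b := T)) isPreconnected_Ioo
    (fun n y _ => hasDerivAt_dysonTerm hC hK g n y) (fun n y hy => ?_) htT
    ((summable_nat_add_iff 1).2 (summable_dysonTerm hK g t)) htT
  · have h3 : dyson C g = fun z => g + ∑' n, dysonTerm C g (n + 1) z := by
      funext z
      rw [dyson, (summable_dysonTerm hK g z).tsum_eq_zero_add]
      rfl
    have h4 : C t (dyson C g t) = ∑' n, C t (dysonTerm C g n t) := by
      rw [dyson, (C t).map_tsum (summable_dysonTerm hK g t)]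
    rw [h3]
    rw [h3] at h4
    simpa only [h4] using h.const_add g
  · refine ((C y).le_of_opNorm_le (hK T y (hT y hy)) _).trans ?_
    refine mul_le_mul_of_nonneg_left ?_ hK0
    refine (norm_dysonTerm_le hK g n T y (hT y hy)).trans ?_
    refine mul_le_mul_of_nonneg_left ?_ (by positivity)
    exact pow_le_pow_left₀ (abs_nonneg _) (hT y hy) n

/-- A term of the series at `t > 0` is `t` times a mean value over `(0, t]` of points of a closed
convex cone, so it stays in the cone; sums and limits do too. For `t < 0` the factor `t` would leave
the cone. -/
theorem dyson_mem_cone [CompleteSpace F]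
    (hC : ∀ g, Continuous fun t => C t g)
    (hK : ∀ T, ∀ t, |t| ≤ T → ‖C t‖ ≤ K T)
    {P : Set F} (hP : IsClosed P) (hP0 : 0 ∈ P)
    (hPadd : ∀ f ∈ P, ∀ g ∈ P, f + g ∈ P) (hPsmul : ∀ c : ℝ, 0 ≤ c → ∀ g ∈ P, c • g ∈ P)
    (hCP : ∀ s, ∀ g ∈ P, C s g ∈ P) {g : F} (hg : g ∈ P) {t : ℝ} (ht : 0 ≤ t) :
    dyson C g t ∈ P := by
  have hconv : Convex ℝ P := fun x hx y hy a b ha hb _ =>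
    hPadd _ (hPsmul a ha x hx) _ (hPsmul b hb y hy)
  have hterm : ∀ n t, 0 ≤ t → dysonTerm C g n t ∈ P := by
    intro n
    induction n with
    | zero => exact fun _ _ => hg
    | succ n ih =>
      intro t ht
      rcases ht.eq_or_lt with rfl | ht
      · simpa [dysonTerm] using hP0
      have hcont := continuous_apply_of_strong hC hK (continuous_dysonTerm hC hK g n)
      have h := hconv.set_average_mem hP (μ := volume) (t := Ioc 0 t)
        (f := fun s => C s (dysonTerm C g n s)) (by simp [ht]) (by simp)
        ((ae_restrict_mem measurableSet_Ioc).mono fun s hs => hCP s _ (ih s hs.1.le))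
        (hcont.integrableOn_Ioc)
      have h2 := hPsmul t ht.le _ h
      rw [setAverage_eq, smul_smul] at h2
      simpa [dysonTerm, intervalIntegral.integral_of_le ht.le, Measure.real, ht.le, ht.ne',
        ENNReal.toReal_ofReal] using h2
  refine hP.mem_of_tendsto (summable_dysonTerm hK g t).hasSum (Eventually.of_forall fun s => ?_)
  induction s using Finset.induction_on with
  | empty => simpa using hP0
  | insert a s ha ih =>
    rw [Finset.sum_insert ha]
    exact hPadd _ (hterm _ _ ht) _ ih

/-- Sup bounds are not controlled by the norm of `L¹`, the space to which this is applied. They are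
expressed by a family of continuous functionals `l i` with thresholds `c i`, and such bounds pass
through integrals and through the sum of the series. -/
theorem abs_dyson_le [CompleteSpace F]
    (hC : ∀ g, Continuous fun t => C t g)
    (hK : ∀ T, ∀ t, |t| ≤ T → ‖C t‖ ≤ K T)
    {ι : Type*} (l : ι → F →L[ℝ] ℝ) (c : ι → ℝ) {T b : ℝ}
    (hb : 0 ≤ b)
    (hl : ∀ N : ℝ, 0 ≤ N → ∀ g, (∀ i, |l i g| ≤ N * c i) → ∀ s, |s| ≤ T →
      ∀ i, |l i (C s g)| ≤ b * N * c i)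
    {g : F} {N : ℝ} (hN : 0 ≤ N) (hg : ∀ i, |l i g| ≤ N * c i) {t : ℝ} (ht : |t| ≤ T) (i : ι) :
    |l i (dyson C g t)| ≤ (∑' n : ℕ, N * b ^ n / n.factorial * |t| ^ n) * c i := by
  have hterm : ∀ n t, |t| ≤ T → ∀ i,
      |l i (dysonTerm C g n t)| ≤ N * b ^ n / n.factorial * |t| ^ n * c i := by
    intro n
    induction n with
    | zero => intro t _ i; simpa [dysonTerm] using hg i
    | succ n ih =>
      intro t ht i
      have hcont := continuous_apply_of_strong hC hK (continuous_dysonTerm hC hK g n)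
      have h := norm_integral_le_of_pow (f := fun s => l i (C s (dysonTerm C g n s))) (t := t)
        (c := b * (N * b ^ n / n.factorial) * c i) (n := n) (fun s hs => by
          rw [Real.norm_eq_abs]
          refine (hl (N * b ^ n / n.factorial * |s| ^ n) (by positivity) _
            (ih s (hs.trans ht)) s (hs.trans ht) i).trans (le_of_eq ?_)
          ring)
      have h2 : l i (dysonTerm C g (n + 1) t) =
          ∫ s in (0 : ℝ)..t, l i (C s (dysonTerm C g n s)) :=
        ((l i).intervalIntegral_comp_comm (hcont.intervalIntegrable _ _)).symm
      rw [h2, ← Real.norm_eq_abs]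
      refine h.trans (le_of_eq ?_)
      rw [Nat.factorial_succ]
      push_cast
      have : (n.factorial : ℝ) ≠ 0 := by positivity
      field_simp
      ring
  rw [dyson, (l i).map_tsum (summable_dysonTerm hK g t), ← tsum_mul_right, ← Real.norm_eq_abs]
  exact tsum_of_norm_bounded ((summable_dyson_bound N b |t|).mul_right (c i)).hasSum
    (fun n => hterm n t ht i)

end Dyson

/-! ### Bounded perturbation of a group: weak equation, Duhamel formula, invariant cones -/

/-- A strongly continuous group of operators with exponential growth bound. -/
structure IsGroupOp {F : Type*} [NormedAddCommGroup F] [NormedSpace ℝ F] (U : ℝ → F →L[ℝ] F)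
    (κ : ℝ) : Prop where
  zero : ∀ g, U 0 g = g
  add : ∀ s t g, U (s + t) g = U s (U t g)
  cont : ∀ g, Continuous fun t => U t g
  bound : ∀ t, ‖U t‖ ≤ Real.exp (κ * |t|)
  nonneg : 0 ≤ κ

section Evolution

variable {F : Type*} [NormedAddCommGroup F] [NormedSpace ℝ F] {U : ℝ → F →L[ℝ] F} {κ : ℝ}

namespace IsGroupOp

lemma bound_le (hU : IsGroupOp U κ) (T t : ℝ) (ht : |t| ≤ T) : ‖U t‖ ≤ Real.exp (κ * T) :=
  (hU.bound t).trans (Real.exp_le_exp.2 (mul_le_mul_of_nonneg_left ht hU.nonneg))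

lemma continuous_apply (hU : IsGroupOp U κ) {h : ℝ → F} (hh : Continuous h) :
    Continuous fun t => U t (h t) :=
  continuous_apply_of_strong hU.cont (K := fun T => Real.exp (κ * T)) hU.bound_le hh

lemma apply_neg (hU : IsGroupOp U κ) (t : ℝ) (g : F) : U t (U (-t) g) = g := by
  rw [← hU.add, add_neg_cancel, hU.zero]

end IsGroupOp

/-- The conjugated generator `U(-t) (B + c) U(t)`. -/
noncomputable def conjOp (U : ℝ → F →L[ℝ] F) (B : F →L[ℝ] F) (c t : ℝ) : F →L[ℝ] F :=
  U (-t) ∘L (B + c • ContinuousLinearMap.id ℝ F) ∘L U t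

lemma conjOp_apply (B : F →L[ℝ] F) (c t : ℝ) (g : F) :
    conjOp U B c t g = U (-t) (B (U t g) + c • U t g) := by
  simp [conjOp]

lemma continuous_conjOp (hU : IsGroupOp U κ) (B : F →L[ℝ] F) (c : ℝ) (g : F) :
    Continuous fun t => conjOp U B c t g := by
  simp only [conjOp_apply]
  have h1 : Continuous fun t => U t (B (U (-t) g) + c • U (-t) g) := by
    refine hU.continuous_apply ?_
    have := (hU.cont g).comp continuous_neg
    exact (B.continuous.comp this).add (this.const_smul c)
  simpa [Function.comp_def] using h1.comp continuous_neg

lemma norm_conjOp_le (hU : IsGroupOp U κ) (B : F →L[ℝ] F) (c T t : ℝ) (ht : |t| ≤ T) :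
    ‖conjOp U B c t‖ ≤ Real.exp (κ * T) * (‖B + c • ContinuousLinearMap.id ℝ F‖ *
      Real.exp (κ * T)) := by
  refine (ContinuousLinearMap.opNorm_comp_le _ _).trans ?_
  refine mul_le_mul (hU.bound_le T _ (by simpa using ht)) ?_ (norm_nonneg _) (Real.exp_pos _).le
  exact (ContinuousLinearMap.opNorm_comp_le _ _).trans
    (mul_le_mul_of_nonneg_left (hU.bound_le T _ ht) (norm_nonneg _))

/-- The solution of `u' = A u + B u`, `u(0) = g`, where `A` generates the group `U`. The constant `c`
only enters through the way in which the solution is built. -/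
noncomputable def evolution (U : ℝ → F →L[ℝ] F) (B : F →L[ℝ] F) (c : ℝ) (g : F) (t : ℝ) : F :=
  Real.exp (-(c * t)) • U t (dyson (conjOp U B c) g t)

lemma hasDerivAt_dyson_conjOp [CompleteSpace F] (hU : IsGroupOp U κ) (B : F →L[ℝ] F) (c : ℝ) (g : F) (t : ℝ) :
    HasDerivAt (dyson (conjOp U B c) g)
      (conjOp U B c t (dyson (conjOp U B c) g t)) t :=
  hasDerivAt_dyson (continuous_conjOp hU B c) (norm_conjOp_le hU B c) g t

lemma continuous_dyson_conjOp [CompleteSpace F] (hU : IsGroupOp U κ) (B : F →L[ℝ] F) (c : ℝ) (g : F) :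
    Continuous (dyson (conjOp U B c) g) :=
  continuous_iff_continuousAt.2 fun t => (hasDerivAt_dyson_conjOp hU B c g t).continuousAt

lemma evolution_zero (hU : IsGroupOp U κ) (B : F →L[ℝ] F) (c : ℝ) (g : F) :
    evolution U B c g 0 = g := by
  simp [evolution, dyson_zero, hU.zero]

lemma continuous_evolution [CompleteSpace F] (hU : IsGroupOp U κ) (B : F →L[ℝ] F) (c : ℝ) (g : F) :
    Continuous (evolution U B c g) := by
  unfold evolution
  exact (by fun_prop : Continuous fun t => Real.exp (-(c * t))).smul
    (hU.continuous_apply (continuous_dyson_conjOp hU B c g))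

/-- The weak form of the evolution equation: `l` is in the domain of the adjoint generator, with
image `l'`. -/
theorem hasDerivAt_evolution_dual [CompleteSpace F] (hU : IsGroupOp U κ) (B : F →L[ℝ] F) (c : ℝ) (g : F)
    (l l' : F →L[ℝ] ℝ) (hl : ∀ g, HasDerivAt (fun r => l (U r g)) (l' g) 0) (t : ℝ) :
    HasDerivAt (fun t => l (evolution U B c g t))
      (l' (evolution U B c g t) + l (B (evolution U B c g t))) t := by
  set z := dyson (conjOp U B c) g with hz
  have hzd := hasDerivAt_dyson_conjOp hU B c g t
  rw [← hz] at hzd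
  -- Product rule for `l (U r (z r))`, split as `U r (z t)` plus `U r (z r - z t)`. In the first
  -- part only the group moves, and the hypothesis on `l` applies after the group law has shifted
  -- the time to 0.
  have hl1 : HasDerivAt (fun r => l (U r (z t))) (l' (U t (z t))) t := by
    have h1 : HasDerivAt (fun r => l (U (r - t) (U t (z t)))) (l' (U t (z t))) t := by
      have h0 : HasDerivAt (fun r => l (U r (U t (z t)))) (l' (U t (z t))) (t - t) := by
        rw [sub_self]; exact hl _
      exact h0.comp_sub_const t t
    refine h1.congr_of_eventuallyEq (Eventually.of_forall fun r => ?_)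
    simp only
    rw [← hU.add, sub_add_cancel]
  -- In the second part the difference quotient of `z` converges in norm, and the local bound on `U`
  -- together with strong continuity lets `U s` act on it in the limit.
  have hl2 : HasDerivAt (fun r => l (U r (z r - z t))) (l (U t (conjOp U B c t (z t)))) t := by
    rw [hasDerivAt_iff_tendsto_slope]
    rw [hasDerivAt_iff_tendsto_slope] at hzd
    have h2 : Continuous fun p : ℝ × ℝ => p.1 := continuous_fst
    have h3 : Tendsto (fun s => U s (slope z t s)) (𝓝[≠] t)
        (𝓝 (U t (conjOp U B c t (z t)))) := by
      have h4 : Tendsto (fun s => U s (slope z t s - conjOp U B c t (z t))) (𝓝[≠] t) (𝓝 0) := by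
        refine squeeze_zero_norm' (a := fun s => Real.exp (κ * (|t| + 1)) *
          ‖slope z t s - conjOp U B c t (z t)‖) ?_ ?_
        · refine mem_nhdsWithin_of_mem_nhds ?_
          filter_upwards [Metric.ball_mem_nhds t one_pos] with s hs
          refine (U s).le_of_opNorm_le (hU.bound_le _ s ?_) _
          rw [Metric.mem_ball, Real.dist_eq] at hs
          calc |s| = |t + (s - t)| := by ring_nf
            _ ≤ |t| + |s - t| := abs_add_le _ _
            _ ≤ _ := by linarith
        · have : Tendsto (fun s => ‖slope z t s - conjOp U B c t (z t)‖) (𝓝[≠] t)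
              (𝓝 ‖conjOp U B c t (z t) - conjOp U B c t (z t)‖) := (hzd.sub_const _).norm
          simpa using this.const_mul (Real.exp (κ * (|t| + 1)))
      have h5 := h4.add (((hU.cont (conjOp U B c t (z t))).tendsto t).mono_left nhdsWithin_le_nhds)
      simpa using h5
    refine ((l.continuous.tendsto _).comp h3).congr fun s => ?_
    simp [slope_def_module, Function.comp]
  have h6 : HasDerivAt (fun r => l (U r (z r)))
      (l' (U t (z t)) + l (B (U t (z t)) + c • U t (z t))) t := by
    have := hl1.add hl2
    rw [conjOp_apply, hU.apply_neg] at this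
    refine this.congr_of_eventuallyEq (Eventually.of_forall fun r => ?_)
    simp
  have h7 : HasDerivAt (fun t => Real.exp (-(c * t))) (Real.exp (-(c * t)) * (-(c * 1))) t :=
    (((hasDerivAt_id t).const_mul c).neg).exp
  have h8 := h7.mul h6
  have h9 : (fun t => l (evolution U B c g t)) =
      (fun t => Real.exp (-(c * t))) * fun r => l (U r (z r)) := by
    funext r
    simp [evolution, hz]
  rw [h9]
  refine h8.congr_deriv ?_
  simp only [evolution, ← hz, map_smul, map_add, smul_eq_mul]
  ring

/-- Duhamel's formula, with an additional damping at rate `a`. -/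
theorem evolution_duhamel [CompleteSpace F] (hU : IsGroupOp U κ) (B : F →L[ℝ] F) (c : ℝ) (g : F)
    (l : F →L[ℝ] ℝ) (a t : ℝ) :
    l (evolution U B c g t) = Real.exp (-(a * t)) * l (U t g) +
      ∫ s in (0 : ℝ)..t, Real.exp (-(a * (t - s))) *
        l (U (t - s) (B (evolution U B c g s) + a • evolution U B c g s)) := by
  set z := dyson (conjOp U B c) g with hz
  have hcz : Continuous z := continuous_dyson_conjOp hU B c g
  -- This function is `exp(a s) U(-s) u(s)` with `u` the evolution: undoing the transport and the
  -- damping leaves only `B + a` in the derivative. Integrating over `[0, t]` and applying `exp(-a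
  -- t) U(t)` gives the formula.
  have hd : ∀ s, HasDerivAt (fun s => Real.exp ((a - c) * s) • z s)
      (Real.exp (a * s) • U (-s) (B (evolution U B c g s) + a • evolution U B c g s)) s := by
    intro s
    have h1 : HasDerivAt (fun s => Real.exp ((a - c) * s))
        (Real.exp ((a - c) * s) * ((a - c) * 1)) s := ((hasDerivAt_id s).const_mul (a - c)).exp
    have h2 := h1.smul (hasDerivAt_dyson_conjOp hU B c g s)
    refine h2.congr_deriv ?_
    have h3 : z s = U (-s) (U s (z s)) := by rw [← hU.add, neg_add_cancel, hU.zero]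
    have h4 : Real.exp ((a - c) * s) = Real.exp (a * s) * Real.exp (-(c * s)) := by
      rw [← Real.exp_add]; ring_nf
    rw [← hz, conjOp_apply]
    nth_rewrite 3 [h3]
    simp only [evolution, ← hz, h4, map_smul, map_add, smul_add, smul_smul]
    rw [add_assoc _ _ (_ • U (-s) (U s (z s))), ← add_smul]
    congr 2
    ring
  have hcont : Continuous fun s =>
      Real.exp (a * s) • U (-s) (B (evolution U B c g s) + a • evolution U B c g s) := by
    have hce := continuous_evolution hU B c g
    have h0 : Continuous fun s => U s (B (evolution U B c g (-s)) + a • evolution U B c g (-s)) := by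
      refine hU.continuous_apply ?_
      have := hce.comp continuous_neg
      exact (B.continuous.comp this).add (this.const_smul a)
    have h1 := h0.comp continuous_neg
    simp only [Function.comp_def, neg_neg] at h1
    exact (by fun_prop : Continuous fun s => Real.exp (a * s)).smul h1
  have hint := intervalIntegral.integral_eq_sub_of_hasDerivAt (a := 0) (b := t)
    (fun s _ => hd s) (hcont.intervalIntegrable _ _)
  set L : F →L[ℝ] ℝ := l ∘L (Real.exp (-(a * t)) • U t) with hL
  have h5 := congrArg L hint
  rw [← L.intervalIntegral_comp_comm (hcont.intervalIntegrable _ _), map_sub] at h5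
  have h6 : L (Real.exp ((a - c) * t) • z t) = l (evolution U B c g t) := by
    simp only [hL, evolution, ← hz, ContinuousLinearMap.comp_apply, _root_.smul_apply,
      map_smul, smul_eq_mul, ← mul_assoc, ← Real.exp_add]
    ring_nf
  have h7 : L (Real.exp ((a - c) * 0) • z 0) = Real.exp (-(a * t)) * l (U t g) := by
    simp [hL, hz, dyson_zero]
  rw [h6, h7] at h5
  rw [← sub_eq_iff_eq_add'] 
  rw [← h5]
  refine intervalIntegral.integral_congr fun s _ => ?_
  simp only [hL, ContinuousLinearMap.comp_apply, _root_.smul_apply, map_smul,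
    smul_eq_mul, ← hU.add, ← sub_eq_add_neg, ← mul_assoc, ← Real.exp_add]
  ring_nf

/-- The shift `c` serves here: only `B + c` has to preserve the cone, and the scalar factor `exp(-c
t)` that compensates for it is positive. -/
theorem evolution_mem_cone [CompleteSpace F] (hU : IsGroupOp U κ) (B : F →L[ℝ] F) (c : ℝ) {P : Set F}
    (hP : IsClosed P) (hP0 : 0 ∈ P)
    (hPadd : ∀ f ∈ P, ∀ g ∈ P, f + g ∈ P) (hPsmul : ∀ c : ℝ, 0 ≤ c → ∀ g ∈ P, c • g ∈ P)
    (hUP : ∀ s, ∀ g ∈ P, U s g ∈ P) (hBP : ∀ g ∈ P, B g + c • g ∈ P) {g : F} (hg : g ∈ P)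
    {t : ℝ} (ht : 0 ≤ t) : evolution U B c g t ∈ P := by
  refine hPsmul _ (Real.exp_pos _).le _ (hUP _ _ ?_)
  refine dyson_mem_cone (continuous_conjOp hU B c) (norm_conjOp_le hU B c) hP hP0 hPadd hPsmul
    (fun s g hg => ?_) hg ht
  rw [conjOp_apply]
  exact hUP _ _ (hBP _ (hUP _ _ hg))

theorem exists_abs_evolution_le [CompleteSpace F] (hU : IsGroupOp U κ) (B : F →L[ℝ] F) (c : ℝ) {ι : Type*}
    (l : ι → F →L[ℝ] ℝ) (w : ι → ℝ) (hw : ∀ i, 0 ≤ w i) {b : ℝ} (hb : 0 ≤ b)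
    (hlU : ∀ N : ℝ, 0 ≤ N → ∀ g, (∀ i, |l i g| ≤ N * w i) → ∀ s, ∀ i,
      |l i (U s g)| ≤ Real.exp (κ * |s|) * N * w i)
    (hlB : ∀ N : ℝ, 0 ≤ N → ∀ g, (∀ i, |l i g| ≤ N * w i) → ∀ i,
      |l i (B g + c • g)| ≤ b * N * w i)
    {g : F} {N : ℝ} (hN : 0 ≤ N) (hg : ∀ i, |l i g| ≤ N * w i) (T : ℝ) :
    ∃ M : ℝ, 0 ≤ M ∧ ∀ t, |t| ≤ T → ∀ i, |l i (evolution U B c g t)| ≤ M * w i := by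
  set E := Real.exp (κ * T)
  have hE : ∀ s, |s| ≤ T → Real.exp (κ * |s|) ≤ E := fun s hs =>
    Real.exp_le_exp.2 (mul_le_mul_of_nonneg_left hs hU.nonneg)
  have hE0 : 0 ≤ E := (Real.exp_pos _).le
  have hlU' : ∀ N : ℝ, 0 ≤ N → ∀ g, (∀ i, |l i g| ≤ N * w i) → ∀ s, |s| ≤ T → ∀ i,
      |l i (U s g)| ≤ E * N * w i := fun N hN g hg s hs i =>
    (hlU N hN g hg s i).trans (by
      have := hE s hs
      have := hw i
      gcongr)
  set S : ℝ := ∑' n : ℕ, N * (E * (b * E)) ^ n / n.factorial * T ^ n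
  have hz : ∀ t, |t| ≤ T → ∀ i, |l i (dyson (conjOp U B c) g t)| ≤ S * w i := by
    intro t ht i
    have h := abs_dyson_le (continuous_conjOp hU B c) (norm_conjOp_le hU B c) l w (T := T)
      (b := E * (b * E)) (by positivity) (fun N hN g hg s hs i => by
        rw [conjOp_apply]
        have h1 := hlU' N hN g hg s hs
        have h2 := hlB (E * N) (by positivity) _ h1
        have h3 := hlU' _ (by positivity) _ h2 (-s) (by simpa using hs) i
        refine h3.trans (le_of_eq ?_)
        ring) hN hg ht i
    refine h.trans (mul_le_mul_of_nonneg_right ?_ (hw i))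
    exact (summable_dyson_bound _ _ _).tsum_le_tsum (fun n => by
      have : |t| ^ n ≤ T ^ n := pow_le_pow_left₀ (abs_nonneg _) ht n
      gcongr) (summable_dyson_bound _ _ _)
  refine ⟨max 0 (Real.exp (|c| * T) * (E * max S 0)), le_max_left _ _, fun t ht i => ?_⟩
  have h1 := hlU' (max S 0) (le_max_right _ _) _
    (fun i => (hz t ht i).trans (mul_le_mul_of_nonneg_right (le_max_left _ _) (hw i))) t ht i
  have h2 : Real.exp (-(c * t)) ≤ Real.exp (|c| * T) := by
    refine Real.exp_le_exp.2 ?_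
    calc -(c * t) ≤ |c * t| := neg_le_abs _
      _ = |c| * |t| := abs_mul _ _
      _ ≤ _ := mul_le_mul_of_nonneg_left ht (abs_nonneg _)
  rw [evolution, map_smul, smul_eq_mul, abs_mul, abs_of_pos (Real.exp_pos _)]
  calc _ ≤ Real.exp (|c| * T) * (E * max S 0 * w i) :=
        mul_le_mul h2 h1 (abs_nonneg _) (Real.exp_pos _).le
    _ = Real.exp (|c| * T) * (E * max S 0) * w i := by ring
    _ ≤ _ := mul_le_mul_of_nonneg_right (le_max_right _ _) (hw i)

end Evolution

/-! ### Phase space, free flow, weight and turning kernel -/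

section PhaseSpace

variable {d : ℕ} {V₀ χ γ : ℝ}

/-- The measure `dv` on the velocity ball. -/
noncomputable abbrev vel (d : ℕ) (V₀ : ℝ) : Measure (E d) := volume.restrict (velocities d V₀)

instance isProbabilityMeasure_vel [h : Fact (volume (velocities d V₀) = 1)] :
    IsProbabilityMeasure (vel d V₀) := ⟨by simpa using h.out⟩

instance sigmaFinite_phase : SigmaFinite (phase d V₀) := by
  unfold phase; infer_instance

instance isLocallyFiniteMeasure_phase : IsLocallyFiniteMeasure (phase d V₀) := by
  unfold phase; infer_instance

lemma radius_pos [h : Fact (volume (velocities d V₀) = 1)] : 0 < V₀ := by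
  by_contra hV
  have h1 := h.out
  rw [velocities, Metric.ball_eq_empty.2 (not_lt.1 hV)] at h1
  simp at h1

lemma measurableSet_velocities : MeasurableSet (velocities d V₀) := Metric.isOpen_ball.measurableSet

lemma ae_mem_velocities : ∀ᵐ z ∂(phase d V₀), z.2 ∈ velocities d V₀ := by
  have h : ∀ᵐ v ∂(vel d V₀), v ∈ velocities d V₀ := ae_restrict_mem measurableSet_velocities
  exact (Measure.quasiMeasurePreserving_snd (μ := (volume : Measure (E d)))).ae h

lemma norm_le_of_mem_velocities {v : E d} (hv : v ∈ velocities d V₀) : ‖v‖ ≤ V₀ := by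
  rw [velocities, mem_ball_zero_iff] at hv
  exact hv.le

/-- Free transport. -/
def flow (r : ℝ) (z : E d × E d) : E d × E d := (z.1 + r • z.2, z.2)

lemma flow_fst (r : ℝ) (z : E d × E d) : (flow r z).1 = z.1 + r • z.2 := rfl

lemma flow_snd (r : ℝ) (z : E d × E d) : (flow r z).2 = z.2 := rfl

lemma flow_flow (r s : ℝ) (z : E d × E d) : flow r (flow s z) = flow (s + r) z := by
  simp [flow, add_smul, add_assoc]

lemma flow_zero (z : E d × E d) : flow 0 z = z := by simp [flow]

lemma continuous_flow_uncurry : Continuous fun p : ℝ × (E d × E d) => flow p.1 p.2 := by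
  unfold flow; fun_prop

lemma continuous_flow (r : ℝ) : Continuous (flow r : E d × E d → E d × E d) := by
  unfold flow; fun_prop

/-- For fixed `v` the flow is a translation in `x`. The two swaps put the velocity first, as the
base of a skew product. -/
lemma measurePreserving_flow (r : ℝ) : MeasurePreserving (flow r) (phase d V₀) (phase d V₀) := by
  have h1 : MeasurePreserving (fun p : E d × E d => (id p.1, p.2 + r • p.1))
      ((vel d V₀).prod volume) ((vel d V₀).prod volume) := by
    refine MeasurePreserving.skew_product (g := fun v x => x + r • v)
      (MeasurePreserving.id _) ?_ ?_
    · exact (by fun_prop : Continuous fun p : E d × E d => p.2 + r • p.1).measurable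
    · exact Eventually.of_forall fun v => map_add_right_eq_self _ _
  exact (Measure.measurePreserving_swap.comp h1).comp Measure.measurePreserving_swap

/-- The Japanese bracket. -/
noncomputable def bracket (x : E d) : ℝ := Real.sqrt (1 + ‖x‖ ^ 2)

lemma one_le_bracket (x : E d) : 1 ≤ bracket x := by
  rw [bracket, Real.one_le_sqrt]
  nlinarith [norm_nonneg x]

lemma bracket_pos (x : E d) : 0 < bracket x := one_pos.trans_le (one_le_bracket x)

lemma bracket_sq (x : E d) : bracket x ^ 2 = 1 + ‖x‖ ^ 2 := Real.sq_sqrt (by positivity)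

lemma norm_le_bracket (x : E d) : ‖x‖ ≤ bracket x :=
  Real.le_sqrt_of_sq_le (by linarith)

lemma bracket_le (x : E d) : bracket x ≤ 1 + ‖x‖ := by
  rw [bracket, Real.sqrt_le_left (by positivity)]
  nlinarith [norm_nonneg x]

lemma bracket_le_add (x y : E d) : bracket y ≤ bracket x + ‖y - x‖ := by
  have h1 : ‖y‖ ≤ ‖x‖ + ‖y - x‖ := by
    simpa using norm_add_le x (y - x)
  rw [bracket, Real.sqrt_le_left (add_nonneg (bracket_pos x).le (norm_nonneg _))]
  nlinarith [bracket_sq x, norm_le_bracket x, norm_nonneg x, norm_nonneg y, norm_nonneg (y - x)]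

lemma continuous_bracket : Continuous (bracket : E d → ℝ) := by
  unfold bracket; fun_prop

lemma weight_eq (x : E d) : weight γ x = Real.exp (γ * bracket x) := rfl

lemma weight_pos (x : E d) : 0 < weight γ x := Real.exp_pos _

lemma one_le_weight (hγ : 0 ≤ γ) (x : E d) : 1 ≤ weight γ x :=
  Real.one_le_exp (mul_nonneg hγ (bracket_pos x).le)

lemma continuous_weight : Continuous (weight γ : E d → ℝ) := by
  unfold weight; fun_prop

/-- The bracket is 1-Lipschitz. Along the flow, with speeds at most `V₀`, this yields the growth
rate `γ V₀` of the conjugated transport. -/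
lemma weight_add_le (hγ : 0 ≤ γ) (x y : E d) :
    weight γ (x + y) ≤ Real.exp (γ * ‖y‖) * weight γ x := by
  rw [weight_eq, weight_eq, ← Real.exp_add, Real.exp_le_exp, ← mul_add]
  have := bracket_le_add x (x + y)
  rw [add_sub_cancel_left] at this
  exact mul_le_mul_of_nonneg_left (by linarith) hγ

lemma weight_div_le (hγ : 0 ≤ γ) {v : E d} (hv : ‖v‖ ≤ V₀) (x : E d) (r : ℝ) :
    (weight γ x)⁻¹ * weight γ (x + r • v) ≤ Real.exp (γ * V₀ * |r|) := by
  rw [inv_mul_le_iff₀ (weight_pos x), mul_comm]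
  refine (weight_add_le hγ x (r • v)).trans ?_
  refine mul_le_mul_of_nonneg_right ?_ (weight_pos x).le
  rw [Real.exp_le_exp, norm_smul, Real.norm_eq_abs, mul_assoc]
  refine mul_le_mul_of_nonneg_left ?_ hγ
  rw [mul_comm]
  exact mul_le_mul_of_nonneg_right hv (abs_nonneg r)

lemma le_weight_div (hγ : 0 ≤ γ) {v : E d} (hv : ‖v‖ ≤ V₀) (x : E d) (r : ℝ) :
    Real.exp (-(γ * V₀ * |r|)) ≤ (weight γ x)⁻¹ * weight γ (x + r • v) := by
  have h := weight_div_le hγ hv (x + r • v) (-r)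
  rw [neg_smul, add_neg_cancel_right, abs_neg] at h
  rw [Real.exp_neg, inv_le_comm₀ (Real.exp_pos _)
    (mul_pos (inv_pos.2 (weight_pos _)) (weight_pos _)), mul_inv, inv_inv, mul_comm]
  exact h

lemma sign_le_one (r : ℝ) : Real.sign r ≤ 1 := by
  rcases Real.sign_apply_eq r with h | h | h <;> rw [h] <;> norm_num

lemma neg_one_le_sign (r : ℝ) : -1 ≤ Real.sign r := by
  rcases Real.sign_apply_eq r with h | h | h <;> rw [h] <;> norm_num

lemma turning_le [h : Fact (χ ∈ Ioo (0 : ℝ) 1)] (x v : E d) : turning χ x v ≤ 1 + χ := by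
  have := mul_le_mul_of_nonneg_left (sign_le_one (inner ℝ x v)) h.out.1.le
  unfold turning; linarith

lemma turning_le_two [h : Fact (χ ∈ Ioo (0 : ℝ) 1)] (x v : E d) : turning χ x v ≤ 2 :=
  (turning_le x v).trans (by linarith [h.out.2])

lemma le_turning [h : Fact (χ ∈ Ioo (0 : ℝ) 1)] (x v : E d) : 1 - χ ≤ turning χ x v := by
  have := mul_le_mul_of_nonneg_left (neg_one_le_sign (inner ℝ x v)) h.out.1.le
  unfold turning; linarith

lemma turning_pos [h : Fact (χ ∈ Ioo (0 : ℝ) 1)] (x v : E d) : 0 < turning χ x v :=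
  lt_of_lt_of_le (by linarith [h.out.2]) (le_turning x v)

lemma abs_turning_le [Fact (χ ∈ Ioo (0 : ℝ) 1)] (x v : E d) : |turning χ x v| ≤ 2 := by
  rw [abs_of_pos (turning_pos x v)]
  exact turning_le_two x v

lemma measurable_sign : Measurable Real.sign := by
  unfold Real.sign
  exact Measurable.ite measurableSet_Iio measurable_const
    (Measurable.ite measurableSet_Ioi measurable_const measurable_const)

lemma measurable_turning : Measurable fun z : E d × E d => turning χ z.1 z.2 := by
  unfold turning
  have h : Measurable fun z : E d × E d => inner ℝ z.1 z.2 :=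
    (by fun_prop : Continuous fun z : E d × E d => inner ℝ z.1 z.2).measurable
  exact (((measurable_sign.comp h).const_mul χ).const_add 1)

/-- With `s = x · v`, `s - χ|s| = (1 - χ sign s) s`, and the two conjugate factors multiply to `1 -
χ²` when `s ≠ 0`. This is what makes division by the discontinuous kernel explicit, and it dictates
the corrector of the weight. -/
lemma turning_mul_eq [Fact (χ ∈ Ioo (0 : ℝ) 1)] (x v : E d) :
    turning χ x v * (inner ℝ x v - χ * |inner ℝ x v|) = (1 - χ ^ 2) * inner ℝ x v := by
  unfold turning
  rcases lt_trichotomy (inner ℝ x v) 0 with h1 | h1 | h1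
  · rw [Real.sign_of_neg h1, abs_of_neg h1]; ring
  · rw [h1]; simp
  · rw [Real.sign_of_pos h1, abs_of_pos h1]; ring

lemma integrable_vel_of_continuous {f : E d → ℝ} (hf : Continuous f) : Integrable f (vel d V₀) := by
  have h : IntegrableOn f (Metric.closedBall 0 V₀) volume :=
    hf.continuousOn.integrableOn_compact (isCompact_closedBall _ _)
  exact h.mono_set Metric.ball_subset_closedBall

lemma integral_vel_inner (x : E d) : ∫ v, (inner ℝ x v : ℝ) ∂(vel d V₀) = 0 := by
  have h : ∫ v, (inner ℝ x v : ℝ) ∂(vel d V₀) = ∫ v, -(inner ℝ x v : ℝ) ∂(vel d V₀) := by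
    rw [← integral_indicator measurableSet_velocities, ← integral_indicator measurableSet_velocities,
      ← integral_neg_eq_self]
    refine integral_congr_ae (Eventually.of_forall fun v => ?_)
    simp [indicator, velocities]
  rw [integral_neg] at h
  linarith

/-- On the ball of radius `V₀/4` about `(V₀/2) x/‖x‖`, which lies inside the velocity ball, `x · v ≥
(V₀/4) ‖x‖`; the volume of this ball does not depend on `x`. The moment measures the confinement
produced by the bias. -/
lemma exists_abs_inner_moment [Fact (volume (velocities d V₀) = 1)] : ∃ κ : ℝ, 0 < κ ∧ ∀ x : E d,
    κ * ‖x‖ ≤ ∫ v, |(inner ℝ x v : ℝ)| ∂(vel d V₀) := by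
  have hV₀ : 0 < V₀ := radius_pos (d := d)
  set ρ : ℝ := volume.real (Metric.ball (0 : E d) (V₀ / 4)) with hρ
  have hρ0 : 0 < ρ := ENNReal.toReal_pos
    (Metric.measure_ball_pos _ _ (by positivity)).ne' measure_ball_lt_top.ne
  refine ⟨V₀ / 4 * ρ, by positivity, fun x => ?_⟩
  rcases eq_or_ne x 0 with rfl | hx
  · simp
  have hx0 : 0 < ‖x‖ := norm_pos_iff.2 hx
  set e : E d := (V₀ / 2) • (‖x‖⁻¹ • x) with he
  have hene : ‖e‖ = V₀ / 2 := by
    rw [he, norm_smul, norm_smul, norm_inv, norm_norm, inv_mul_cancel₀ hx0.ne', mul_one,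
      Real.norm_of_nonneg (by positivity)]
  have hsub : Metric.ball e (V₀ / 4) ⊆ velocities d V₀ := by
    intro v hv
    rw [mem_ball_iff_norm] at hv
    rw [velocities, mem_ball_zero_iff]
    have : ‖v‖ ≤ ‖v - e‖ + ‖e‖ := by simpa using norm_add_le (v - e) e
    linarith
  have hlow : ∀ v ∈ Metric.ball e (V₀ / 4), V₀ / 4 * ‖x‖ ≤ |(inner ℝ x v : ℝ)| := by
    intro v hv
    rw [mem_ball_iff_norm] at hv
    have h1 : (inner ℝ x v : ℝ) = inner ℝ x e + inner ℝ x (v - e) := by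
      rw [← inner_add_right]; simp
    have h2 : (inner ℝ x e : ℝ) = V₀ / 2 * ‖x‖ := by
      rw [he, inner_smul_right, inner_smul_right, real_inner_self_eq_norm_sq]
      field_simp
    have h3 := abs_real_inner_le_norm x (v - e)
    have h4 : ‖x‖ * ‖v - e‖ ≤ ‖x‖ * (V₀ / 4) := mul_le_mul_of_nonneg_left hv.le hx0.le
    have h5 := neg_abs_le (inner ℝ x (v - e) : ℝ)
    refine le_trans ?_ (le_abs_self _)
    rw [h1, h2]
    linarith
  have hint : Integrable (fun v => |(inner ℝ x v : ℝ)|) (vel d V₀) :=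
    integrable_vel_of_continuous (by fun_prop)
  calc V₀ / 4 * ρ * ‖x‖ = ∫ _ in Metric.ball e (V₀ / 4), V₀ / 4 * ‖x‖ := by
        rw [setIntegral_const, Measure.real, Measure.addHaar_ball_center, smul_eq_mul, hρ,
          Measure.real]
        ring
    _ ≤ ∫ v in Metric.ball e (V₀ / 4), |(inner ℝ x v : ℝ)| :=
        setIntegral_mono_on (integrableOn_const measure_ball_lt_top.ne)
          (IntegrableOn.mono_set hint hsub) measurableSet_ball hlow
    _ ≤ _ := setIntegral_mono_set hint (Eventually.of_forall fun _ => abs_nonneg _)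
        hsub.eventuallyLE

/-- The change of variables `y = x - r v` has Jacobian `r^{-d}`. It turns a velocity integral into a
space integral and is the source of the regularisation from `L¹` to `L^∞`. -/
lemma integral_vel_comp_le {h : E d → ℝ} (h0 : 0 ≤ h) (hi : Integrable h) {r : ℝ} (hr : 0 < r)
    (x : E d) : ∫ v, h (x + (-r) • v) ∂(vel d V₀) ≤ (r ^ d)⁻¹ * ∫ y, h y := by
  have h1 : ∫ v, h (x + (-r) • v) = (r ^ d)⁻¹ * ∫ y, h y := by
    rw [Measure.integral_comp_smul volume (fun y => h (x + y)) (-r), integral_add_left_eq_self]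
    simp [abs_of_pos hr]
  have h2 : Integrable fun v => h (x + (-r) • v) := by
    have := (hi.comp_add_left x).comp_smul (R := -r) (by linarith)
    exact this
  rw [← h1]
  exact setIntegral_le_integral h2 (Eventually.of_forall fun v => h0 (x + (-r) • v))

end PhaseSpace

/-! ### Multiplication and pairing with bounded functions on `L¹` -/

section Operators

variable {d : ℕ} {V₀ χ γ : ℝ}

/-- The space `L¹(dx dv)`; its elements stand for densities multiplied by the weight. -/
abbrev Dens (d : ℕ) (V₀ : ℝ) : Type := Lp ℝ 1 (phase d V₀)

/-- Measurable functions that are bounded on the phase space. -/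
structure Bdd (V₀ : ℝ) (ψ : E d × E d → ℝ) : Prop where
  meas : Measurable ψ
  bound : ∃ C, ∀ z : E d × E d, z.2 ∈ velocities d V₀ → |ψ z| ≤ C

namespace Bdd

variable {φ ψ : E d × E d → ℝ}

lemma memLp (h : Bdd V₀ ψ) : MemLp ψ ⊤ (phase d V₀) := by
  obtain ⟨C, hC⟩ := h.bound
  exact memLp_top_of_bound h.meas.aestronglyMeasurable C
    (ae_mem_velocities.mono fun z hz => hC z hz)

lemma exists_nonneg_bound (h : Bdd V₀ ψ) :
    ∃ C, 0 ≤ C ∧ ∀ z : E d × E d, z.2 ∈ velocities d V₀ → |ψ z| ≤ C := by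
  obtain ⟨C, hC⟩ := h.bound
  exact ⟨max C 0, le_max_right _ _, fun z hz => (hC z hz).trans (le_max_left _ _)⟩

lemma mul (hφ : Bdd V₀ φ) (hψ : Bdd V₀ ψ) : Bdd V₀ (fun z => φ z * ψ z) := by
  obtain ⟨C, hC0, hC⟩ := hφ.exists_nonneg_bound
  obtain ⟨C', -, hC'⟩ := hψ.exists_nonneg_bound
  refine ⟨hφ.meas.mul hψ.meas, C * C', fun z hz => ?_⟩
  rw [abs_mul]
  exact mul_le_mul (hC z hz) (hC' z hz) (abs_nonneg _) hC0

lemma add (hφ : Bdd V₀ φ) (hψ : Bdd V₀ ψ) : Bdd V₀ (fun z => φ z + ψ z) := by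
  obtain ⟨C, hC⟩ := hφ.bound
  obtain ⟨C', hC'⟩ := hψ.bound
  exact ⟨hφ.meas.add hψ.meas, C + C', fun z hz =>
    (abs_add_le _ _).trans (add_le_add (hC z hz) (hC' z hz))⟩

lemma sub (hφ : Bdd V₀ φ) (hψ : Bdd V₀ ψ) : Bdd V₀ (fun z => φ z - ψ z) := by
  obtain ⟨C, hC⟩ := hφ.bound
  obtain ⟨C', hC'⟩ := hψ.bound
  exact ⟨hφ.meas.sub hψ.meas, C + C', fun z hz =>
    (abs_sub _ _).trans (add_le_add (hC z hz) (hC' z hz))⟩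

lemma const (c : ℝ) : Bdd V₀ (fun _ : E d × E d => c) :=
  ⟨measurable_const, |c|, fun _ _ => le_rfl⟩

lemma indicator_one {S : Set (E d × E d)} (hS : MeasurableSet S) :
    Bdd V₀ (S.indicator fun _ => (1 : ℝ)) := by
  refine ⟨measurable_const.indicator hS, 1, fun z _ => ?_⟩
  by_cases h : z ∈ S <;> simp [h]

lemma turning [Fact (χ ∈ Ioo (0 : ℝ) 1)] :
    Bdd V₀ fun z : E d × E d => turning χ z.1 z.2 :=
  ⟨measurable_turning, 2, fun z _ => abs_turning_le z.1 z.2⟩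

end Bdd

/-- Multiplication by a bounded function. -/
noncomputable def mulOp (ψ : E d × E d → ℝ) : Dens d V₀ →L[ℝ] Dens d V₀ :=
  open Classical in
  if h : MemLp ψ ⊤ (phase d V₀) then
    (ContinuousLinearMap.mul ℝ ℝ).holderL (phase d V₀) ⊤ 1 1 (h.toLp ψ) else 0

lemma coeFn_mulOp {ψ : E d × E d → ℝ} (h : Bdd V₀ ψ) (g : Dens d V₀) :
    mulOp ψ g =ᵐ[phase d V₀] fun z => ψ z * g z := by
  have h1 : mulOp ψ g = (ContinuousLinearMap.mul ℝ ℝ).holder 1 (h.memLp.toLp ψ) g := by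
    rw [mulOp, dif_pos h.memLp]; rfl
  rw [h1]
  filter_upwards [(ContinuousLinearMap.mul ℝ ℝ).coeFn_holder (r := 1) (h.memLp.toLp ψ) g,
    h.memLp.coeFn_toLp] with z hz hz2
  rw [hz, hz2]
  rfl

lemma integrable_dens (g : Dens d V₀) : Integrable g (phase d V₀) := L1.integrable_coeFn g

lemma norm_dens (g : Dens d V₀) : ‖g‖ = ∫ z, |g z| ∂(phase d V₀) := by
  rw [L1.norm_eq_integral_norm]; rfl

lemma integrable_mul_dens {ψ : E d × E d → ℝ} (h : Bdd V₀ ψ) (g : Dens d V₀) :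
    Integrable (fun z => ψ z * g z) (phase d V₀) :=
  (integrable_dens (mulOp ψ g)).congr (coeFn_mulOp h g)

lemma norm_mulOp_le {ψ : E d × E d → ℝ} (h : Bdd V₀ ψ) {C : ℝ}
    (hC : ∀ z : E d × E d, z.2 ∈ velocities d V₀ → |ψ z| ≤ C) (g : Dens d V₀) :
    ‖mulOp ψ g‖ ≤ C * ‖g‖ := by
  rw [norm_dens, norm_dens, ← integral_const_mul]
  refine integral_mono_ae (integrable_dens _).abs ((integrable_dens _).abs.const_mul _) ?_
  filter_upwards [coeFn_mulOp h g, ae_mem_velocities] with z hz hz2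
  rw [hz, abs_mul]
  exact mul_le_mul_of_nonneg_right (hC z hz2) (abs_nonneg _)

/-- Integration against a bounded function. -/
noncomputable def pair (ψ : E d × E d → ℝ) : Dens d V₀ →L[ℝ] ℝ := L1.integralCLM ∘L mulOp ψ

lemma pair_apply {ψ : E d × E d → ℝ} (h : Bdd V₀ ψ) (g : Dens d V₀) :
    pair ψ g = ∫ z, ψ z * g z ∂(phase d V₀) := by
  have h1 : pair ψ g = L1.integral (mulOp ψ g) := (L1.integral_eq _).symm
  rw [h1, L1.integral_eq_integral]
  exact integral_congr_ae (coeFn_mulOp h g)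

lemma abs_pair_le {ψ : E d × E d → ℝ} (h : Bdd V₀ ψ) {C : ℝ}
    (hC : ∀ z : E d × E d, z.2 ∈ velocities d V₀ → |ψ z| ≤ C) (g : Dens d V₀) :
    |pair ψ g| ≤ C * ‖g‖ := by
  have h1 : pair ψ g = L1.integral (mulOp ψ g) := (L1.integral_eq _).symm
  rw [h1]
  exact (L1.norm_integral_le _).trans (norm_mulOp_le h hC g)

lemma pair_mulOp {φ ψ : E d × E d → ℝ} (hφ : Bdd V₀ φ) (hψ : Bdd V₀ ψ) (g : Dens d V₀) :
    pair ψ (mulOp φ g) = pair (fun z => φ z * ψ z) g := by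
  rw [pair_apply hψ, pair_apply (hφ.mul hψ)]
  refine integral_congr_ae ?_
  filter_upwards [coeFn_mulOp hφ g] with z hz
  rw [hz]; ring

lemma pair_sub {φ ψ : E d × E d → ℝ} (hφ : Bdd V₀ φ) (hψ : Bdd V₀ ψ) (g : Dens d V₀) :
    pair (fun z => φ z - ψ z) g = pair φ g - pair ψ g := by
  rw [pair_apply hφ, pair_apply hψ, pair_apply (hφ.sub hψ),
    ← integral_sub (integrable_mul_dens hφ g) (integrable_mul_dens hψ g)]
  simp only [sub_mul]

lemma pair_mono {φ ψ : E d × E d → ℝ} (hφ : Bdd V₀ φ) (hψ : Bdd V₀ ψ)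
    (h : ∀ z : E d × E d, z.2 ∈ velocities d V₀ → φ z ≤ ψ z) {g : Dens d V₀} (hg : 0 ≤ g) :
    pair φ g ≤ pair ψ g := by
  rw [pair_apply hφ, pair_apply hψ]
  refine integral_mono_ae (integrable_mul_dens hφ g) (integrable_mul_dens hψ g) ?_
  filter_upwards [ae_mem_velocities, (Lp.coeFn_nonneg g).2 hg] with z hz hz2
  exact mul_le_mul_of_nonneg_right (h z hz) hz2

/-! ### Velocity average and collision operators -/

section Average

/-- Average over the velocities. -/
noncomputable def avgFun (V₀ : ℝ) (f : E d × E d → ℝ) (z : E d × E d) : ℝ :=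
  ∫ v, f (z.1, v) ∂(vel d V₀)

lemma ae_integrable_section {f : E d × E d → ℝ} (hf : Integrable f (phase d V₀)) :
    ∀ᵐ z ∂(phase d V₀), Integrable (fun v => f (z.1, v)) (vel d V₀) :=
  Measure.quasiMeasurePreserving_fst.ae (Integrable.prod_right_ae (f := f) hf)

lemma avgFun_congr {f g : E d × E d → ℝ} (h : f =ᵐ[phase d V₀] g) :
    avgFun V₀ f =ᵐ[phase d V₀] avgFun V₀ g := by
  have h1 : ∀ᵐ x ∂(volume : Measure (E d)), ∀ᵐ v ∂(vel d V₀), f (x, v) = g (x, v) :=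
    Measure.ae_ae_of_ae_prod h
  have h2 : ∀ᵐ z ∂(phase d V₀), ∀ᵐ v ∂(vel d V₀), f (z.1, v) = g (z.1, v) :=
    Measure.quasiMeasurePreserving_fst.ae h1
  filter_upwards [h2] with z hz
  exact integral_congr_ae hz

lemma integral_phase {f : E d × E d → ℝ} (hf : Integrable f (phase d V₀)) :
    ∫ z, f z ∂(phase d V₀) = ∫ x, ∫ v, f (x, v) ∂(vel d V₀) :=
  integral_prod (μ := (volume : Measure (E d))) (ν := vel d V₀) f hf

variable [hV : Fact (volume (velocities d V₀) = 1)]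

lemma integrable_avgFun {f : E d × E d → ℝ} (hf : Integrable f (phase d V₀)) :
    Integrable (avgFun V₀ f) (phase d V₀) :=
  hf.integral_prod_left.comp_fst (vel d V₀)

lemma integral_abs_avgFun_le {f : E d × E d → ℝ} (hf : Integrable f (phase d V₀)) :
    ∫ z, |avgFun V₀ f z| ∂(phase d V₀) ≤ ∫ z, |f z| ∂(phase d V₀) := by
  have h1 : ∫ z, |f z| ∂(phase d V₀) = ∫ z, avgFun V₀ (fun z => |f z|) z ∂(phase d V₀) := by
    unfold phase avgFun
    rw [integral_prod _ hf.abs, integral_fun_fst (μ := (volume : Measure (E d)))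
      (ν := vel d V₀) (fun x => ∫ v, |f (x, v)| ∂(vel d V₀))]
    simp
  rw [h1]
  exact integral_mono (integrable_avgFun hf).abs (integrable_avgFun hf.abs)
    fun z => abs_integral_le_integral_abs

/-- The average over the velocities, as an operator. -/
noncomputable def avgOp : Dens d V₀ →L[ℝ] Dens d V₀ :=
  LinearMap.mkContinuous
    { toFun := fun g => (memLp_one_iff_integrable.2 (integrable_avgFun (integrable_dens g))).toLp _
      map_add' := fun f g => by
        rw [← MemLp.toLp_add]
        refine MemLp.toLp_congr _ _ ?_
        refine (avgFun_congr (Lp.coeFn_add f g)).trans ?_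
        filter_upwards [ae_integrable_section (integrable_dens f),
          ae_integrable_section (integrable_dens g)] with z hf hg
        exact integral_add hf hg
      map_smul' := fun c g => by
        rw [RingHom.id_apply, ← MemLp.toLp_const_smul]
        refine MemLp.toLp_congr _ _ ?_
        refine (avgFun_congr (Lp.coeFn_smul c g)).trans (Eventually.of_forall fun z => ?_)
        exact integral_const_mul c _ } 1 (fun g => by
    rw [one_mul, norm_dens, norm_dens]
    refine le_trans (le_of_eq (integral_congr_ae ?_)) (integral_abs_avgFun_le (integrable_dens g))
    filter_upwards [MemLp.coeFn_toLp
      (memLp_one_iff_integrable.2 (integrable_avgFun (integrable_dens g)))] with z hz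
    simp only [LinearMap.coe_mk, AddHom.coe_mk]
    rw [hz])

lemma coeFn_avgOp (g : Dens d V₀) : avgOp g =ᵐ[phase d V₀] avgFun V₀ g :=
  MemLp.coeFn_toLp (memLp_one_iff_integrable.2 (integrable_avgFun (integrable_dens g)))

lemma abs_avgFun_le {ψ : E d × E d → ℝ} {C : ℝ}
    (hC : ∀ z : E d × E d, z.2 ∈ velocities d V₀ → |ψ z| ≤ C) (z : E d × E d) :
    |avgFun V₀ ψ z| ≤ C := by
  have h : ∀ᵐ v ∂(vel d V₀), ‖ψ (z.1, v)‖ ≤ C :=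
    (ae_restrict_mem measurableSet_velocities).mono fun v hv => hC (z.1, v) hv
  have := norm_integral_le_of_norm_le_const h
  simpa [avgFun] using this

lemma Bdd.avg {ψ : E d × E d → ℝ} (h : Bdd V₀ ψ) : Bdd V₀ (avgFun V₀ ψ) := by
  obtain ⟨C, hC⟩ := h.bound
  refine ⟨?_, C, fun z _ => abs_avgFun_le hC z⟩
  have h1 : StronglyMeasurable fun x : E d => ∫ v, ψ (x, v) ∂(vel d V₀) :=
    h.meas.stronglyMeasurable.integral_prod_right'
  exact h1.measurable.comp measurable_fst

/-- By Fubini both sides equal the integral over `x` of the product of the two velocity averages. -/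
lemma pair_avgOp {ψ : E d × E d → ℝ} (h : Bdd V₀ ψ) (g : Dens d V₀) :
    pair ψ (avgOp g) = pair (avgFun V₀ ψ) g := by
  rw [pair_apply h, pair_apply h.avg]
  have h1 : Integrable (fun z => ψ z * avgFun V₀ g z) (phase d V₀) :=
    (integrable_mul_dens h (avgOp g)).congr ((coeFn_avgOp g).mono fun z hz => by simp only [hz])
  have h2 : ∫ z, ψ z * avgOp g z ∂(phase d V₀) = ∫ z, ψ z * avgFun V₀ g z ∂(phase d V₀) :=
    integral_congr_ae ((coeFn_avgOp g).mono fun z hz => by simp only [hz])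
  rw [h2, integral_phase h1, integral_phase (integrable_mul_dens h.avg g)]
  refine integral_congr_ae (Eventually.of_forall fun x => ?_)
  simp only [avgFun]
  rw [integral_mul_const, integral_const_mul]

variable (χ) in
/-- The gain operator `∫ K(x, v') g(x, v') dv'`. -/
noncomputable def gainOp : Dens d V₀ →L[ℝ] Dens d V₀ :=
  avgOp ∘L mulOp fun z => turning χ z.1 z.2

variable (χ) in
/-- The collision operator `∫ (K(x, v') g(x, v') - K(x, v) g(x, v)) dv'`. -/
noncomputable def collOp : Dens d V₀ →L[ℝ] Dens d V₀ :=
  gainOp χ - mulOp fun z => turning χ z.1 z.2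

variable [Fact (χ ∈ Ioo (0 : ℝ) 1)]

lemma pair_gainOp {ψ : E d × E d → ℝ} (h : Bdd V₀ ψ) (g : Dens d V₀) :
    pair ψ (gainOp χ g) = pair (fun z => turning χ z.1 z.2 * avgFun V₀ ψ z) g := by
  rw [gainOp, ContinuousLinearMap.comp_apply, pair_avgOp h, pair_mulOp Bdd.turning h.avg]

/-- In this adjoint form the difference of average and function is visible; it vanishes for
functions of `x` alone, which gives conservation of mass. -/
lemma pair_collOp {ψ : E d × E d → ℝ} (h : Bdd V₀ ψ) (g : Dens d V₀) :
    pair ψ (collOp χ g) = pair (fun z => turning χ z.1 z.2 * (avgFun V₀ ψ z - ψ z)) g := by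
  rw [collOp, _root_.sub_apply, map_sub, pair_gainOp h, pair_mulOp Bdd.turning h,
    ← pair_sub (Bdd.turning.mul h.avg) (Bdd.turning.mul h)]
  simp only [mul_sub]

lemma coeFn_gainOp (g : Dens d V₀) : gainOp χ g =ᵐ[phase d V₀]
    avgFun V₀ (fun z => turning χ z.1 z.2 * g z) :=
  (coeFn_avgOp _).trans (avgFun_congr (coeFn_mulOp Bdd.turning g))

end Average

/-! ### The transport group conjugated with the weight -/

section Transport

/-- The factor produced by conjugating the free transport with the weight. -/
noncomputable def weightRatio (γ r : ℝ) (z : E d × E d) : ℝ :=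
  weight γ z.1 * (weight γ (z.1 + (-r) • z.2))⁻¹

lemma weightRatio_flow (r : ℝ) (z : E d × E d) :
    weightRatio γ r (flow r z) = weight γ (z.1 + r • z.2) * (weight γ z.1)⁻¹ := by
  simp [weightRatio, flow]

lemma weightRatio_le (hγ : 0 ≤ γ) (r : ℝ) {z : E d × E d} (hz : z.2 ∈ velocities d V₀) :
    weightRatio γ r z ≤ Real.exp (γ * V₀ * |r|) := by
  have h := weight_div_le hγ (norm_le_of_mem_velocities hz) (z.1 + (-r) • z.2) r
  rw [neg_smul, neg_add_cancel_right, mul_comm (weight γ _)⁻¹] at h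
  simpa [weightRatio] using h

lemma le_weightRatio (hγ : 0 ≤ γ) (r : ℝ) {z : E d × E d} (hz : z.2 ∈ velocities d V₀) :
    Real.exp (-(γ * V₀ * |r|)) ≤ weightRatio γ r z := by
  have h := le_weight_div hγ (norm_le_of_mem_velocities hz) (z.1 + (-r) • z.2) r
  rw [neg_smul, neg_add_cancel_right, mul_comm (weight γ _)⁻¹] at h
  simpa [weightRatio] using h

lemma weightRatio_pos (r : ℝ) (z : E d × E d) : 0 < weightRatio γ r z :=
  mul_pos (weight_pos _) (inv_pos.2 (weight_pos _))

lemma continuous_weightRatio (r : ℝ) : Continuous (weightRatio γ r : E d × E d → ℝ) := by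
  unfold weightRatio
  refine (continuous_weight.comp continuous_fst).mul (Continuous.inv₀ ?_ fun z => (weight_pos _).ne')
  exact continuous_weight.comp (by fun_prop)

lemma bdd_weightRatio (hγ : 0 ≤ γ) (r : ℝ) : Bdd V₀ (weightRatio γ r : E d × E d → ℝ) :=
  ⟨(continuous_weightRatio r).measurable, Real.exp (γ * V₀ * |r|), fun z hz => by
    rw [abs_of_pos (weightRatio_pos r z)]
    exact weightRatio_le hγ r hz⟩

/-- The free transport group on `L¹`. -/
noncomputable def shiftOp (r : ℝ) : Dens d V₀ →L[ℝ] Dens d V₀ :=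
  (Lp.compMeasurePreservingₗᵢ ℝ (flow (-r)) (measurePreserving_flow (-r))).toContinuousLinearMap

lemma coeFn_shiftOp (r : ℝ) (g : Dens d V₀) :
    shiftOp r g =ᵐ[phase d V₀] fun z => g (flow (-r) z) :=
  Lp.coeFn_compMeasurePreserving g (measurePreserving_flow (-r))

lemma norm_shiftOp (r : ℝ) (g : Dens d V₀) : ‖shiftOp r g‖ = ‖g‖ :=
  Lp.norm_compMeasurePreserving g (measurePreserving_flow (-r))

lemma continuous_shiftOp (g : Dens d V₀) : Continuous fun r => shiftOp r g := by
  let F : C(ℝ, C(E d × E d, E d × E d)) :=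
    (ContinuousMap.mk (fun p : ℝ × (E d × E d) => flow (-p.1) p.2)
      (continuous_flow_uncurry.comp (by fun_prop : Continuous fun p : ℝ × (E d × E d) =>
        (-p.1, p.2)))).curry
  exact Continuous.compMeasurePreservingLp (f := fun _ : ℝ => g) (g := fun r => F r)
    continuous_const F.continuous (fun r => measurePreserving_flow (-r)) ENNReal.one_ne_top

variable (γ) in
/-- The free transport group, conjugated with the weight. -/
noncomputable def transOp (r : ℝ) : Dens d V₀ →L[ℝ] Dens d V₀ :=
  mulOp (weightRatio γ r) ∘L shiftOp r

lemma coeFn_transOp (hγ : 0 ≤ γ) (r : ℝ) (g : Dens d V₀) :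
    transOp γ r g =ᵐ[phase d V₀] fun z => weightRatio γ r z * g (flow (-r) z) := by
  refine (coeFn_mulOp (bdd_weightRatio hγ r) _).trans ?_
  filter_upwards [coeFn_shiftOp r g] with z hz
  exact congrArg _ hz

lemma norm_transOp_le (hγ : 0 ≤ γ) (r : ℝ) :
    ‖(transOp γ r : Dens d V₀ →L[ℝ] Dens d V₀)‖ ≤ Real.exp (γ * V₀ * |r|) := by
  refine ContinuousLinearMap.opNorm_le_bound _ (Real.exp_pos _).le fun g => ?_
  rw [transOp, ContinuousLinearMap.comp_apply, ← norm_shiftOp r g]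
  refine norm_mulOp_le (bdd_weightRatio hγ r) (fun z hz => ?_) _
  rw [abs_of_pos (weightRatio_pos r z)]
  exact weightRatio_le hγ r hz

lemma transOp_zero (hγ : 0 ≤ γ) (g : Dens d V₀) : transOp γ 0 g = g := by
  refine Lp.ext ((coeFn_transOp hγ 0 g).trans (Eventually.of_forall fun z => ?_))
  simp [weightRatio, flow_zero, (weight_pos _).ne']

/-- The weight ratios form a cocycle: the weight at the intermediate point `x - s v` cancels. -/
lemma transOp_add (hγ : 0 ≤ γ) (s t : ℝ) (g : Dens d V₀) :
    transOp γ (s + t) g = transOp γ s (transOp γ t g) := by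
  refine Lp.ext ?_
  have h1 := (measurePreserving_flow (V₀ := V₀) (-s)).quasiMeasurePreserving.ae_eq_comp
    (coeFn_transOp hγ t g)
  filter_upwards [coeFn_transOp hγ (s + t) g, coeFn_transOp hγ s (transOp γ t g), h1]
    with z hz hz2 hz3
  simp only [Function.comp] at hz3
  rw [hz, hz2, hz3, flow_flow, ← mul_assoc]
  congr 1
  · simp only [weightRatio, flow]
    have : z.1 + -s • z.2 + -t • z.2 = z.1 + -(s + t) • z.2 := by
      rw [add_assoc, ← add_smul]; congr 2; ring
    rw [this]
    have := (weight_pos (γ := γ) (z.1 + -s • z.2)).ne'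
    field_simp
  · congr 2; ring

/-- By the group law it suffices to treat time 0. There the weight ratio differs from 1 by at most
`exp(γ V₀ |r|) - 1`, uniformly on the phase space (the lower side uses `exp a + exp(-a) ≥ 2`), and
the unweighted transport is continuous in `L¹`. -/
lemma continuous_transOp (hγ : 0 ≤ γ) (g : Dens d V₀) :
    Continuous fun r => transOp γ r g := by
  have h0 : ∀ g : Dens d V₀, Tendsto (fun r => transOp γ r g) (𝓝 0) (𝓝 g) := by
    intro g
    rw [tendsto_iff_norm_sub_tendsto_zero]
    refine squeeze_zero (g := fun r => (Real.exp (γ * V₀ * |r|) - 1) * ‖g‖ + ‖shiftOp r g - g‖)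
      (fun _ => norm_nonneg _) (fun r => ?_) ?_
    · have hM : Bdd V₀ (fun z : E d × E d => weightRatio γ r z - 1) :=
        (bdd_weightRatio hγ r).sub (Bdd.const 1)
      have h1 : transOp γ r g - g =
          mulOp (fun z => weightRatio γ r z - 1) (shiftOp r g) + (shiftOp r g - g) := by
        rw [← sub_eq_zero]
        have : transOp γ r g = mulOp (fun z => weightRatio γ r z - 1) (shiftOp r g) +
            shiftOp r g := by
          refine Lp.ext ?_
          refine EventuallyEq.trans ?_ (Lp.coeFn_add _ _).symm
          filter_upwards [coeFn_mulOp (bdd_weightRatio hγ r) (shiftOp r g),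
            coeFn_mulOp hM (shiftOp r g)] with z hz hz2
          rw [transOp, ContinuousLinearMap.comp_apply, hz, Pi.add_apply, hz2]
          ring
        rw [this]; abel
      rw [h1]
      refine (norm_add_le _ _).trans (add_le_add_left ?_ _)
      rw [← norm_shiftOp r g]
      refine norm_mulOp_le hM (fun z hz => ?_) _
      rw [abs_le]
      refine ⟨?_, by linarith [weightRatio_le hγ r hz]⟩
      have h2 := le_weightRatio hγ r hz
      have h3 := Real.add_one_le_exp (γ * V₀ * |r|)
      have h4 := Real.add_one_le_exp (-(γ * V₀ * |r|))
      linarith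
    · have h1 : Tendsto (fun r => ‖shiftOp r g - g‖) (𝓝 0) (𝓝 ‖shiftOp (V₀ := V₀) 0 g - g‖) :=
        (((continuous_shiftOp g).tendsto 0).sub_const g).norm
      have h2 : shiftOp (V₀ := V₀) 0 g = g := by
        refine Lp.ext ((coeFn_shiftOp 0 g).trans (Eventually.of_forall fun z => ?_))
        simp [flow_zero]
      rw [h2, sub_self, norm_zero] at h1
      have h3 : Continuous fun r => (Real.exp (γ * V₀ * |r|) - 1) * ‖g‖ := by fun_prop
      have h4 := (h3.tendsto 0).add h1
      simpa using h4
  rw [continuous_iff_continuousAt]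
  intro t
  have h1 : Tendsto (fun r => transOp γ (r - t) g) (𝓝 t) (𝓝 g) := by
    refine (h0 g).comp ?_
    have h2 : Continuous fun r : ℝ => r - t := by fun_prop
    simpa using h2.tendsto t
  have h2 := ((transOp γ t).continuous.tendsto g).comp h1
  refine h2.congr fun r => ?_
  simp only [Function.comp]
  rw [← transOp_add hγ, add_sub_cancel]

theorem isGroupOp_transOp (hγ : 0 ≤ γ) (hV₀ : 0 ≤ V₀) :
    IsGroupOp (transOp γ : ℝ → Dens d V₀ →L[ℝ] Dens d V₀) (γ * V₀) where
  zero := transOp_zero hγ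
  add := transOp_add hγ
  cont := continuous_transOp hγ
  bound := norm_transOp_le hγ
  nonneg := mul_nonneg hγ hV₀

lemma Bdd.comp_flow {ψ : E d × E d → ℝ} (h : Bdd V₀ ψ) (r : ℝ) :
    Bdd V₀ (fun z => ψ (flow r z)) := by
  obtain ⟨C, hC⟩ := h.bound
  exact ⟨h.meas.comp (continuous_flow r).measurable, C, fun z hz => hC _ hz⟩

lemma integral_comp_flow {f : E d × E d → ℝ} (hf : AEStronglyMeasurable f (phase d V₀)) (r : ℝ) :
    ∫ z, f (flow r z) ∂(phase d V₀) = ∫ z, f z ∂(phase d V₀) := by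
  have h1 := measurePreserving_flow (V₀ := V₀) (d := d) r
  conv_rhs => rw [← h1.map_eq]
  rw [← h1.map_eq] at hf
  exact (integral_map h1.measurable.aemeasurable hf).symm

lemma pair_transOp (hγ : 0 ≤ γ) {ψ : E d × E d → ℝ} (h : Bdd V₀ ψ) (r : ℝ) (g : Dens d V₀) :
    pair ψ (transOp γ r g) = pair (fun z => weightRatio γ r (flow r z) * ψ (flow r z)) g := by
  rw [pair_apply h, pair_apply (((bdd_weightRatio hγ r).mul h).comp_flow r)]
  have h1 := (measurePreserving_flow (V₀ := V₀) (d := d) r)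
  have h2 : AEStronglyMeasurable (fun z => ψ z * transOp γ r g z) (phase d V₀) :=
    (integrable_mul_dens h _).aestronglyMeasurable
  have h3 : ∫ z, ψ z * transOp γ r g z ∂(phase d V₀) =
      ∫ z, ψ (flow r z) * transOp γ r g (flow r z) ∂(phase d V₀) :=
    (integral_comp_flow h2 r).symm
  rw [h3]
  refine integral_congr_ae ?_
  filter_upwards [h1.quasiMeasurePreserving.ae_eq_comp (coeFn_transOp hγ r g)] with z hz
  simp only [Function.comp] at hz
  rw [hz, flow_flow, add_neg_cancel, flow_zero]
  ring

end Transport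

/-! ### Differentiating pairings along the transport group -/

section Generator

/-- `w` is dominated by the weight and differentiable along the free transport, with derivative `Dw`
dominated by the weight. -/
structure FlowDiff (V₀ γ : ℝ) (w Dw : E d × E d → ℝ) : Prop where
  bdd : Bdd V₀ fun z => (weight γ z.1)⁻¹ * w z
  bdd_deriv : Bdd V₀ fun z => (weight γ z.1)⁻¹ * Dw z
  deriv : ∀ z : E d × E d, z.2 ∈ velocities d V₀ → HasDerivAt (fun r => w (flow r z)) (Dw z) 0

variable (γ) in
/-- Integration against a function dominated by the weight. -/
noncomputable def wpair (w : E d × E d → ℝ) : Dens d V₀ →L[ℝ] ℝ :=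
  pair fun z => (weight γ z.1)⁻¹ * w z

lemma FlowDiff.hasDerivAt {w Dw : E d × E d → ℝ} (h : FlowDiff V₀ γ w Dw) {z : E d × E d}
    (hz : z.2 ∈ velocities d V₀) (r : ℝ) :
    HasDerivAt (fun r => w (flow r z)) (Dw (flow r z)) r := by
  have h0 : HasDerivAt (fun s => w (flow s (flow r z))) (Dw (flow r z)) (r - r) := by
    rw [sub_self]; exact h.deriv _ hz
  refine (h0.comp_sub_const r r).congr_of_eventuallyEq (Eventually.of_forall fun s => ?_)
  simp [flow_flow]

/-- Since the flow preserves the measure, it can be moved onto `w`, so no regularity of `g` is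
needed. Differentiation under the integral is dominated for `|r| < 1`, because the weight changes by
a bounded factor along the flow. -/
theorem hasDerivAt_wpair_transOp (hγ : 0 ≤ γ) {w Dw : E d × E d → ℝ}
    (h : FlowDiff V₀ γ w Dw) (g : Dens d V₀) :
    HasDerivAt (fun r => wpair γ w (transOp γ r g)) (wpair γ Dw g) 0 := by
  have h1 : ∀ r, wpair γ w (transOp γ r g) =
      ∫ z, (weight γ z.1)⁻¹ * w (flow r z) * g z ∂(phase d V₀) := by
    intro r
    rw [wpair, pair_transOp hγ h.bdd, pair_apply (((bdd_weightRatio hγ r).mul h.bdd).comp_flow r)]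
    refine integral_congr_ae (Eventually.of_forall fun z => ?_)
    simp only
    rw [weightRatio_flow, flow_fst]
    have := (weight_pos (γ := γ) (z.1 + r • z.2)).ne'
    field_simp
  have hint : ∀ r, Integrable (fun z => (weight γ z.1)⁻¹ * w (flow r z) * g z) (phase d V₀) := by
    intro r
    refine (integrable_mul_dens (((bdd_weightRatio hγ r).mul h.bdd).comp_flow r) g).congr
      (Eventually.of_forall fun z => ?_)
    simp only
    rw [weightRatio_flow, flow_fst]
    have := (weight_pos (γ := γ) (z.1 + r • z.2)).ne'
    field_simp
  obtain ⟨C, hC0, hC⟩ := h.bdd_deriv.exists_nonneg_bound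
  have h2 := hasDerivAt_integral_of_dominated_loc_of_deriv_le (μ := phase d V₀)
    (F := fun r z => (weight γ z.1)⁻¹ * w (flow r z) * g z)
    (F' := fun r z => (weight γ z.1)⁻¹ * Dw (flow r z) * g z)
    (bound := fun z => Real.exp (γ * V₀ * 1) * C * |g z|) (x₀ := 0)
    (s := Metric.ball (0 : ℝ) 1) (Metric.ball_mem_nhds _ one_pos)
    (Eventually.of_forall fun r => (hint r).aestronglyMeasurable) (hint 0) ?_ ?_ ?_ ?_
  · have h3 : wpair γ Dw g = ∫ z, (weight γ z.1)⁻¹ * Dw (flow 0 z) * g z ∂(phase d V₀) := by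
      rw [wpair, pair_apply h.bdd_deriv]
      simp only [flow_zero]
    rw [h3]
    exact h2.2.congr_of_eventuallyEq (Eventually.of_forall h1)
  · simp only [flow_zero]
    exact (integrable_mul_dens h.bdd_deriv g).aestronglyMeasurable
  · filter_upwards [ae_mem_velocities] with z hz r hr
    rw [Metric.mem_ball, Real.dist_eq, sub_zero] at hr
    rw [norm_mul, Real.norm_eq_abs, Real.norm_eq_abs]
    refine mul_le_mul_of_nonneg_right ?_ (abs_nonneg _)
    have h4 : (weight γ z.1)⁻¹ * Dw (flow r z) = ((weight γ z.1)⁻¹ * weight γ (z.1 + r • z.2)) *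
        ((weight γ (flow r z).1)⁻¹ * Dw (flow r z)) := by
      rw [flow_fst]
      have := (weight_pos (γ := γ) (z.1 + r • z.2)).ne'
      field_simp
    rw [h4, abs_mul, abs_of_pos (mul_pos (inv_pos.2 (weight_pos _)) (weight_pos _))]
    refine mul_le_mul ?_ (hC _ hz) (abs_nonneg _) (Real.exp_pos _).le
    refine (weight_div_le hγ (norm_le_of_mem_velocities hz) _ _).trans (Real.exp_le_exp.2 ?_)
    have hV : 0 ≤ V₀ := (norm_nonneg _).trans (norm_le_of_mem_velocities hz)
    exact mul_le_mul_of_nonneg_left hr.le (mul_nonneg hγ hV)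
  · exact (integrable_dens g).abs.const_mul _
  · filter_upwards [ae_mem_velocities] with z hz r _
    exact ((h.hasDerivAt hz r).const_mul _).mul_const _

end Generator

end Operators

/-! ### The corrected weight and its Lyapunov inequality -/

section Lyapunov

variable {d : ℕ} {V₀ χ γ : ℝ}

/-- The numerator of the corrector: a smooth version of `s - χ |s|` for `s = x · v`. -/
noncomputable def softPart (χ s : ℝ) : ℝ := s - χ * Real.sqrt (1 + s ^ 2)

/-- The first order corrector of the weight. -/
noncomputable def corrector (χ : ℝ) (z : E d × E d) : ℝ :=
  softPart χ (inner ℝ z.1 z.2) / ((1 - χ ^ 2) * bracket z.1)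

/-- The derivative of the corrector along the free transport. -/
noncomputable def correctorDeriv (χ : ℝ) (z : E d × E d) : ℝ :=
  ((‖z.2‖ ^ 2 - χ * (inner ℝ z.1 z.2 * ‖z.2‖ ^ 2 / Real.sqrt (1 + (inner ℝ z.1 z.2) ^ 2))) /
      bracket z.1 -
    softPart χ (inner ℝ z.1 z.2) * inner ℝ z.1 z.2 / bracket z.1 ^ 3) / (1 - χ ^ 2)

/-- The modified weight. -/
noncomputable def lyapunov (χ γ : ℝ) (z : E d × E d) : ℝ :=
  weight γ z.1 * (1 + γ * corrector χ z)

/-- The derivative of the modified weight along the free transport. -/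
noncomputable def lyapunovDeriv (χ γ : ℝ) (z : E d × E d) : ℝ :=
  weight γ z.1 * (γ * (inner ℝ z.1 z.2 / bracket z.1) * (1 + γ * corrector χ z) +
    γ * correctorDeriv χ z)

lemma one_le_sqrt_one_add (s : ℝ) : 1 ≤ Real.sqrt (1 + s ^ 2) := by
  rw [Real.one_le_sqrt]; nlinarith [sq_nonneg s]

lemma abs_le_sqrt_one_add (s : ℝ) : |s| ≤ Real.sqrt (1 + s ^ 2) :=
  Real.abs_le_sqrt (by linarith)

lemma sqrt_one_add_le (s : ℝ) : Real.sqrt (1 + s ^ 2) ≤ 1 + |s| := by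
  rw [Real.sqrt_le_left (by positivity)]
  nlinarith [abs_nonneg s, sq_abs s]

lemma continuous_corrector : Continuous (corrector χ : E d × E d → ℝ) := by
  by_cases h : 1 - χ ^ 2 = 0
  · have : (corrector χ : E d × E d → ℝ) = fun _ => 0 := by
      funext z; simp [corrector, h]
    rw [this]; exact continuous_const
  unfold corrector softPart
  refine Continuous.div (by fun_prop) ?_ fun z => mul_ne_zero h (bracket_pos _).ne'
  exact (continuous_bracket.comp continuous_fst).const_mul _

lemma continuous_correctorDeriv : Continuous (correctorDeriv χ : E d × E d → ℝ) := by
  unfold correctorDeriv softPart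
  have hb : Continuous fun z : E d × E d => bracket z.1 := continuous_bracket.comp continuous_fst
  refine Continuous.div_const (Continuous.sub (Continuous.div (Continuous.sub (by fun_prop)
    (Continuous.const_mul (Continuous.div (by fun_prop) (by fun_prop) fun z => ?_) _)) hb
    fun z => (bracket_pos _).ne') (Continuous.div (by fun_prop) (by fun_prop)
    fun z => (pow_pos (bracket_pos _) 3).ne')) _
  exact (one_pos.trans_le (one_le_sqrt_one_add _)).ne'

lemma hasDerivAt_bracket (z : E d × E d) :
    HasDerivAt (fun r => bracket (flow r z).1) (inner ℝ z.1 z.2 / bracket z.1) 0 := by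
  have h1 : ∀ r : ℝ, 1 + ‖(flow r z).1‖ ^ 2 =
      1 + (‖z.1‖ ^ 2 + 2 * (r * inner ℝ z.1 z.2) + r ^ 2 * ‖z.2‖ ^ 2) := by
    intro r
    rw [flow_fst, norm_add_sq_real, inner_smul_right, norm_smul, mul_pow, Real.norm_eq_abs, sq_abs]
  have h2 : HasDerivAt (fun r : ℝ => 1 + ‖(flow r z).1‖ ^ 2) (2 * inner ℝ z.1 z.2) 0 := by
    simp only [h1]
    have h3 : HasDerivAt (fun r : ℝ => r) 1 0 := hasDerivAt_id 0
    have h4 := ((((h3.mul_const (inner ℝ z.1 z.2)).const_mul 2).const_add (‖z.1‖ ^ 2)).add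
      ((h3.pow 2).mul_const (‖z.2‖ ^ 2))).const_add 1
    refine h4.congr_deriv ?_
    simp
  have h5 := h2.sqrt (by rw [flow_zero]; positivity)
  refine h5.congr_deriv ?_
  rw [flow_zero, mul_div_mul_left _ _ two_ne_zero]
  rfl

lemma hasDerivAt_inner_flow (z : E d × E d) :
    HasDerivAt (fun r => (inner ℝ (flow r z).1 (flow r z).2 : ℝ)) (‖z.2‖ ^ 2) 0 := by
  have h1 : ∀ r : ℝ, (inner ℝ (flow r z).1 (flow r z).2 : ℝ) = inner ℝ z.1 z.2 + r * ‖z.2‖ ^ 2 := by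
    intro r
    rw [flow_fst, flow_snd, inner_add_left, real_inner_smul_left, real_inner_self_eq_norm_sq]
  simp only [h1]
  simpa using ((hasDerivAt_id (0 : ℝ)).mul_const (‖z.2‖ ^ 2)).const_add (inner ℝ z.1 z.2)

/-- Differentiability where `x · v = 0` is the reason for `√(1 + s²)` in place of `|s|`; the
replacement costs at most 1 in the numerator of the corrector, up to the factor `χ`. -/
lemma hasDerivAt_corrector (hχ : 1 - χ ^ 2 ≠ 0) (z : E d × E d) :
    HasDerivAt (fun r => corrector χ (flow r z)) (correctorDeriv χ z) 0 := by
  have hs := hasDerivAt_inner_flow z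
  have hb := hasDerivAt_bracket z
  have h0 : (1 : ℝ) + (inner ℝ (flow 0 z).1 (flow 0 z).2) ^ 2 ≠ 0 := by positivity
  have hS := ((hs.pow 2).const_add 1).sqrt h0
  have h1 := (hs.sub (hS.const_mul χ)).div (hb.const_mul (1 - χ ^ 2))
    (mul_ne_zero hχ (bracket_pos _).ne')
  refine h1.congr_deriv ?_
  simp only [flow_zero, correctorDeriv, softPart, Pi.sub_apply, Pi.pow_apply]
  have hb0 := (bracket_pos z.1).ne'
  have hS0 : Real.sqrt (1 + (inner ℝ z.1 z.2) ^ 2) ≠ 0 :=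
    (one_pos.trans_le (one_le_sqrt_one_add _)).ne'
  field_simp
  push_cast
  ring

lemma hasDerivAt_lyapunov (hχ : 1 - χ ^ 2 ≠ 0) (z : E d × E d) :
    HasDerivAt (fun r => lyapunov χ γ (flow r z)) (lyapunovDeriv χ γ z) 0 := by
  have h1 := ((hasDerivAt_bracket z).const_mul γ).exp.mul
    (((hasDerivAt_corrector hχ z).const_mul γ).const_add 1)
  refine h1.congr_deriv ?_
  simp only [flow_zero, lyapunovDeriv, weight_eq]
  ring

variable [hχ : Fact (χ ∈ Ioo (0 : ℝ) 1)]

lemma one_sub_sq_pos : 0 < 1 - χ ^ 2 := by nlinarith [hχ.out.1, hχ.out.2]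

lemma abs_inner_le {z : E d × E d} (hz : z.2 ∈ velocities d V₀) :
    |(inner ℝ z.1 z.2 : ℝ)| ≤ V₀ * bracket z.1 := by
  refine (abs_real_inner_le_norm _ _).trans ?_
  rw [mul_comm]
  exact mul_le_mul (norm_le_of_mem_velocities hz) (norm_le_bracket _) (norm_nonneg _)
    ((norm_nonneg _).trans (norm_le_of_mem_velocities hz))

lemma abs_softPart_le (s : ℝ) : |softPart χ s| ≤ 2 * |s| + 1 := by
  have h1 := sqrt_one_add_le s
  have h2 := one_le_sqrt_one_add s
  have h3 : |softPart χ s| ≤ |s| + |χ * Real.sqrt (1 + s ^ 2)| := abs_sub _ _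
  rw [abs_of_nonneg (mul_nonneg hχ.out.1.le (by positivity))] at h3
  nlinarith [hχ.out.1, hχ.out.2]

lemma abs_corrector_le {z : E d × E d} (hz : z.2 ∈ velocities d V₀) :
    |corrector χ z| ≤ (2 * V₀ + 1) / (1 - χ ^ 2) := by
  have hb := one_le_bracket z.1
  have hJ := one_sub_sq_pos (χ := χ)
  have h1 := abs_softPart_le (χ := χ) (inner ℝ z.1 z.2)
  have h2 := abs_inner_le hz
  rw [corrector, abs_div, abs_of_pos (mul_pos hJ (bracket_pos _)),
    div_le_div_iff₀ (mul_pos hJ (bracket_pos _)) hJ]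
  have h3 : |softPart χ (inner ℝ z.1 z.2)| ≤ (2 * V₀ + 1) * bracket z.1 := by linarith
  nlinarith

/-- The numerator of the corrector has a bounded derivative along the flow, and differentiating
`1/⟨x⟩` gains one power of `⟨x⟩`. The result is an error term that is negligible at infinity. -/
lemma abs_correctorDeriv_le {z : E d × E d} (hz : z.2 ∈ velocities d V₀) :
    |correctorDeriv χ z| ≤ (4 * V₀ ^ 2 + V₀) / (1 - χ ^ 2) / bracket z.1 := by
  have hb := one_le_bracket z.1
  have hb0 := bracket_pos z.1
  have hJ := one_sub_sq_pos (χ := χ)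
  have h1 := abs_softPart_le (χ := χ) (inner ℝ z.1 z.2)
  have h2 := abs_inner_le hz
  have hV : 0 ≤ V₀ := (norm_nonneg _).trans (norm_le_of_mem_velocities hz)
  have hn : ‖z.2‖ ^ 2 ≤ V₀ ^ 2 := pow_le_pow_left₀ (norm_nonneg _) (norm_le_of_mem_velocities hz) 2
  set s : ℝ := inner ℝ z.1 z.2
  set S := Real.sqrt (1 + s ^ 2)
  have hS : 1 ≤ S := one_le_sqrt_one_add s
  have hsS : |s| ≤ S := abs_le_sqrt_one_add s
  set b := bracket z.1
  have h3 : |‖z.2‖ ^ 2 - χ * (s * ‖z.2‖ ^ 2 / S)| ≤ 2 * V₀ ^ 2 := by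
    have h4 : |χ * (s * ‖z.2‖ ^ 2 / S)| ≤ V₀ ^ 2 := by
      have h5 : |s| / S ≤ 1 := (div_le_one (by linarith)).2 hsS
      have h6 : χ * (s * ‖z.2‖ ^ 2 / S) = χ * (s / S) * ‖z.2‖ ^ 2 := by ring
      rw [h6, abs_mul, abs_mul, abs_of_pos hχ.out.1, abs_div, abs_of_pos (by linarith : 0 < S),
        abs_of_nonneg (by positivity : 0 ≤ ‖z.2‖ ^ 2)]
      have h7 : χ * (|s| / S) ≤ 1 := mul_le_one₀ hχ.out.2.le (by positivity) h5
      calc χ * (|s| / S) * ‖z.2‖ ^ 2 ≤ 1 * ‖z.2‖ ^ 2 :=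
            mul_le_mul_of_nonneg_right h7 (by positivity)
        _ ≤ _ := by linarith
    refine (abs_sub _ _).trans ?_
    rw [abs_of_nonneg (by positivity : 0 ≤ ‖z.2‖ ^ 2)]
    linarith
  have h8 : |softPart χ s * s / b ^ 3| ≤ (2 * V₀ ^ 2 + V₀) / b := by
    rw [abs_div, abs_mul, abs_of_pos (by positivity : 0 < b ^ 3), div_le_div_iff₀ (by positivity) hb0]
    have h9 : |softPart χ s| * |s| ≤ ((2 * V₀ + 1) * b) * (V₀ * b) :=
      mul_le_mul (by linarith) h2 (abs_nonneg _) (by positivity)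
    calc |softPart χ s| * |s| * b ≤ ((2 * V₀ + 1) * b) * (V₀ * b) * b :=
          mul_le_mul_of_nonneg_right h9 hb0.le
      _ = _ := by ring
  rw [correctorDeriv, abs_div, abs_of_pos hJ, div_div, mul_comm (1 - χ ^ 2), ← div_div]
  refine div_le_div_of_nonneg_right ?_ hJ.le
  refine (abs_sub _ _).trans ?_
  rw [abs_div, abs_of_pos hb0]
  calc _ ≤ 2 * V₀ ^ 2 / b + (2 * V₀ ^ 2 + V₀) / b :=
        add_le_add (div_le_div_of_nonneg_right h3 hb0.le) h8
    _ = _ := by ring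

lemma flowDiff_lyapunov (hV₀ : 0 ≤ V₀) :
    FlowDiff V₀ γ (lyapunov χ γ : E d × E d → ℝ) (lyapunovDeriv χ γ) where
  bdd := by
    have h1 : (fun z : E d × E d => (weight γ z.1)⁻¹ * lyapunov χ γ z) =
        fun z => 1 + γ * corrector χ z := by
      funext z
      rw [lyapunov, inv_mul_cancel_left₀ (weight_pos _).ne']
    rw [h1]
    exact (Bdd.const 1).add ((Bdd.const γ).mul
      ⟨continuous_corrector.measurable, _, fun z hz => abs_corrector_le hz⟩)
  bdd_deriv := by
    have h1 : (fun z : E d × E d => (weight γ z.1)⁻¹ * lyapunovDeriv χ γ z) =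
        fun z => γ * (inner ℝ z.1 z.2 / bracket z.1) * (1 + γ * corrector χ z) +
          γ * correctorDeriv χ z := by
      funext z
      rw [lyapunovDeriv, inv_mul_cancel_left₀ (weight_pos _).ne']
    rw [h1]
    have hc : Bdd V₀ (corrector χ : E d × E d → ℝ) :=
      ⟨continuous_corrector.measurable, _, fun z hz => abs_corrector_le hz⟩
    have hd : Bdd V₀ (correctorDeriv χ : E d × E d → ℝ) := by
      refine ⟨continuous_correctorDeriv.measurable, _, fun z hz =>
        (abs_correctorDeriv_le hz).trans (div_le_self ?_ (one_le_bracket _))⟩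
      exact div_nonneg (by positivity) one_sub_sq_pos.le
    have hi : Bdd V₀ (fun z : E d × E d => (inner ℝ z.1 z.2 : ℝ) / bracket z.1) := by
      refine ⟨(Continuous.div (by fun_prop) (continuous_bracket.comp continuous_fst)
        fun z => (bracket_pos _).ne').measurable, V₀, fun z hz => ?_⟩
      rw [abs_div, abs_of_pos (bracket_pos _), div_le_iff₀ (bracket_pos _)]
      exact abs_inner_le hz
    exact (((Bdd.const γ).mul hi).mul ((Bdd.const 1).add ((Bdd.const γ).mul hc))).add
      ((Bdd.const γ).mul hd)
  deriv := fun z _ => hasDerivAt_lyapunov one_sub_sq_pos.ne' z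

/-- The odd part `x · v` averages to zero over the centered ball. What remains is `-χ √(1 + s²) ≤ -χ
|s|`, whose mean is controlled by the first moment: this is the negative drift. -/
lemma avgFun_corrector_le {κ : ℝ}
    (hκ : ∀ x : E d, κ * ‖x‖ ≤ ∫ v, |(inner ℝ x v : ℝ)| ∂(vel d V₀)) (z : E d × E d) :
    avgFun V₀ (corrector χ) z ≤ -(χ * (κ * ‖z.1‖)) / ((1 - χ ^ 2) * bracket z.1) := by
  have h1 : avgFun V₀ (corrector χ) z =
      (∫ v, softPart χ (inner ℝ z.1 v) ∂(vel d V₀)) / ((1 - χ ^ 2) * bracket z.1) := by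
    simp only [avgFun, corrector]
    exact integral_div _ _
  rw [h1]
  refine div_le_div_of_nonneg_right ?_ (mul_pos one_sub_sq_pos (bracket_pos _)).le
  have hc1 : Integrable (fun v => (inner ℝ z.1 v : ℝ)) (vel d V₀) :=
    integrable_vel_of_continuous (by fun_prop)
  have hc2 : Integrable (fun v => χ * Real.sqrt (1 + (inner ℝ z.1 v) ^ 2)) (vel d V₀) :=
    integrable_vel_of_continuous (by fun_prop)
  have hc3 : Integrable (fun v => χ * |(inner ℝ z.1 v : ℝ)|) (vel d V₀) :=
    integrable_vel_of_continuous (by fun_prop)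
  unfold softPart
  rw [integral_sub hc1 hc2, integral_vel_inner, zero_sub, neg_le_neg_iff]
  calc χ * (κ * ‖z.1‖) ≤ χ * ∫ v, |(inner ℝ z.1 v : ℝ)| ∂(vel d V₀) :=
        mul_le_mul_of_nonneg_left (hκ _) hχ.out.1.le
    _ = ∫ v, χ * |(inner ℝ z.1 v : ℝ)| ∂(vel d V₀) := (integral_const_mul _ _).symm
    _ ≤ _ := integral_mono hc3 hc2 fun v =>
        mul_le_mul_of_nonneg_left (abs_le_sqrt_one_add _) hχ.out.1.le

variable (d V₀ χ) [hV : Fact (volume (velocities d V₀) = 1)] in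
/-- The modified weight is comparable with the weight and decreases along the dual flow, up to a
bounded term. -/
theorem exists_lyapunov : ∃ γs : ℝ, 0 < γs ∧ ∀ γ ∈ Ioo 0 γs, ∃ w Dw : E d × E d → ℝ,
    FlowDiff V₀ γ w Dw ∧
    (∀ z : E d × E d, z.2 ∈ velocities d V₀ →
      1 / 2 ≤ (weight γ z.1)⁻¹ * w z ∧ (weight γ z.1)⁻¹ * w z ≤ 3 / 2) ∧
    ∃ α β : ℝ, 0 < α ∧ 0 ≤ β ∧ ∀ z : E d × E d, z.2 ∈ velocities d V₀ →
      (weight γ z.1)⁻¹ * Dw z + turning χ z.1 z.2 *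
        (avgFun V₀ (fun z => (weight γ z.1)⁻¹ * w z) z - (weight γ z.1)⁻¹ * w z) ≤
      -α * ((weight γ z.1)⁻¹ * w z) + β * (weight γ z.1)⁻¹ := by
  have hV₀ : 0 < V₀ := radius_pos (d := d)
  obtain ⟨κ, hκ0, hκ⟩ := exists_abs_inner_moment (d := d) (V₀ := V₀)
  have hJ := one_sub_sq_pos (χ := χ)
  have hχ0 := hχ.out.1
  have hχ1 := hχ.out.2
  set J := 1 - χ ^ 2 with hJdef
  set c := (1 - χ) * (χ * κ) / J with hc
  have hc0 : 0 < c := div_pos (mul_pos (by linarith) (mul_pos hχ0 hκ0)) hJ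
  set C₁ := (2 * V₀ + 1) / J with hC₁
  have hC₁0 : 0 < C₁ := by positivity
  set C₂ := (4 * V₀ ^ 2 + V₀) / J with hC₂
  have hC₂0 : 0 < C₂ := by positivity
  set C₃ := 2 / J + c + C₂ with hC₃
  have hC₃0 : 0 < C₃ := by positivity
  -- The first threshold gives `γ |p| ≤ 1/2`, hence the comparison of `w` with the weight; the
  -- second keeps the term of second order in `γ` below a quarter of the drift.
  refine ⟨min (1 / (2 * C₁)) (c / (4 * (V₀ * C₁))), by positivity, fun γ hγ => ?_⟩
  have hγ0 : 0 < γ := hγ.1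
  have hγ1 : γ * C₁ ≤ 1 / 2 := by
    have := (lt_min_iff.1 hγ.2).1.le
    rw [le_div_iff₀ (by positivity)] at this
    linarith
  have hγ2 : γ * (V₀ * C₁) ≤ c / 4 := by
    have := (lt_min_iff.1 hγ.2).2.le
    rw [le_div_iff₀ (by positivity)] at this
    linarith
  have hw : ∀ z : E d × E d, (weight γ z.1)⁻¹ * lyapunov χ γ z = 1 + γ * corrector χ z := by
    intro z
    rw [lyapunov, inv_mul_cancel_left₀ (weight_pos _).ne']
  have hDw : ∀ z : E d × E d, (weight γ z.1)⁻¹ * lyapunovDeriv χ γ z =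
      γ * (inner ℝ z.1 z.2 / bracket z.1) * (1 + γ * corrector χ z) + γ * correctorDeriv χ z := by
    intro z
    rw [lyapunovDeriv, inv_mul_cancel_left₀ (weight_pos _).ne']
  have hbd : ∀ z : E d × E d, z.2 ∈ velocities d V₀ →
      1 / 2 ≤ 1 + γ * corrector χ z ∧ 1 + γ * corrector χ z ≤ 3 / 2 := by
    intro z hz
    have h1 : |γ * corrector χ z| ≤ 1 / 2 := by
      rw [abs_mul, abs_of_pos hγ0]
      exact (mul_le_mul_of_nonneg_left (abs_corrector_le hz) hγ0.le).trans hγ1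
    have := abs_le.1 h1
    constructor <;> linarith
  have havg : ∀ z : E d × E d, avgFun V₀ (fun z => 1 + γ * corrector χ z) z =
      1 + γ * avgFun V₀ (corrector χ) z := by
    intro z
    have hi : Integrable (fun v => corrector χ (z.1, v)) (vel d V₀) :=
      integrable_vel_of_continuous (continuous_corrector.comp (by fun_prop))
    simp only [avgFun]
    rw [integral_add (integrable_const _) (hi.const_mul γ), integral_const_mul]
    simp
  refine ⟨lyapunov χ γ, lyapunovDeriv χ γ, flowDiff_lyapunov hV₀.le, fun z hz => ?_, ?_⟩
  · rw [hw]; exact hbd z hz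
  -- The errors sum to `C₃/⟨x⟩`. For `⟨x⟩ ≥ 4 C₃/c` they are at most `c/4`; below this radius the
  -- weight is at most the exponential written here, so `β/m ≥ C₃`.
  set β := C₃ * Real.exp (γ * (4 * C₃ / c)) with hβ
  have hβ0 : 0 < β := by positivity
  -- The decay obtained below is `γ c/2`, and `w/m ≤ 3/2`; this leaves the rate `γ c/3` relative to
  -- `w`.
  refine ⟨γ * c / 3, γ * β, by positivity, by positivity, fun z hz => ?_⟩
  simp only [hw, hDw, havg]
  set b := bracket z.1 with hb
  have hb1 : 1 ≤ b := one_le_bracket z.1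
  have hb0 : 0 < b := bracket_pos z.1
  set s : ℝ := inner ℝ z.1 z.2 with hs
  set K := turning χ z.1 z.2 with hK
  have hK2 : K ≤ 2 := turning_le_two _ _
  have hK1 : 1 - χ ≤ K := le_turning _ _
  have hK0 : 0 < K := turning_pos _ _
  set p := corrector χ z with hp
  -- The cancellation for which `p` was designed: only the smoothing error `√(1 + s²) - |s| ≤ 1`
  -- survives.
  have e1 : s / b - K * p ≤ 2 / J / b := by
    have h1 : K * (s - χ * |s|) = J * s := turning_mul_eq z.1 z.2
    have h2 : s / b - K * p = K * χ * (Real.sqrt (1 + s ^ 2) - |s|) / (J * b) := by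
      have : p = softPart χ s / (J * b) := rfl
      rw [this, softPart, eq_div_iff (by positivity)]
      field_simp
      linear_combination -h1
    rw [h2, div_div]
    refine div_le_div_of_nonneg_right ?_ (by positivity)
    have h3 : Real.sqrt (1 + s ^ 2) - |s| ≤ 1 := by linarith [sqrt_one_add_le s]
    have h4 : 0 ≤ Real.sqrt (1 + s ^ 2) - |s| := by linarith [abs_le_sqrt_one_add s]
    have h5 : K * χ ≤ 2 * 1 := mul_le_mul hK2 hχ1.le hχ0.le (by norm_num)
    nlinarith
  have e2 : K * avgFun V₀ (corrector χ) z ≤ -c + c / b := by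
    have h1 := avgFun_corrector_le (χ := χ) hκ z
    rw [← hJdef, ← hb] at h1
    have h2 : b - 1 ≤ ‖z.1‖ := by linarith [bracket_le z.1]
    have h3 : -(χ * (κ * ‖z.1‖)) / (J * b) ≤ -(χ * (κ * (b - 1))) / (J * b) := by
      refine div_le_div_of_nonneg_right ?_ (by positivity)
      rw [neg_le_neg_iff]
      gcongr
    have h4 : -(χ * (κ * (b - 1))) / (J * b) ≤ 0 :=
      div_nonpos_of_nonpos_of_nonneg (by
        have : 0 ≤ χ * (κ * (b - 1)) := by
          have : 0 ≤ b - 1 := by linarith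
          positivity
        linarith) (by positivity)
    calc K * avgFun V₀ (corrector χ) z ≤ K * (-(χ * (κ * (b - 1))) / (J * b)) :=
          mul_le_mul_of_nonneg_left (h1.trans h3) hK0.le
      _ ≤ (1 - χ) * (-(χ * (κ * (b - 1))) / (J * b)) :=
          mul_le_mul_of_nonpos_right hK1 h4
      _ = -c + c / b := by
          rw [hc]; field_simp; ring
  have e3 : correctorDeriv χ z ≤ C₂ / b := (le_abs_self _).trans (abs_correctorDeriv_le hz)
  have e4 : γ * (s / b) * p ≤ c / 4 := by
    have h1 : |s / b| ≤ V₀ := by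
      rw [abs_div, abs_of_pos hb0, div_le_iff₀ hb0]
      exact abs_inner_le hz
    have h2 : (s / b) * p ≤ V₀ * C₁ := by
      refine (le_abs_self _).trans ?_
      rw [abs_mul]
      exact mul_le_mul h1 (abs_corrector_le hz) (abs_nonneg _) hV₀.le
    calc γ * (s / b) * p = γ * ((s / b) * p) := by ring
      _ ≤ γ * (V₀ * C₁) := mul_le_mul_of_nonneg_left h2 hγ0.le
      _ ≤ _ := hγ2
  have e5 : C₃ / b ≤ c / 4 + β * (weight γ z.1)⁻¹ := by
    have hm : 0 < (weight γ z.1)⁻¹ := inv_pos.2 (weight_pos _)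
    rcases le_total (4 * C₃ / c) b with h | h
    · have : C₃ / b ≤ c / 4 := by
        rw [div_le_iff₀ hc0] at h
        rw [div_le_div_iff₀ hb0 (by norm_num)]
        linarith
      have := mul_pos hβ0 hm
      linarith
    · have h1 : 1 ≤ Real.exp (γ * (4 * C₃ / c)) * (weight γ z.1)⁻¹ := by
        rw [weight_eq, ← Real.exp_neg, ← Real.exp_add]
        refine Real.one_le_exp ?_
        have := mul_le_mul_of_nonneg_left h hγ0.le
        linarith
      have h2 : C₃ / b ≤ C₃ := div_le_self hC₃0.le hb1
      have h3 : C₃ ≤ β * (weight γ z.1)⁻¹ := by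
        rw [hβ, mul_assoc]
        exact le_mul_of_one_le_right hC₃0.le h1
      linarith
  have e6 : 2 / J / b + c / b + C₂ / b = C₃ / b := by rw [hC₃]; ring
  -- The left side is the adjoint generator applied to `w`, divided by `γ m`. The drift `-c` pays
  -- `c/4` for the second-order term and `c/4` for the errors.
  have e7 : (s / b - K * p) + K * avgFun V₀ (corrector χ) z + correctorDeriv χ z +
      γ * (s / b) * p ≤ -(c / 2) + β * (weight γ z.1)⁻¹ := by linarith
  have e8 := mul_le_mul_of_nonneg_left e7 hγ0.le
  have e9 : γ * c / 3 * (1 + γ * p) ≤ γ * c / 3 * (3 / 2) :=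
    mul_le_mul_of_nonneg_left (hbd z hz).2 (by positivity)
  linarith

end Lyapunov

/-! ### Positivity, conservation of mass and the uniform weighted `L¹` bound -/

section Solution

set_option linter.unusedSectionVars false

variable {d : ℕ} {V₀ χ γ : ℝ}

lemma IsGroupOp.continuous_apply_sub {F : Type*} [NormedAddCommGroup F] [NormedSpace ℝ F]
    {U : ℝ → F →L[ℝ] F} {κ : ℝ} (hU : IsGroupOp U κ) {h : ℝ → F} (hh : Continuous h) (t : ℝ) :
    Continuous fun s => U (t - s) (h s) := by
  have h1 : Continuous fun r => U r (h (t - r)) :=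
    hU.continuous_apply (hh.comp (by fun_prop))
  have h2 := h1.comp (by fun_prop : Continuous fun s : ℝ => t - s)
  simpa [Function.comp_def] using h2

/-- Gronwall: `exp(α t) (Y - b/α)` is nonincreasing. The damping keeps the bound uniform in time. -/
lemma le_add_div_of_deriv_le {Y Y' : ℝ → ℝ} {α b : ℝ} (hα : 0 < α) (hb : 0 ≤ b)
    (hY : ∀ t, HasDerivAt Y (Y' t) t) (h : ∀ t, 0 ≤ t → Y' t ≤ -α * Y t + b)
    (hY0 : 0 ≤ Y 0) {t : ℝ} (ht : 0 ≤ t) : Y t ≤ Y 0 + b / α := by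
  have hd : ∀ t, HasDerivAt (fun t => Real.exp (α * t) * (Y t - b / α))
      (Real.exp (α * t) * (Y' t + α * Y t - b)) t := by
    intro t
    have h1 := (((hasDerivAt_id t).const_mul α).exp).mul ((hY t).sub_const (b / α))
    refine h1.congr_deriv ?_
    simp only [id]
    field_simp
    ring
  have hanti : AntitoneOn (fun t => Real.exp (α * t) * (Y t - b / α)) (Ici 0) := by
    refine antitoneOn_of_deriv_nonpos (convex_Ici 0)
      (fun t _ => (hd t).continuousAt.continuousWithinAt)
      (fun t _ => (hd t).differentiableAt.differentiableWithinAt) (fun t ht => ?_)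
    rw [interior_Ici] at ht
    rw [(hd t).deriv]
    exact mul_nonpos_of_nonneg_of_nonpos (Real.exp_pos _).le
      (by linarith [h t (le_of_lt (mem_Ioi.1 ht))])
  have h1 := hanti (mem_Ici.2 le_rfl) (mem_Ici.2 ht) ht
  simp only [mul_zero, Real.exp_zero, one_mul] at h1
  have h2 : 1 ≤ Real.exp (α * t) := Real.one_le_exp (by positivity)
  have h3 : 0 ≤ b / α := by positivity
  rcases le_total (Y t) (b / α) with h4 | h4
  · linarith
  · have : Y t - b / α ≤ Real.exp (α * t) * (Y t - b / α) :=
      le_mul_of_one_le_left (by linarith) h2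
    linarith

lemma integral_exp_neg_le {k : ℝ} (hk : 0 < k) (t : ℝ) :
    ∫ s in (0 : ℝ)..t, Real.exp (-(k * (t - s))) ≤ 1 / k := by
  have h : ∀ s, HasDerivAt (fun s => Real.exp (-(k * (t - s))) / k)
      (Real.exp (-(k * (t - s)))) s := by
    intro s
    have h1 : HasDerivAt (fun s => -(k * (t - s))) k s := by
      refine (((hasDerivAt_id s).const_sub t).const_mul k).neg.congr_deriv ?_
      ring
    refine (h1.exp.div_const k).congr_deriv ?_
    field_simp
  rw [intervalIntegral.integral_eq_sub_of_hasDerivAt (fun s _ => h s)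
    (Continuous.intervalIntegrable (by fun_prop) _ _)]
  simp only [sub_self, mul_zero, neg_zero, Real.exp_zero]
  have : 0 ≤ Real.exp (-(k * (t - 0))) / k := by positivity
  linarith

section SetFunctionals

/-- Integration over a set. -/
noncomputable def setPair (S : Set (E d × E d)) : Dens d V₀ →L[ℝ] ℝ :=
  pair (S.indicator fun _ => (1 : ℝ))

lemma setPair_apply {S : Set (E d × E d)} (hS : MeasurableSet S) (g : Dens d V₀) :
    setPair S g = ∫ z in S, g z ∂(phase d V₀) := by
  rw [setPair, pair_apply (Bdd.indicator_one hS), ← integral_indicator hS]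
  refine integral_congr_ae (Eventually.of_forall fun z => ?_)
  by_cases h : z ∈ S <;> simp [h]

lemma setPair_le {S : Set (E d × E d)} (hS : MeasurableSet S) (hS' : phase d V₀ S < ⊤)
    {g : Dens d V₀} {N : ℝ} (h : ∀ᵐ z ∂(phase d V₀), g z ≤ N) :
    setPair S g ≤ N * (phase d V₀).real S := by
  rw [setPair_apply hS]
  have h1 : ∫ _ in S, N ∂(phase d V₀) = N * (phase d V₀).real S := by
    rw [setIntegral_const, smul_eq_mul, mul_comm]
  rw [← h1]
  exact setIntegral_mono_ae (integrable_dens g).integrableOn (integrableOn_const hS'.ne) h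

lemma abs_setPair_le {S : Set (E d × E d)} (hS : MeasurableSet S) (hS' : phase d V₀ S < ⊤)
    {g : Dens d V₀} {N : ℝ} (h : ∀ᵐ z ∂(phase d V₀), |g z| ≤ N) :
    |setPair S g| ≤ N * (phase d V₀).real S := by
  rw [setPair_apply hS]
  exact norm_setIntegral_le_of_norm_le_const_ae' (f := fun z => g z) hS' (h.mono fun z hz _ => hz)

/-- Constants are not integrable on the whole phase space, so the comparison is made on sets of
finite measure, which suffices by σ-finiteness. Sup bounds thus become bounds on continuous
functionals of `L¹`, stable under integrals, series and weak limits. -/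
lemma ae_le_of_setPair_le {g : Dens d V₀} {N : ℝ}
    (h : ∀ S : Set (E d × E d), MeasurableSet S → phase d V₀ S < ⊤ →
      setPair S g ≤ N * (phase d V₀).real S) : ∀ᵐ z ∂(phase d V₀), g z ≤ N := by
  refine ae_of_forall_measure_lt_top_ae_restrict _ fun T hT hT' => ?_
  refine ae_le_of_forall_setIntegral_le (μ := (phase d V₀).restrict T) (g := fun _ => N)
    (integrable_dens g).integrableOn (integrableOn_const hT'.ne) fun S hS _ => ?_
  have h1 := h (S ∩ T) (hS.inter hT) ((measure_mono inter_subset_right).trans_lt hT')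
  rw [setPair_apply (hS.inter hT)] at h1
  rw [Measure.restrict_restrict hS, setIntegral_const, smul_eq_mul, mul_comm]
  exact h1

lemma ae_abs_le_of_setPair_le {g : Dens d V₀} {N : ℝ}
    (h : ∀ S : Set (E d × E d), MeasurableSet S → phase d V₀ S < ⊤ →
      |setPair S g| ≤ N * (phase d V₀).real S) : ∀ᵐ z ∂(phase d V₀), |g z| ≤ N := by
  have h1 := ae_le_of_setPair_le fun S hS hS' => (le_abs_self _).trans (h S hS hS')
  have h2 : ∀ᵐ z ∂(phase d V₀), (-g : Dens d V₀) z ≤ N :=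
    ae_le_of_setPair_le fun S hS hS' => by
      rw [map_neg]; exact (neg_le_abs _).trans (h S hS hS')
  filter_upwards [h1, h2, Lp.coeFn_neg g] with z hz1 hz2 hz3
  rw [hz3, Pi.neg_apply] at hz2
  exact abs_le.2 ⟨by linarith, hz1⟩

lemma setPair_nonneg {S : Set (E d × E d)} (hS : MeasurableSet S) {g : Dens d V₀} (hg : 0 ≤ g) :
    0 ≤ setPair S g := by
  rw [setPair_apply hS]
  exact integral_nonneg_of_ae (ae_restrict_of_ae ((Lp.coeFn_nonneg g).2 hg))

end SetFunctionals

lemma transOp_nonneg (hγ : 0 ≤ γ) (r : ℝ) {g : Dens d V₀} (hg : 0 ≤ g) : 0 ≤ transOp γ r g := by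
  rw [← Lp.coeFn_nonneg] at hg ⊢
  have h1 := (measurePreserving_flow (V₀ := V₀) (d := d) (-r)).quasiMeasurePreserving.ae hg
  filter_upwards [coeFn_transOp hγ r g, h1] with z hz hz2
  rw [hz]
  exact mul_nonneg (weightRatio_pos r z).le hz2

lemma transOp_le (hγ : 0 ≤ γ) (r : ℝ) {g : Dens d V₀} {N : ℝ} (hN : 0 ≤ N)
    (hg : ∀ᵐ z ∂(phase d V₀), g z ≤ N) :
    ∀ᵐ z ∂(phase d V₀), transOp γ r g z ≤ Real.exp (γ * V₀ * |r|) * N := by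
  have h1 := (measurePreserving_flow (V₀ := V₀) (d := d) (-r)).quasiMeasurePreserving.ae hg
  filter_upwards [coeFn_transOp hγ r g, h1, ae_mem_velocities] with z hz hz2 hz3
  rw [hz]
  exact (mul_le_mul_of_nonneg_left hz2 (weightRatio_pos r z).le).trans
    (mul_le_mul_of_nonneg_right (weightRatio_le hγ r hz3) hN)

lemma abs_transOp_le (hγ : 0 ≤ γ) (r : ℝ) {g : Dens d V₀} {N : ℝ}
    (hg : ∀ᵐ z ∂(phase d V₀), |g z| ≤ N) :
    ∀ᵐ z ∂(phase d V₀), |transOp γ r g z| ≤ Real.exp (γ * V₀ * |r|) * N := by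
  have h1 := (measurePreserving_flow (V₀ := V₀) (d := d) (-r)).quasiMeasurePreserving.ae hg
  filter_upwards [coeFn_transOp hγ r g, h1, ae_mem_velocities] with z hz hz2 hz3
  rw [hz, abs_mul, abs_of_pos (weightRatio_pos r z)]
  exact mul_le_mul (weightRatio_le hγ r hz3) hz2 (abs_nonneg _) (Real.exp_pos _).le

lemma bdd_inv_weight (hγ : 0 ≤ γ) : Bdd V₀ fun z : E d × E d => (weight γ z.1)⁻¹ := by
  refine ⟨(Continuous.inv₀ (continuous_weight.comp continuous_fst)
    fun z => (weight_pos _).ne').measurable, 1, fun z _ => ?_⟩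
  rw [abs_of_pos (inv_pos.2 (weight_pos _))]
  exact inv_le_one_of_one_le₀ (one_le_weight hγ _)

lemma dens_smul_nonneg {c : ℝ} (hc : 0 ≤ c) {g : Dens d V₀} (hg : 0 ≤ g) : 0 ≤ c • g := by
  rw [← Lp.coeFn_nonneg] at hg ⊢
  filter_upwards [hg, Lp.coeFn_smul c g] with z hz hz2
  rw [hz2]
  exact mul_nonneg hc hz

lemma ae_section {p : E d × E d → Prop} (h : ∀ᵐ z ∂(phase d V₀), p z) :
    ∀ᵐ z ∂(phase d V₀), ∀ᵐ v ∂(vel d V₀), p (z.1, v) := by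
  have h1 : ∀ᵐ x ∂(volume : Measure (E d)), ∀ᵐ v ∂(vel d V₀), p (x, v) :=
    Measure.ae_ae_of_ae_prod h
  exact Measure.quasiMeasurePreserving_fst.ae h1

variable [hV : Fact (volume (velocities d V₀) = 1)] [hχ : Fact (χ ∈ Ioo (0 : ℝ) 1)]

lemma gainOp_nonneg {g : Dens d V₀} (hg : 0 ≤ g) : 0 ≤ gainOp χ g := by
  rw [← Lp.coeFn_nonneg] at hg ⊢
  filter_upwards [coeFn_gainOp (χ := χ) g, ae_section hg] with z hz hz2
  rw [hz]
  exact integral_nonneg_of_ae (hz2.mono fun v hv => mul_nonneg (turning_pos _ _).le hv)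

lemma gainOp_le {g : Dens d V₀} {N : ℝ} (hN : 0 ≤ N) (hg : ∀ᵐ z ∂(phase d V₀), g z ≤ N) :
    ∀ᵐ z ∂(phase d V₀), gainOp χ g z ≤ 2 * N := by
  filter_upwards [coeFn_gainOp (χ := χ) g, ae_section hg,
    ae_integrable_section (integrable_mul_dens (Bdd.turning (χ := χ)) g)] with z hz hz2 hz3
  rw [hz, avgFun]
  have h1 : ∫ _ : E d, 2 * N ∂(vel d V₀) = 2 * N := by simp
  rw [← h1]
  refine integral_mono_ae hz3 (integrable_const _) (hz2.mono fun v hv => ?_)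
  exact (mul_le_mul_of_nonneg_left hv (turning_pos _ _).le).trans
    (mul_le_mul_of_nonneg_right (turning_le_two _ _) hN)

lemma abs_gainOp_le {g : Dens d V₀} {N : ℝ} (hg : ∀ᵐ z ∂(phase d V₀), |g z| ≤ N) :
    ∀ᵐ z ∂(phase d V₀), |gainOp χ g z| ≤ 2 * N := by
  filter_upwards [coeFn_gainOp (χ := χ) g, ae_section hg] with z hz hz2
  rw [hz, avgFun]
  have h := norm_integral_le_of_norm_le_const (μ := vel d V₀) (C := 2 * N)
    (f := fun v => turning χ z.1 v * g (z.1, v)) (hz2.mono fun v hv => by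
      rw [norm_mul]
      exact mul_le_mul (abs_turning_le _ _) hv (abs_nonneg _) zero_le_two)
  simpa using h

lemma coeFn_collOp (g : Dens d V₀) : collOp χ g =ᵐ[phase d V₀]
    fun z => gainOp χ g z - turning χ z.1 z.2 * g z := by
  refine (Lp.coeFn_sub _ _).trans ?_
  filter_upwards [coeFn_mulOp (Bdd.turning (χ := χ)) g] with z hz
  exact congrArg (fun y => gainOp χ g z - y) hz

lemma coeFn_collOp_add (g : Dens d V₀) (a : ℝ) : (collOp χ g + a • g : Dens d V₀) =ᵐ[phase d V₀]
    fun z => gainOp χ g z + (a - turning χ z.1 z.2) * g z := by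
  refine (Lp.coeFn_add _ _).trans ?_
  filter_upwards [coeFn_collOp (χ := χ) g, Lp.coeFn_smul a g] with z hz hz2
  rw [Pi.add_apply, hz, hz2, Pi.smul_apply, smul_eq_mul]
  ring

/-- Since `K ≤ 2`, the added term outweighs the loss. This is the origin of the shift 2 in `sol`. -/
lemma collOp_add_nonneg {g : Dens d V₀} (hg : 0 ≤ g) : 0 ≤ collOp χ g + (2 : ℝ) • g := by
  have h1 := gainOp_nonneg (χ := χ) hg
  rw [← Lp.coeFn_nonneg] at hg h1 ⊢
  filter_upwards [hg, h1, coeFn_collOp_add (χ := χ) g 2] with z hz hz1 hz2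
  rw [hz2]
  exact add_nonneg hz1 (mul_nonneg (by linarith [turning_le_two (χ := χ) z.1 z.2]) hz)

/-- Since `K ≥ 1 - χ`, the loss contains a damping at rate `1 - χ`; Duhamel's formula with this rate
then involves only the gain. -/
lemma collOp_add_le {g : Dens d V₀} (hg : 0 ≤ g) : collOp χ g + (1 - χ) • g ≤ gainOp χ g := by
  rw [← Lp.coeFn_nonneg] at hg
  rw [← Lp.coeFn_le]
  filter_upwards [hg, coeFn_collOp_add (χ := χ) g (1 - χ)] with z hz hz2
  rw [hz2]
  have : (1 - χ - turning χ z.1 z.2) * g z ≤ 0 :=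
    mul_nonpos_of_nonpos_of_nonneg (by linarith [le_turning (χ := χ) z.1 z.2]) hz
  linarith

lemma abs_collOp_add_le {g : Dens d V₀} {N : ℝ} (hg : ∀ᵐ z ∂(phase d V₀), |g z| ≤ N) :
    ∀ᵐ z ∂(phase d V₀), |(collOp χ g + (2 : ℝ) • g : Dens d V₀) z| ≤ 4 * N := by
  filter_upwards [hg, abs_gainOp_le (χ := χ) hg, coeFn_collOp_add (χ := χ) g 2] with z hz hz1 hz2
  rw [hz2]
  have h1 : |(2 - turning χ z.1 z.2) * g z| ≤ 2 * N := by
    rw [abs_mul]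
    refine mul_le_mul ?_ hz (abs_nonneg _) zero_le_two
    rw [abs_of_nonneg (by linarith [turning_le_two (χ := χ) z.1 z.2])]
    linarith [turning_pos (χ := χ) z.1 z.2]
  linarith [abs_add_le (gainOp χ g z) ((2 - turning χ z.1 z.2) * g z)]

/-- Velocity averaging: the gain operator, the transport and the gain operator again map `L¹` to
`L^∞`. -/
lemma gainOp_transOp_gainOp_le (hγ : 0 ≤ γ) {r : ℝ} (hr : 0 < r) (g : Dens d V₀) :
    ∀ᵐ z ∂(phase d V₀), gainOp χ (transOp γ r (gainOp χ g)) z ≤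
      4 * Real.exp (γ * V₀ * r) * (r ^ d)⁻¹ * ‖g‖ := by
  have hKg := integrable_mul_dens (Bdd.turning (χ := χ)) g
  -- The gain is a function of `x` alone. After transport it is evaluated at `x - r v`, and the
  -- second velocity integral becomes an integral over space.
  set h : E d → ℝ := fun x => ∫ v, turning χ x v * g (x, v) ∂(vel d V₀) with hh
  have hint : Integrable h := hKg.integral_prod_left
  have h0 : ∫ x, |h x| ≤ 2 * ‖g‖ := by
    have h1 : ∫ x, |h x| ≤ ∫ x, ∫ v, |turning χ x v * g (x, v)| ∂(vel d V₀) :=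
      integral_mono hint.abs hKg.abs.integral_prod_left fun x => abs_integral_le_integral_abs
    refine h1.trans ?_
    rw [← integral_phase hKg.abs, norm_dens, ← integral_const_mul]
    refine integral_mono hKg.abs ((integrable_dens g).abs.const_mul 2) fun z => ?_
    rw [abs_mul]
    exact mul_le_mul_of_nonneg_right (abs_turning_le _ _) (abs_nonneg _)
  have h1 : ∀ᵐ z ∂(phase d V₀), gainOp χ g z = h z.1 := coeFn_gainOp (χ := χ) g
  have h2 := (measurePreserving_flow (V₀ := V₀) (d := d) (-r)).quasiMeasurePreserving.ae h1
  have h3 : ∀ᵐ z ∂(phase d V₀), transOp γ r (gainOp χ g) z =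
      weightRatio γ r z * h (z.1 + (-r) • z.2) := by
    filter_upwards [coeFn_transOp hγ r (gainOp χ g), h2] with z hz hz2
    rw [hz, hz2, flow_fst]
  filter_upwards [coeFn_gainOp (χ := χ) (transOp γ r (gainOp χ g)), ae_section h3] with z hz hz2
  rw [hz, avgFun]
  have hi : Integrable fun v => |h (z.1 + (-r) • v)| := by
    have := (hint.abs.comp_add_left z.1).comp_smul (R := -r) (by linarith)
    exact this
  have h4 : ‖∫ v, turning χ z.1 v * transOp γ r (gainOp χ g) (z.1, v) ∂(vel d V₀)‖ ≤
      ∫ v, 2 * Real.exp (γ * V₀ * r) * |h (z.1 + (-r) • v)| ∂(vel d V₀) := by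
    refine norm_integral_le_of_norm_le (hi.restrict.const_mul _) ?_
    filter_upwards [hz2, ae_restrict_mem measurableSet_velocities] with v hv hv2
    rw [hv, norm_mul, norm_mul, ← mul_assoc]
    refine mul_le_mul_of_nonneg_right ?_ (norm_nonneg _)
    refine mul_le_mul (abs_turning_le _ _) ?_ (norm_nonneg _) zero_le_two
    rw [Real.norm_eq_abs, abs_of_pos (weightRatio_pos _ _)]
    have := weightRatio_le (V₀ := V₀) hγ r (z := (z.1, v)) hv2
    rwa [abs_of_pos hr] at this
  refine (le_abs_self _).trans (h4.trans ?_)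
  rw [integral_const_mul]
  have h5 := integral_vel_comp_le (V₀ := V₀) (h := fun x => |h x|) (fun x => abs_nonneg _)
    hint.abs hr z.1
  calc 2 * Real.exp (γ * V₀ * r) * ∫ v, |h (z.1 + (-r) • v)| ∂(vel d V₀)
      ≤ 2 * Real.exp (γ * V₀ * r) * ((r ^ d)⁻¹ * (2 * ‖g‖)) :=
        mul_le_mul_of_nonneg_left (h5.trans (mul_le_mul_of_nonneg_left h0 (by positivity)))
          (by positivity)
    _ = _ := by ring

variable (χ γ) in
/-- The solution of the run-and-tumble equation, for densities multiplied by the weight. -/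
noncomputable def sol (g : Dens d V₀) (t : ℝ) : Dens d V₀ :=
  evolution (transOp γ) (collOp χ) 2 g t

lemma isGroupOp (hγ : 0 ≤ γ) :
    IsGroupOp (transOp γ : ℝ → Dens d V₀ →L[ℝ] Dens d V₀) (γ * V₀) :=
  isGroupOp_transOp hγ (radius_pos (d := d)).le

lemma sol_zero (hγ : 0 ≤ γ) (g : Dens d V₀) : sol χ γ g 0 = g :=
  evolution_zero (isGroupOp hγ) _ _ _

lemma continuous_sol (hγ : 0 ≤ γ) (g : Dens d V₀) : Continuous (sol χ γ g) :=
  continuous_evolution (isGroupOp hγ) _ _ _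

lemma sol_nonneg (hγ : 0 ≤ γ) {g : Dens d V₀} (hg : 0 ≤ g) {t : ℝ} (ht : 0 ≤ t) :
    0 ≤ sol χ γ g t := by
  refine evolution_mem_cone (isGroupOp hγ) (collOp χ) 2 (P := {g | 0 ≤ g}) isClosed_Ici
    (show (0 : Dens d V₀) ≤ 0 from le_rfl)
    (fun f hf g hg => show (0 : Dens d V₀) ≤ f + g from add_nonneg hf hg)
    (fun c hc g hg => show (0 : Dens d V₀) ≤ c • g from dens_smul_nonneg hc hg)
    (fun s g hg => transOp_nonneg hγ s hg) (fun g hg => collOp_add_nonneg hg) hg ht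

lemma hasDerivAt_wpair_sol (hγ : 0 ≤ γ) {w Dw : E d × E d → ℝ} (h : FlowDiff V₀ γ w Dw)
    (g : Dens d V₀) (t : ℝ) :
    HasDerivAt (fun t => wpair γ w (sol χ γ g t))
      (wpair γ Dw (sol χ γ g t) + wpair γ w (collOp χ (sol χ γ g t))) t :=
  hasDerivAt_evolution_dual (isGroupOp hγ) (collOp χ) 2 g (wpair γ w) (wpair γ Dw)
    (hasDerivAt_wpair_transOp hγ h) t

lemma flowDiff_one (hγ : 0 ≤ γ) : FlowDiff V₀ γ (fun _ : E d × E d => 1) (fun _ => 0) where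
  bdd := by simpa using bdd_inv_weight hγ
  bdd_deriv := by simpa using Bdd.const 0
  deriv := fun z _ => hasDerivAt_const _ _

/-- Conservation of the mass of `f`. The constant 1 is admissible because `1/m` is bounded;
transport does not change it, and the adjoint collision operator vanishes on functions of `x`. -/
lemma wpair_one_sol (hγ : 0 ≤ γ) (g : Dens d V₀) (t : ℝ) :
    wpair γ (fun _ => 1) (sol χ γ g t) = wpair γ (fun _ => 1) g := by
  have hb : Bdd V₀ fun z : E d × E d => (weight γ z.1)⁻¹ * 1 := (flowDiff_one hγ).bdd
  have h0 : ∀ g : Dens d V₀, wpair γ (fun _ => 0) g + wpair γ (fun _ => 1) (collOp χ g) = 0 := by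
    intro g
    rw [wpair, wpair, pair_collOp hb, pair_apply (by simpa using Bdd.const 0),
      pair_apply (Bdd.turning.mul (hb.avg.sub hb))]
    have : ∀ z : E d × E d, avgFun V₀ (fun z => (weight γ z.1)⁻¹ * 1) z = (weight γ z.1)⁻¹ * 1 := by
      intro z; simp [avgFun]
    simp only [this]
    simp
  have h1 := is_const_of_deriv_eq_zero
    (fun t => (hasDerivAt_wpair_sol (χ := χ) hγ (flowDiff_one hγ) g t).differentiableAt)
    (fun t => by rw [(hasDerivAt_wpair_sol (χ := χ) hγ (flowDiff_one hγ) g t).deriv, h0]) t 0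
  simpa only [sol_zero hγ] using h1

lemma norm_eq_pair_one {g : Dens d V₀} (hg : 0 ≤ g) : ‖g‖ = pair (fun _ => 1) g := by
  rw [norm_dens, pair_apply (Bdd.const 1)]
  refine integral_congr_ae (((Lp.coeFn_nonneg g).2 hg).mono fun z hz => ?_)
  simp only [one_mul]
  exact abs_of_nonneg hz

variable (d V₀ χ) in
/-- The solutions are bounded in the weighted `L¹` space, uniformly in time. -/
theorem exists_norm_sol_le : ∃ γs : ℝ, 0 < γs ∧ ∀ γ ∈ Ioo 0 γs, ∃ C : ℝ, 0 ≤ C ∧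
    ∀ g : Dens d V₀, 0 ≤ g → ∀ t, 0 ≤ t → ‖sol χ γ g t‖ ≤ C * ‖g‖ := by
  obtain ⟨γs, hγs, H⟩ := exists_lyapunov d V₀ χ
  refine ⟨γs, hγs, fun γ hγ => ?_⟩
  obtain ⟨w, Dw, hw, hbd, α, β, hα, hβ, hL⟩ := H γ hγ
  have hγ0 : 0 ≤ γ := hγ.1.le
  -- The factor 2 comes from `w ≥ m/2`, the term `3/2` from `w ≤ 3m/2` at time 0, and `β/α` from the
  -- source in the Gronwall inequality.
  refine ⟨2 * (3 / 2 + β / α), by positivity, fun g hg t ht => ?_⟩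
  have hb1 : Bdd V₀ fun z : E d × E d => (weight γ z.1)⁻¹ * 1 := (flowDiff_one hγ0).bdd
  have hmass : wpair γ (fun _ => 1) g ≤ ‖g‖ := by
    rw [norm_eq_pair_one hg, wpair]
    refine pair_mono hb1 (Bdd.const 1) (fun z _ => ?_) hg
    rw [mul_one]
    exact inv_le_one_of_one_le₀ (one_le_weight hγ0 _)
  have hmass0 : 0 ≤ wpair γ (fun _ => 1) g := by
    have := pair_mono (Bdd.const 0) hb1 (fun z _ => by
      rw [mul_one]; exact (inv_pos.2 (weight_pos _)).le) hg
    refine le_trans (le_of_eq ?_) this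
    rw [pair_apply (Bdd.const 0)]
    simp
  have hY0 : 0 ≤ wpair γ w g ∧ wpair γ w g ≤ 3 / 2 * ‖g‖ := by
    constructor
    · have := pair_mono (Bdd.const 0) hw.bdd (fun z hz => by linarith [(hbd z hz).1]) hg
      refine le_trans (le_of_eq ?_) this
      rw [pair_apply (Bdd.const 0)]
      simp
    · refine (le_abs_self _).trans (abs_pair_le hw.bdd (fun z hz => ?_) g)
      exact abs_le.2 ⟨by linarith [(hbd z hz).1], (hbd z hz).2⟩
  -- The source is `β` times the mass of `f`, which is constant in time and bounded by the initial
  -- norm; hence a bound with no growth.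
  have hY := le_add_div_of_deriv_le hα (mul_nonneg hβ hmass0)
    (fun t => hasDerivAt_wpair_sol (χ := χ) hγ0 hw g t) (fun t ht => ?_)
    (by rw [sol_zero hγ0]; exact hY0.1) ht
  · have h2 : ‖sol χ γ g t‖ ≤ 2 * wpair γ w (sol χ γ g t) := by
      have hp := sol_nonneg (χ := χ) hγ0 hg ht
      rw [norm_eq_pair_one hp, wpair, pair_apply (Bdd.const 1), pair_apply hw.bdd,
        ← integral_const_mul]
      refine integral_mono_ae (integrable_mul_dens (Bdd.const 1) _)
        ((integrable_mul_dens hw.bdd _).const_mul 2) ?_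
      filter_upwards [(Lp.coeFn_nonneg _).2 hp, ae_mem_velocities] with z hz hz2
      have h3 : 0 ≤ sol χ γ g t z := hz
      have := mul_le_mul_of_nonneg_right (hbd z hz2).1 h3
      linarith
    rw [sol_zero hγ0] at hY
    have h4 : β * wpair γ (fun _ => 1) g / α ≤ β / α * ‖g‖ := by
      rw [mul_div_right_comm]
      exact mul_le_mul_of_nonneg_left hmass (by positivity)
    calc ‖sol χ γ g t‖ ≤ 2 * (3 / 2 * ‖g‖ + β / α * ‖g‖) := by linarith [hY0.2]
      _ = _ := by ring
  · have hp := sol_nonneg (χ := χ) hγ0 hg ht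
    rw [← wpair_one_sol (χ := χ) hγ0 g t]
    simp only [wpair]
    rw [pair_collOp hw.bdd, pair_apply hw.bdd_deriv, pair_apply hw.bdd, pair_apply hb1,
      pair_apply (Bdd.turning.mul (hw.bdd.avg.sub hw.bdd)), ← integral_const_mul,
      ← integral_const_mul, ← integral_add (integrable_mul_dens hw.bdd_deriv _)
      (integrable_mul_dens (Bdd.turning.mul (hw.bdd.avg.sub hw.bdd)) _),
      ← integral_add ((integrable_mul_dens hw.bdd _).const_mul _)
      ((integrable_mul_dens hb1 _).const_mul _)]
    refine integral_mono_ae ((integrable_mul_dens hw.bdd_deriv _).add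
      (integrable_mul_dens (Bdd.turning.mul (hw.bdd.avg.sub hw.bdd)) _))
      (((integrable_mul_dens hw.bdd _).const_mul _).add
      ((integrable_mul_dens hb1 _).const_mul _)) ?_
    filter_upwards [(Lp.coeFn_nonneg _).2 hp, ae_mem_velocities] with z hz hz2
    have h3 : 0 ≤ sol χ γ g t z := hz
    have := mul_le_mul_of_nonneg_right (hL z hz2) h3
    simp only [mul_one] at this ⊢
    linarith

end Solution

/-! ### The uniform sup bound by damping and velocity averaging -/

section UniformBound

set_option linter.unusedSectionVars false

variable {d : ℕ} {V₀ χ γ : ℝ}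
variable [hV : Fact (volume (velocities d V₀) = 1)] [hχ : Fact (χ ∈ Ioo (0 : ℝ) 1)]

/-- The solutions remain bounded on bounded time intervals. -/
lemma exists_abs_sol_le (hγ : 0 ≤ γ) {g : Dens d V₀} {N : ℝ} (hN : 0 ≤ N)
    (hg : ∀ᵐ z ∂(phase d V₀), |g z| ≤ N) (T : ℝ) :
    ∃ M : ℝ, 0 ≤ M ∧ ∀ t, |t| ≤ T → ∀ᵐ z ∂(phase d V₀), |sol χ γ g t z| ≤ M := by
  -- The sup bound is encoded by the integrals over all sets of finite measure, with the measures as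
  -- thresholds, so that the Dyson series can be estimated through functionals.
  let ι := {S : Set (E d × E d) // MeasurableSet S ∧ phase d V₀ S < ⊤}
  have key : ∀ (N : ℝ) (g : Dens d V₀),
      (∀ i : ι, |setPair (V₀ := V₀) i.1 g| ≤ N * (phase d V₀).real i.1) ↔
        ∀ᵐ z ∂(phase d V₀), |g z| ≤ N := fun N g =>
    ⟨fun h => ae_abs_le_of_setPair_le fun S hS hS' => h ⟨S, hS, hS'⟩,
      fun h i => abs_setPair_le i.2.1 i.2.2 h⟩
  obtain ⟨M, hM0, hM⟩ := exists_abs_evolution_le (isGroupOp hγ) (collOp χ) 2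
    (fun i : ι => setPair (V₀ := V₀) i.1) (fun i => (phase d V₀).real i.1)
    (fun i => measureReal_nonneg) (b := 4) (by norm_num)
    (fun N hN g hg s => by
      rw [key] at hg ⊢
      exact abs_transOp_le hγ s hg)
    (fun N hN g hg => by
      rw [key] at hg ⊢
      exact abs_collOp_add_le hg)
    hN ((key N g).2 hg) T
  exact ⟨M, hM0, fun t ht => (key M _).1 (hM t ht)⟩

/-- A positive functional of a positive solution is bounded by the Duhamel formula without the
loss term. -/
lemma apply_sol_le (hγ : 0 ≤ γ) {g : Dens d V₀} (hg : 0 ≤ g) (l : Dens d V₀ →L[ℝ] ℝ)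
    (hl : ∀ h, 0 ≤ h → 0 ≤ l h) {p q k₁ k₂ t : ℝ} (ht : 0 ≤ t) (hp : 0 ≤ p) (hq : 0 ≤ q)
    (hk₁ : 0 < k₁) (hk₂ : 0 < k₂)
    (hG : ∀ s ∈ Ioo 0 t, Real.exp (-((1 - χ) * (t - s))) *
      l (transOp γ (t - s) (gainOp χ (sol χ γ g s))) ≤
        p * Real.exp (-(k₁ * (t - s))) + q * Real.exp (-(k₂ * (t - s)))) :
    l (sol χ γ g t) ≤ Real.exp (-((1 - χ) * t)) * l (transOp γ t g) + (p / k₁ + q / k₂) := by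
  have hU := isGroupOp (d := d) (V₀ := V₀) hγ
  have hcs := continuous_sol (χ := χ) hγ g
  have hduh := evolution_duhamel hU (collOp χ) 2 g l (1 - χ) t
  set F : ℝ → Dens d V₀ := fun s => collOp χ (sol χ γ g s) + (1 - χ) • sol χ γ g s with hF
  have hFc : Continuous F := ((collOp χ).continuous.comp hcs).add (hcs.const_smul (1 - χ))
  have hc : Continuous fun s => Real.exp (-((1 - χ) * (t - s))) * l (transOp γ (t - s) (F s)) :=
    (by fun_prop : Continuous fun s => Real.exp (-((1 - χ) * (t - s)))).mul
      (l.continuous.comp (hU.continuous_apply_sub hFc t))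
  have hle : ∀ s ∈ Ioo 0 t, Real.exp (-((1 - χ) * (t - s))) * l (transOp γ (t - s) (F s)) ≤
      p * Real.exp (-(k₁ * (t - s))) + q * Real.exp (-(k₂ * (t - s))) := by
    intro s hs
    refine le_trans (mul_le_mul_of_nonneg_left ?_ (Real.exp_pos _).le) (hG s hs)
    have h2 := sub_nonneg.2 (collOp_add_le (χ := χ) (sol_nonneg (χ := χ) hγ hg hs.1.le))
    have h3 := hl _ (transOp_nonneg hγ (t - s) h2)
    rw [map_sub, map_sub] at h3
    exact sub_nonneg.1 h3
  have hc1 : Continuous fun s => p * Real.exp (-(k₁ * (t - s))) := by fun_prop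
  have hc2 : Continuous fun s => q * Real.exp (-(k₂ * (t - s))) := by fun_prop
  have h1 : ∫ s in (0 : ℝ)..t, Real.exp (-((1 - χ) * (t - s))) * l (transOp γ (t - s) (F s)) ≤
      ∫ s in (0 : ℝ)..t, (p * Real.exp (-(k₁ * (t - s))) + q * Real.exp (-(k₂ * (t - s)))) :=
    intervalIntegral.integral_mono_on_of_le_Ioo ht (hc.intervalIntegrable _ _)
      ((hc1.add hc2).intervalIntegrable _ _) hle
  refine hduh.le.trans (add_le_add le_rfl (h1.trans ?_))
  rw [intervalIntegral.integral_add (hc1.intervalIntegrable _ _) (hc2.intervalIntegrable _ _),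
    intervalIntegral.integral_const_mul, intervalIntegral.integral_const_mul]
  refine add_le_add ?_ ?_
  · rw [div_eq_mul_one_div]
    exact mul_le_mul_of_nonneg_left (integral_exp_neg_le hk₁ t) hp
  · rw [div_eq_mul_one_div]
    exact mul_le_mul_of_nonneg_left (integral_exp_neg_le hk₂ t) hq

/-- Half of the damping absorbs the growth of the conjugated transport; the other half is kept for
the time integrals. -/
lemma exp_damping_le (hγ : γ * V₀ ≤ (1 - χ) / 2) {r : ℝ} (hr : 0 ≤ r) :
    Real.exp (-((1 - χ) * r)) * Real.exp (γ * V₀ * |r|) ≤ Real.exp (-((1 - χ) / 2 * r)) := by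
  rw [← Real.exp_add, Real.exp_le_exp, abs_of_nonneg hr]
  nlinarith

lemma exp_damping_le_one (hγ : γ * V₀ ≤ (1 - χ) / 2) {r : ℝ} (hr : 0 ≤ r) :
    Real.exp (-((1 - χ) * r)) * Real.exp (γ * V₀ * |r|) ≤ 1 := by
  refine (exp_damping_le hγ hr).trans (Real.exp_le_one_iff.2 ?_)
  have := hχ.out.2
  have : 0 ≤ (1 - χ) / 2 * r := mul_nonneg (by linarith) hr
  linarith

/-- An upper bound of the gain term improves itself. -/
lemma gainOp_sol_le_of_le (hγ : 0 ≤ γ) (hγ' : γ * V₀ ≤ (1 - χ) / 2) {g : Dens d V₀} (hg : 0 ≤ g)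
    {N L P T : ℝ} (hN : 0 ≤ N) (hL : 0 ≤ L) (hP : 0 ≤ P) (hgN : ∀ᵐ z ∂(phase d V₀), g z ≤ N)
    (hgL : ∀ t, 0 ≤ t → ‖sol χ γ g t‖ ≤ L)
    (hGP : ∀ t ∈ Icc 0 T, ∀ᵐ z ∂(phase d V₀), gainOp χ (sol χ γ g t) z ≤ P) :
    ∀ t ∈ Icc 0 T, ∀ᵐ z ∂(phase d V₀), gainOp χ (sol χ γ g t) z ≤
      2 * N + (P / 2 + 4 * 16 ^ d * L / ((1 - χ) / 2)) := by
  intro t ht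
  have hχ1 : 0 < 1 - χ := by linarith [hχ.out.2]
  refine ae_le_of_setPair_le fun S hS hS' => ?_
  set m := (phase d V₀).real S
  have hm : 0 ≤ m := measureReal_nonneg
  -- For lags `r ≤ 1/16` the integrand is at most `2 P m`, and `1 ≤ exp(1 - 16 r)` there, whence `k₁
  -- = 16`. Integration gives `2 P e m/16 ≤ P m/2` because `e ≤ 4`. Lags `r ≥ 1/16` are covered by
  -- `q` and the remaining damping.
  have h := apply_sol_le (χ := χ) hγ hg (setPair S ∘L gainOp χ) (t := t)
    (fun h hh => setPair_nonneg hS (gainOp_nonneg hh)) ht.1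
    (p := 2 * P * Real.exp 1 * m) (q := 4 * 16 ^ d * L * m) (k₁ := 16) (k₂ := (1 - χ) / 2)
    (by positivity) (by positivity) (by norm_num) (by positivity) (fun s hs => ?_)
  · refine h.trans ?_
    have h1 : Real.exp (-((1 - χ) * t)) * (setPair S ∘L gainOp χ) (transOp γ t g) ≤ 2 * N * m := by
      have h2 := setPair_le hS hS' (gainOp_le (χ := χ) (by positivity) (transOp_le hγ t hN hgN))
      calc _ ≤ Real.exp (-((1 - χ) * t)) * (2 * (Real.exp (γ * V₀ * |t|) * N) * m) :=
            mul_le_mul_of_nonneg_left h2 (Real.exp_pos _).le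
        _ = (Real.exp (-((1 - χ) * t)) * Real.exp (γ * V₀ * |t|)) * (2 * N * m) := by ring
        _ ≤ 1 * (2 * N * m) :=
            mul_le_mul_of_nonneg_right (exp_damping_le_one hγ' ht.1) (by positivity)
        _ = _ := one_mul _
    have h3 : 2 * P * Real.exp 1 * m / 16 ≤ P / 2 * m := by
      have := Real.exp_one_lt_d9
      have h4 : Real.exp 1 ≤ 4 := by linarith
      have h5 : P * m * Real.exp 1 ≤ P * m * 4 := mul_le_mul_of_nonneg_left h4 (by positivity)
      linarith
    have h6 : 4 * 16 ^ d * L * m / ((1 - χ) / 2) = 4 * 16 ^ d * L / ((1 - χ) / 2) * m := by ring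
    rw [h6]
    linarith
  · set r := t - s
    have hr : 0 < r := by simp only [r]; linarith [hs.2]
    have hs' : s ∈ Icc 0 T := ⟨hs.1.le, hs.2.le.trans ht.2⟩
    rw [ContinuousLinearMap.comp_apply]
    -- The averaging bound `r^{-d}` is not integrable at 0: short lags use the provisional bound
    -- `P`, long lags the `L¹` bound with `r^{-d} ≤ 16^d`.
    rcases le_total r (1 / 16) with hr1 | hr1
    · have h2 := setPair_le hS hS' (gainOp_le (χ := χ) (by positivity)
        (transOp_le hγ r hP (hGP s hs')))
      have h3 : 1 ≤ Real.exp 1 * Real.exp (-(16 * r)) := by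
        rw [← Real.exp_add]
        exact Real.one_le_exp (by linarith)
      have h4 : Real.exp (-((1 - χ) * r)) *
          setPair S (gainOp χ (transOp γ r (gainOp χ (sol χ γ g s)))) ≤ 2 * P * m := by
        calc _ ≤ Real.exp (-((1 - χ) * r)) * (2 * (Real.exp (γ * V₀ * |r|) * P) * m) :=
              mul_le_mul_of_nonneg_left h2 (Real.exp_pos _).le
          _ = (Real.exp (-((1 - χ) * r)) * Real.exp (γ * V₀ * |r|)) * (2 * P * m) := by ring
          _ ≤ 1 * (2 * P * m) :=
              mul_le_mul_of_nonneg_right (exp_damping_le_one hγ' hr.le) (by positivity)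
          _ = _ := one_mul _
      have h5 : 2 * P * m ≤ 2 * P * m * (Real.exp 1 * Real.exp (-(16 * r))) :=
        le_mul_of_one_le_right (by positivity) h3
      have h6 : 0 ≤ 4 * 16 ^ d * L * m * Real.exp (-((1 - χ) / 2 * r)) := by positivity
      calc _ ≤ 2 * P * m * (Real.exp 1 * Real.exp (-(16 * r))) := h4.trans h5
        _ = 2 * P * Real.exp 1 * m * Real.exp (-(16 * r)) := by ring
        _ ≤ _ := by linarith
    · have h2 := setPair_le hS hS'
        (gainOp_transOp_gainOp_le (χ := χ) hγ hr (sol χ γ g s))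
      have h3 : (r ^ d)⁻¹ ≤ 16 ^ d := by
        rw [← inv_pow]
        refine pow_le_pow_left₀ (by positivity) ?_ d
        rw [inv_le_comm₀ hr (by norm_num)]
        linarith
      have h4 : 4 * Real.exp (γ * V₀ * r) * (r ^ d)⁻¹ * ‖sol χ γ g s‖ * m ≤
          4 * Real.exp (γ * V₀ * |r|) * 16 ^ d * L * m := by
        rw [abs_of_pos hr]
        have := hgL s hs.1.le
        gcongr
      have h5 := exp_damping_le hγ' hr.le
      have h6 : 0 ≤ 2 * P * Real.exp 1 * m * Real.exp (-(16 * r)) := by positivity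
      calc _ ≤ Real.exp (-((1 - χ) * r)) * (4 * Real.exp (γ * V₀ * |r|) * 16 ^ d * L * m) :=
            mul_le_mul_of_nonneg_left (h2.trans h4) (Real.exp_pos _).le
        _ = (Real.exp (-((1 - χ) * r)) * Real.exp (γ * V₀ * |r|)) * (4 * 16 ^ d * L * m) := by ring
        _ ≤ Real.exp (-((1 - χ) / 2 * r)) * (4 * 16 ^ d * L * m) :=
            mul_le_mul_of_nonneg_right h5 (by positivity)
        _ = 4 * 16 ^ d * L * m * Real.exp (-((1 - χ) / 2 * r)) := by ring
        _ ≤ _ := by linarith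

/-- The bound on the gain term, uniform in time. -/
lemma gainOp_sol_le (hγ : 0 ≤ γ) (hγ' : γ * V₀ ≤ (1 - χ) / 2) {g : Dens d V₀} (hg : 0 ≤ g)
    {N L : ℝ} (hN : 0 ≤ N) (hL : 0 ≤ L) (hgN : ∀ᵐ z ∂(phase d V₀), g z ≤ N)
    (hgL : ∀ t, 0 ≤ t → ‖sol χ γ g t‖ ≤ L) {t : ℝ} (ht : 0 ≤ t) :
    ∀ᵐ z ∂(phase d V₀), gainOp χ (sol χ γ g t) z ≤
      2 * (2 * N + 4 * 16 ^ d * L / ((1 - χ) / 2)) := by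
  have hχ1 : 0 < 1 - χ := by linarith [hχ.out.2]
  set D := 2 * N + 4 * 16 ^ d * L / ((1 - χ) / 2) with hD
  have hD0 : 0 ≤ D := by positivity
  have hgN' : ∀ᵐ z ∂(phase d V₀), |g z| ≤ N := by
    filter_upwards [hgN, (Lp.coeFn_nonneg g).2 hg] with z hz hz2
    have h3 : 0 ≤ g z := hz2
    rwa [abs_of_nonneg h3]
  obtain ⟨M, hM0, hM⟩ := exists_abs_sol_le (χ := χ) hγ hN hgN' t
  -- Iterates of `P ↦ D + P/2`, whose fixed point is `2 D`. The starting value comes from the local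
  -- bound `M`, which may depend on `t`, but its contribution disappears in the limit.
  have hP : ∀ n : ℕ, ∀ s ∈ Icc 0 t, ∀ᵐ z ∂(phase d V₀), gainOp χ (sol χ γ g s) z ≤
      2 * D + 2 * M * (1 / 2) ^ n := by
    intro n
    induction n with
    | zero =>
      intro s hs
      refine (abs_gainOp_le (χ := χ) (hM s (by rw [abs_of_nonneg hs.1]; exact hs.2))).mono fun z hz => ?_
      rw [pow_zero, mul_one]
      linarith [le_abs_self (gainOp χ (sol χ γ g s) z)]
    | succ n ih =>
      intro s hs
      refine (gainOp_sol_le_of_le hγ hγ' hg hN hL (by positivity) hgN hgL ih s hs).mono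
        fun z hz => hz.trans (le_of_eq ?_)
      rw [hD, pow_succ]
      ring
  have hall : ∀ᵐ z ∂(phase d V₀), ∀ n : ℕ, gainOp χ (sol χ γ g t) z ≤
      2 * D + 2 * M * (1 / 2) ^ n := ae_all_iff.2 fun n => hP n t ⟨ht, le_rfl⟩
  filter_upwards [hall] with z hz
  have hlim : Tendsto (fun n : ℕ => 2 * D + 2 * M * (1 / 2 : ℝ) ^ n) atTop
      (𝓝 (2 * D + 2 * M * 0)) :=
    ((tendsto_pow_atTop_nhds_zero_of_lt_one (by norm_num) (by norm_num)).const_mul _).const_add _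
  rw [mul_zero, add_zero] at hlim
  exact ge_of_tendsto hlim (Eventually.of_forall hz)

/-- One more use of Duhamel's formula: the damped datum plus the damped integral of a bounded gain.
Choosing `p = 0` in `apply_sol_le` switches off the first exponential, so `k₁ = 1` is arbitrary. -/
lemma sol_le (hγ : 0 ≤ γ) (hγ' : γ * V₀ ≤ (1 - χ) / 2) {g : Dens d V₀} (hg : 0 ≤ g)
    {N P : ℝ} (hN : 0 ≤ N) (hP : 0 ≤ P) (hgN : ∀ᵐ z ∂(phase d V₀), g z ≤ N)
    (hGP : ∀ t, 0 ≤ t → ∀ᵐ z ∂(phase d V₀), gainOp χ (sol χ γ g t) z ≤ P) {t : ℝ} (ht : 0 ≤ t) :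
    ∀ᵐ z ∂(phase d V₀), sol χ γ g t z ≤ N + P / ((1 - χ) / 2) := by
  have hχ1 : 0 < 1 - χ := by linarith [hχ.out.2]
  refine ae_le_of_setPair_le fun S hS hS' => ?_
  set m := (phase d V₀).real S
  have hm : 0 ≤ m := measureReal_nonneg
  have h := apply_sol_le (χ := χ) hγ hg (setPair S) (t := t)
    (fun h hh => setPair_nonneg hS hh) ht (p := 0) (q := P * m) (k₁ := 1) (k₂ := (1 - χ) / 2)
    le_rfl (by positivity) one_pos (by positivity) (fun s hs => ?_)
  · refine h.trans ?_
    have h2 := setPair_le hS hS' (transOp_le hγ t hN hgN)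
    have h1 : Real.exp (-((1 - χ) * t)) * setPair S (transOp γ t g) ≤ N * m := by
      calc _ ≤ Real.exp (-((1 - χ) * t)) * (Real.exp (γ * V₀ * |t|) * N * m) :=
            mul_le_mul_of_nonneg_left h2 (Real.exp_pos _).le
        _ = (Real.exp (-((1 - χ) * t)) * Real.exp (γ * V₀ * |t|)) * (N * m) := by ring
        _ ≤ 1 * (N * m) := mul_le_mul_of_nonneg_right (exp_damping_le_one hγ' ht) (by positivity)
        _ = _ := one_mul _
    have h3 : P * m / ((1 - χ) / 2) = P / ((1 - χ) / 2) * m := by ring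
    rw [h3, zero_div, zero_add]
    linarith
  · have hr : 0 ≤ t - s := by linarith [hs.2]
    have h2 := setPair_le hS hS' (transOp_le hγ (t - s) hP (hGP s hs.1.le))
    calc _ ≤ Real.exp (-((1 - χ) * (t - s))) * (Real.exp (γ * V₀ * |t - s|) * P * m) :=
          mul_le_mul_of_nonneg_left h2 (Real.exp_pos _).le
      _ = (Real.exp (-((1 - χ) * (t - s))) * Real.exp (γ * V₀ * |t - s|)) * (P * m) := by ring
      _ ≤ Real.exp (-((1 - χ) / 2 * (t - s))) * (P * m) :=
          mul_le_mul_of_nonneg_right (exp_damping_le hγ' hr) (by positivity)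
      _ = _ := by ring

variable (d V₀ χ) in
/-- Nonnegative solutions are bounded in `L¹(m) ∩ L^∞(m)`, uniformly in time. -/
theorem exists_sol_le : ∃ γs : ℝ, 0 < γs ∧ ∀ γ ∈ Ioo 0 γs, ∃ C : ℝ, 0 ≤ C ∧
    ∀ g : Dens d V₀, 0 ≤ g → (∀ t, 0 ≤ t → ‖sol χ γ g t‖ ≤ C * ‖g‖) ∧
      ∀ N, 0 ≤ N → (∀ᵐ z ∂(phase d V₀), g z ≤ N) → ∀ t, 0 ≤ t →
        ∀ᵐ z ∂(phase d V₀), sol χ γ g t z ≤ C * (‖g‖ + N) := by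
  obtain ⟨γs, hγs, H⟩ := exists_norm_sol_le d V₀ χ
  have hV₀ : 0 < V₀ := radius_pos (d := d)
  have hχ1 : 0 < 1 - χ := by linarith [hχ.out.2]
  -- The second threshold is the condition `γ V₀ ≤ (1 - χ)/2` under which the damping dominates.
  refine ⟨min γs ((1 - χ) / 2 / V₀), by positivity, fun γ hγ => ?_⟩
  obtain ⟨C, hC0, hC⟩ := H γ ⟨hγ.1, (lt_min_iff.1 hγ.2).1⟩
  have hγ0 := hγ.1.le
  have hγ' : γ * V₀ ≤ (1 - χ) / 2 := by
    have := (lt_min_iff.1 hγ.2).2.le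
    rwa [le_div_iff₀ hV₀] at this
  set b := (1 - χ) / 2
  have hb : 0 < b := by positivity
  refine ⟨C + (1 + 4 / b) + 8 * 16 ^ d * C / b / b, by positivity, fun g hg =>
    ⟨fun t ht => (hC g hg t ht).trans ?_, fun N hN hgN t ht => ?_⟩⟩
  · refine mul_le_mul_of_nonneg_right ?_ (norm_nonneg _)
    have : 0 ≤ (1 + 4 / b) + 8 * 16 ^ d * C / b / b := by positivity
    linarith
  · have h1 := fun t (ht : 0 ≤ t) => gainOp_sol_le (χ := χ) hγ0 hγ' hg hN
      (L := C * ‖g‖) (by positivity) hgN (hC g hg) ht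
    refine (sol_le hγ0 hγ' hg hN (by positivity) hgN h1 ht).mono fun z hz => hz.trans ?_
    have h2 : N + 2 * (2 * N + 4 * 16 ^ d * (C * ‖g‖) / b) / b =
        (1 + 4 / b) * N + 8 * 16 ^ d * C / b / b * ‖g‖ := by
      field_simp
      ring
    rw [h2]
    have h3 : 0 ≤ (1 + 4 / b) * ‖g‖ := by positivity
    have h4 : 0 ≤ 8 * 16 ^ d * C / b / b * N := by positivity
    have h5 : 0 ≤ C * (‖g‖ + N) := by positivity
    linarith

end UniformBound

/-! ### Test functions determine the `L¹` norm -/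

section TestFunctions

set_option linter.unusedSectionVars false

variable {d : ℕ} {V₀ χ γ : ℝ}

/-- Continuous functions with compact support in the open phase space. -/
structure IsCc (V₀ : ℝ) (φ : E d × E d → ℝ) : Prop where
  cont : Continuous φ
  compact : HasCompactSupport φ
  support : tsupport φ ⊆ univ ×ˢ velocities d V₀

lemma IsCc.exists_bound {φ : E d × E d → ℝ} (h : IsCc V₀ φ) : ∃ C, ∀ z, |φ z| ≤ C :=
  h.compact.exists_bound_of_continuous h.cont

lemma IsCc.bdd {φ : E d × E d → ℝ} (h : IsCc V₀ φ) : Bdd V₀ φ := by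
  obtain ⟨C, hC⟩ := h.exists_bound
  exact ⟨h.cont.measurable, C, fun z _ => hC z⟩

/-- Free transport as a homeomorphism. -/
def flowHomeo (r : ℝ) : E d × E d ≃ₜ E d × E d where
  toFun := flow r
  invFun := flow (-r)
  left_inv := fun z => by rw [flow_flow, add_neg_cancel, flow_zero]
  right_inv := fun z => by rw [flow_flow, neg_add_cancel, flow_zero]
  continuous_toFun := continuous_flow r
  continuous_invFun := continuous_flow (-r)

lemma tsupport_comp_flow (φ : E d × E d → ℝ) (r : ℝ) :
    tsupport (fun z => φ (flow r z)) = flow r ⁻¹' tsupport φ :=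
  tsupport_comp_eq_preimage φ (flowHomeo r)

lemma IsCc.comp_flow {φ : E d × E d → ℝ} (h : IsCc V₀ φ) (r : ℝ) :
    IsCc V₀ (fun z => φ (flow r z)) where
  cont := h.cont.comp (continuous_flow r)
  compact := h.compact.comp_homeomorph (flowHomeo r)
  support := by
    rw [tsupport_comp_flow]
    intro z hz
    exact ⟨mem_univ _, (h.support hz).2⟩

/-- The derivative along the free transport. -/
noncomputable def flowDeriv (φ : E d × E d → ℝ) (z : E d × E d) : ℝ := fderiv ℝ φ z (z.2, 0)

lemma hasFDerivAt_flow (r : ℝ) (z : E d × E d) :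
    HasFDerivAt (flow r) ((ContinuousLinearMap.fst ℝ (E d) (E d) +
      r • ContinuousLinearMap.snd ℝ (E d) (E d)).prod (ContinuousLinearMap.snd ℝ (E d) (E d))) z :=
  ((ContinuousLinearMap.fst ℝ (E d) (E d) +
      r • ContinuousLinearMap.snd ℝ (E d) (E d)).prod
        (ContinuousLinearMap.snd ℝ (E d) (E d))).hasFDerivAt

lemma contDiff_flow (r : ℝ) : ContDiff ℝ 1 (flow r : E d × E d → E d × E d) := by
  unfold flow
  fun_prop

lemma bdd_inv_weight_mul (hγ : 0 ≤ γ) {ψ : E d × E d → ℝ} (h : Bdd V₀ ψ) : Bdd V₀ (fun z => (weight γ z.1)⁻¹ * ψ z) :=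
  (bdd_inv_weight hγ).mul h

namespace IsTest

variable {φ : E d × E d → ℝ}

lemma isCc (h : IsTest d V₀ φ) : IsCc V₀ φ := ⟨h.contDiff.continuous, h.compact, h.support⟩

lemma comp_flow (h : IsTest d V₀ φ) (r : ℝ) : IsTest d V₀ (fun z => φ (flow r z)) :=
  ⟨h.contDiff.comp (contDiff_flow r), (h.isCc.comp_flow r).compact, (h.isCc.comp_flow r).support⟩

/-- The velocity is constant along the flow, so differentiation along transport commutes with
transport. -/
lemma flowDeriv_comp (h : IsTest d V₀ φ) (r : ℝ) (z : E d × E d) :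
    flowDeriv (fun z => φ (flow r z)) z = flowDeriv φ (flow r z) := by
  have h1 := ((h.contDiff.differentiable one_ne_zero) (flow r z)).hasFDerivAt.comp z
    (hasFDerivAt_flow r z)
  have h2 : HasFDerivAt (fun z => φ (flow r z)) _ z := h1
  rw [flowDeriv, h2.fderiv]
  simp [flowDeriv, flow]

lemma isCc_flowDeriv (h : IsTest d V₀ φ) : IsCc V₀ (flowDeriv φ) := by
  have hs : Function.support (flowDeriv φ) ⊆ tsupport φ := by
    intro z hz
    by_contra hzn
    refine hz ?_
    have : fderiv ℝ φ z = 0 := by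
      have := support_fderiv_subset ℝ (f := φ)
      by_contra h3
      exact hzn (this h3)
    simp [flowDeriv, this]
  have ht : tsupport (flowDeriv φ) ⊆ tsupport φ := closure_minimal hs (isClosed_tsupport φ)
  refine ⟨?_, h.compact.mono' hs, ht.trans h.support⟩
  have h1 : Continuous (fderiv ℝ φ) := h.contDiff.continuous_fderiv one_ne_zero
  exact h1.clm_apply (by fun_prop)

lemma flowDiff (h : IsTest d V₀ φ) (hγ : 0 ≤ γ) : FlowDiff V₀ γ φ (flowDeriv φ) where
  bdd := bdd_inv_weight_mul hγ h.isCc.bdd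
  bdd_deriv := bdd_inv_weight_mul hγ h.isCc_flowDeriv.bdd
  deriv := fun z _ => by
    have h1 : HasDerivAt (fun r : ℝ => flow r z) (z.2, 0) 0 := by
      have h2 : HasDerivAt (fun r : ℝ => z.1 + r • z.2) ((1 : ℝ) • z.2) 0 :=
        ((hasDerivAt_id (0 : ℝ)).smul_const z.2).const_add z.1
      rw [one_smul] at h2
      exact h2.prodMk (hasDerivAt_const (0 : ℝ) z.2)
    have h3 : HasFDerivAt φ (fderiv ℝ φ (flow 0 z)) (flow 0 z) :=
      ((h.contDiff.differentiable one_ne_zero) _).hasFDerivAt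
    have h4 := h3.comp_hasDerivAt 0 h1
    simp only [flow_zero] at h4
    exact h4

end IsTest

section Density

variable {g : Dens d V₀} {κ : ℝ}

/-- A `C¹` approximation within `ε`, supported where `φ` is, costs `κ ε` from its larger sup norm
and `‖g‖ ε` from the replacement. -/
lemma abs_pair_le_of_isCc (hκ : ∀ φ, IsTest d V₀ φ → ∀ c, 0 ≤ c → (∀ z, |φ z| ≤ c) →
    |pair φ g| ≤ c * κ) {φ : E d × E d → ℝ} (hφ : IsCc V₀ φ) (h1 : ∀ z, |φ z| ≤ 1) :
    |pair φ g| ≤ κ := by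
  have h : ∀ ε : ℝ, 0 < ε → |pair φ g| ≤ κ + (κ + ‖g‖) * ε := by
    intro ε hε
    obtain ⟨ψ, hψ, hd, hs⟩ := hφ.cont.exists_contDiff_approx 1 (ε := fun _ => ε)
      continuous_const (fun _ => hε)
    have ht : tsupport ψ ⊆ tsupport φ := closure_mono hs
    have hψt : IsTest d V₀ ψ := ⟨by exact_mod_cast hψ, hφ.compact.mono hs, ht.trans hφ.support⟩
    have hle : ∀ z, |φ z - ψ z| ≤ ε := fun z => by
      have := (hd z).le
      rwa [dist_comm, Real.dist_eq] at this
    have h2 := hκ ψ hψt (1 + ε) (by positivity) fun z => by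
      have h3 : |ψ z| ≤ |φ z| + |φ z - ψ z| := by
        have := abs_sub (φ z) (φ z - ψ z)
        simpa using this
      linarith [h1 z, hle z]
    have h4 := abs_pair_le (hφ.bdd.sub hψt.isCc.bdd) (fun z _ => hle z) g
    rw [pair_sub hφ.bdd hψt.isCc.bdd] at h4
    have h5 : |pair φ g| ≤ |pair ψ g| + |pair φ g - pair ψ g| := by
      have := abs_add_le (pair ψ g) (pair φ g - pair ψ g)
      simpa using this
    linarith
  have hlim : Tendsto (fun ε : ℝ => κ + (κ + ‖g‖) * ε) (𝓝[>] 0) (𝓝 (κ + (κ + ‖g‖) * 0)) :=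
    ((by fun_prop : Continuous fun ε : ℝ => κ + (κ + ‖g‖) * ε).tendsto 0).mono_left
      nhdsWithin_le_nhds
  rw [mul_zero, add_zero] at hlim
  exact ge_of_tendsto hlim (eventually_nhdsWithin_of_forall fun ε hε => h ε hε)

/-- Continuous cutoff functions exhausting the open phase space. -/
noncomputable def cutoff (V₀ : ℝ) (n : ℕ) (z : E d × E d) : ℝ :=
  max 0 (min 1 (n - ‖z.1‖)) * max 0 (min 1 (n * (V₀ - ‖z.2‖) - 1))

lemma clamp_mem (a : ℝ) : 0 ≤ max 0 (min 1 a) ∧ max 0 (min 1 a) ≤ 1 :=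
  ⟨le_max_left _ _, max_le zero_le_one (min_le_left _ _)⟩

lemma cutoff_nonneg (n : ℕ) (z : E d × E d) : 0 ≤ cutoff V₀ n z :=
  mul_nonneg (clamp_mem _).1 (clamp_mem _).1

lemma cutoff_le_one (n : ℕ) (z : E d × E d) : cutoff V₀ n z ≤ 1 :=
  mul_le_one₀ (clamp_mem _).2 (clamp_mem _).1 (clamp_mem _).2

lemma isCc_cutoff (n : ℕ) : IsCc V₀ (cutoff V₀ n : E d × E d → ℝ) := by
  have hc : Continuous (cutoff V₀ n : E d × E d → ℝ) := by unfold cutoff; fun_prop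
  -- The `- 1` in the velocity factor of the cutoff makes it vanish for `‖v‖ ≥ V₀ - 1/n`, so the
  -- support is compact in the open velocity ball.
  set A : Set (E d × E d) := Metric.closedBall 0 n ×ˢ Metric.closedBall 0 (V₀ - 1 / n) with hA
  have hAc : IsCompact A := (isCompact_closedBall _ _).prod (isCompact_closedBall _ _)
  have hs : Function.support (cutoff V₀ n : E d × E d → ℝ) ⊆ A := by
    intro z hz
    rw [Function.mem_support, cutoff] at hz
    have h1 : 0 < max 0 (min 1 ((n : ℝ) - ‖z.1‖)) :=
      (clamp_mem _).1.lt_of_ne' (left_ne_zero_of_mul hz)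
    have h2 : 0 < max 0 (min 1 ((n : ℝ) * (V₀ - ‖z.2‖) - 1)) :=
      (clamp_mem _).1.lt_of_ne' (right_ne_zero_of_mul hz)
    have h3 := (lt_min_iff.1 ((lt_max_iff.1 h1).resolve_left (lt_irrefl _))).2
    have h4 := (lt_min_iff.1 ((lt_max_iff.1 h2).resolve_left (lt_irrefl _))).2
    have hn : (0 : ℝ) < n := by linarith [norm_nonneg z.1]
    refine ⟨mem_closedBall_zero_iff.2 (by linarith), mem_closedBall_zero_iff.2 ?_⟩
    have h5 : 1 / (n : ℝ) ≤ V₀ - ‖z.2‖ := by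
      rw [div_le_iff₀ hn]; linarith
    linarith
  have ht : tsupport (cutoff V₀ n : E d × E d → ℝ) ⊆ A := closure_minimal hs hAc.isClosed
  refine ⟨hc, HasCompactSupport.of_support_subset_isCompact hAc hs, ?_⟩
  rcases Nat.eq_zero_or_pos n with rfl | hn
  · have : (cutoff V₀ 0 : E d × E d → ℝ) = 0 := by
      funext z
      have : max 0 (min 1 (((0 : ℕ) : ℝ) - ‖z.1‖)) = 0 := by
        refine max_eq_left ((min_le_right _ _).trans ?_)
        simp
      rw [cutoff, this, zero_mul]
      rfl
    rw [this, tsupport_zero]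
    exact empty_subset _
  · refine ht.trans fun z hz => ⟨mem_univ _, ?_⟩
    have h1 := mem_closedBall_zero_iff.1 hz.2
    have h2 : (0 : ℝ) < 1 / n := by positivity
    rw [velocities, mem_ball_zero_iff]
    linarith

lemma tendsto_cutoff {z : E d × E d} (hz : z.2 ∈ velocities d V₀) :
    Tendsto (fun n : ℕ => cutoff V₀ n z) atTop (𝓝 1) := by
  rw [velocities, mem_ball_zero_iff] at hz
  refine tendsto_const_nhds.congr' ?_
  have h1 : ∀ᶠ n : ℕ in atTop, 1 + ‖z.1‖ ≤ n := tendsto_natCast_atTop_atTop.eventually_ge_atTop _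
  have h2 : ∀ᶠ n : ℕ in atTop, 2 / (V₀ - ‖z.2‖) ≤ n :=
    tendsto_natCast_atTop_atTop.eventually_ge_atTop _
  filter_upwards [h1, h2] with n h1 h2
  have hpos : 0 < V₀ - ‖z.2‖ := by linarith
  rw [div_le_iff₀ hpos] at h2
  rw [cutoff, min_eq_left (by linarith), min_eq_left (by linarith)]
  simp

lemma tendsto_pair_cutoff {ψ : E d × E d → ℝ} (hψ : Bdd V₀ ψ) (g : Dens d V₀) :
    Tendsto (fun n : ℕ => pair (fun z => cutoff V₀ n z * ψ z) g) atTop (𝓝 (pair ψ g)) := by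
  have hb : ∀ n : ℕ, Bdd V₀ (fun z : E d × E d => cutoff V₀ n z * ψ z) := fun n =>
    (isCc_cutoff n).bdd.mul hψ
  rw [pair_apply hψ]
  simp only [fun n => pair_apply (hb n)]
  refine tendsto_integral_of_dominated_convergence (fun z => |ψ z * g z|)
    (fun n => (integrable_mul_dens (hb n) g).aestronglyMeasurable)
    (integrable_mul_dens hψ g).abs (fun n => Eventually.of_forall fun z => ?_) ?_
  · rw [mul_assoc, norm_mul, Real.norm_eq_abs, Real.norm_eq_abs, abs_of_nonneg (cutoff_nonneg n z)]
    exact mul_le_of_le_one_left (abs_nonneg _) (cutoff_le_one n z)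
  · filter_upwards [ae_mem_velocities] with z hz
    have := ((tendsto_cutoff hz).mul_const (ψ z)).mul_const (g z)
    rwa [one_mul] at this

lemma abs_pair_le_of_continuous (hκ : ∀ φ : E d × E d → ℝ, IsCc V₀ φ → (∀ z, |φ z| ≤ 1) →
    |pair φ g| ≤ κ) {φ : E d × E d → ℝ} (hφ : Continuous φ) (h1 : ∀ z, |φ z| ≤ 1) :
    |pair φ g| ≤ κ := by
  have hb : Bdd V₀ φ := ⟨hφ.measurable, 1, fun z _ => h1 z⟩
  refine le_of_tendsto (tendsto_pair_cutoff hb g).abs (Eventually.of_forall fun n => ?_)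
  have hc := isCc_cutoff (d := d) (V₀ := V₀) n
  refine hκ _ ⟨hc.cont.mul hφ, hc.compact.mul_right, ?_⟩ fun z => ?_
  · exact (tsupport_mul_subset_left).trans hc.support
  · rw [abs_mul, abs_of_nonneg (cutoff_nonneg n z)]
    exact mul_le_one₀ (cutoff_le_one n z) (abs_nonneg _) (h1 z)

/-- With `f` continuous, compactly supported and close to `g` in `L¹`, the functions `f/(|f| +
1/(n+1))` are continuous substitutes for the sign of `f`, bounded by 1, and their pairing with `f`
tends to the norm of `f`. The distance `ε/2` from `f` to `g` is paid twice. -/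
lemma norm_le_of_abs_pair_le (hκ : ∀ φ : E d × E d → ℝ, Continuous φ → (∀ z, |φ z| ≤ 1) →
    |pair φ g| ≤ κ) : ‖g‖ ≤ κ := by
  refine le_of_forall_pos_le_add fun ε hε => ?_
  have : (phase d V₀).Regular := by infer_instance
  obtain ⟨f, -, hfg, hfc, hfi⟩ := (integrable_dens g).exists_hasCompactSupport_integral_sub_le
    (half_pos hε)
  have hb : ∀ n : ℕ, ∀ z, |f z / (|f z| + 1 / (n + 1))| ≤ 1 := fun n z => by
    have : (0 : ℝ) < 1 / (n + 1) := by positivity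
    rw [abs_div, abs_of_pos (by positivity : 0 < |f z| + 1 / ((n : ℝ) + 1)), div_le_one (by positivity)]
    linarith
  have hc : ∀ n : ℕ, Continuous fun z => f z / (|f z| + 1 / ((n : ℝ) + 1)) := fun n =>
    Continuous.div hfc (by fun_prop) fun z => by positivity
  have hB : ∀ n : ℕ, Bdd V₀ fun z => f z / (|f z| + 1 / ((n : ℝ) + 1)) := fun n =>
    ⟨(hc n).measurable, 1, fun z _ => hb n z⟩
  have hlim : Tendsto (fun n : ℕ => ∫ z, f z / (|f z| + 1 / ((n : ℝ) + 1)) * f z ∂(phase d V₀)) atTop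
      (𝓝 (∫ z, |f z| ∂(phase d V₀))) := by
    refine tendsto_integral_of_dominated_convergence (fun z => |f z|)
      (fun n => ((hc n).mul hfc).aestronglyMeasurable) hfi.abs
      (fun n => Eventually.of_forall fun z => ?_) (Eventually.of_forall fun z => ?_)
    · rw [norm_mul, Real.norm_eq_abs, Real.norm_eq_abs]
      exact mul_le_of_le_one_left (abs_nonneg _) (hb n z)
    · by_cases h0 : f z = 0
      · simp [h0]
      have h1 : Tendsto (fun n : ℕ => |f z| + 1 / ((n : ℝ) + 1)) atTop (𝓝 (|f z| + 0)) :=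
        tendsto_one_div_add_atTop_nhds_zero_nat.const_add _
      rw [add_zero] at h1
      have h2 := ((tendsto_const_nhds (x := f z)).div h1 (abs_ne_zero.2 h0)).mul_const (f z)
      have h3 : f z / |f z| * f z = |f z| := by
        rw [div_mul_eq_mul_div, div_eq_iff (abs_ne_zero.2 h0), abs_mul_abs_self]
      rwa [h3] at h2
  have h4 : ∀ n : ℕ, ∫ z, f z / (|f z| + 1 / ((n : ℝ) + 1)) * f z ∂(phase d V₀) ≤ κ + ε / 2 := by
    intro n
    have h5 := le_of_abs_le (hκ _ (hc n) (hb n))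
    rw [pair_apply (hB n)] at h5
    have hi : Integrable (fun z => f z / (|f z| + 1 / ((n : ℝ) + 1)) * f z) (phase d V₀) :=
      hfi.abs.mono ((hc n).mul hfc).aestronglyMeasurable (Eventually.of_forall fun z => by
        rw [norm_mul, Real.norm_eq_abs, Real.norm_eq_abs, Real.norm_eq_abs, abs_abs]
        exact mul_le_of_le_one_left (abs_nonneg _) (hb n z))
    have h6 : ∫ z, f z / (|f z| + 1 / ((n : ℝ) + 1)) * f z ∂(phase d V₀) -
        ∫ z, f z / (|f z| + 1 / ((n : ℝ) + 1)) * g z ∂(phase d V₀) ≤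
        ∫ z, ‖g z - f z‖ ∂(phase d V₀) := by
      rw [← integral_sub hi (integrable_mul_dens (hB n) g)]
      refine integral_mono (hi.sub (integrable_mul_dens (hB n) g)) ((integrable_dens g).sub hfi).norm
        fun z => ?_
      simp only
      rw [← mul_sub, Real.norm_eq_abs, abs_sub_comm]
      refine (le_abs_self _).trans ?_
      rw [abs_mul]
      exact mul_le_of_le_one_left (abs_nonneg _) (hb n z)
    linarith
  have h7 := le_of_tendsto' hlim h4
  have h8 : ‖g‖ ≤ ∫ z, |f z| ∂(phase d V₀) + ∫ z, ‖g z - f z‖ ∂(phase d V₀) := by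
    have hsub : Integrable (fun z => ‖g z - f z‖) (phase d V₀) :=
      ((integrable_dens g).sub hfi).norm
    rw [norm_dens, ← integral_add hfi.abs hsub]
    refine integral_mono (integrable_dens g).abs (hfi.abs.add hsub) fun z => ?_
    have := abs_add_le (f z) (g z - f z)
    simpa using this
  linarith

/-- The norm of a density is determined by its action on test functions. -/
theorem norm_le_of_isTest (hκ : ∀ φ, IsTest d V₀ φ → ∀ c, 0 ≤ c → (∀ z, |φ z| ≤ c) →
    |pair φ g| ≤ c * κ) : ‖g‖ ≤ κ :=
  norm_le_of_abs_pair_le fun _ hφ h1 => abs_pair_le_of_continuous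
    (fun _ hψ hψ1 => abs_pair_le_of_isCc hκ hψ hψ1) hφ h1

end Density

end TestFunctions

/-! ### Uniqueness of weak solutions by duality with transported test functions -/

section Uniqueness

set_option linter.unusedSectionVars false

variable {d : ℕ} {V₀ χ γ : ℝ}

lemma abs_pair_sub_le {ψ : E d × E d → ℝ} (hψ : Bdd V₀ ψ) {C : ℝ}
    (hC : ∀ z : E d × E d, z.2 ∈ velocities d V₀ → |ψ z| ≤ C) {A : Set (E d × E d)}
    (hA : MeasurableSet A) (hψA : ∀ z, z ∉ A → ψ z = 0) (f g : Dens d V₀) :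
    |pair ψ f - pair ψ g| ≤ C * ∫ z in A, |f z - g z| ∂(phase d V₀) := by
  rw [pair_apply hψ, pair_apply hψ,
    ← integral_sub (integrable_mul_dens hψ f) (integrable_mul_dens hψ g),
    ← integral_const_mul, ← integral_indicator hA, ← Real.norm_eq_abs]
  refine norm_integral_le_of_norm_le ?_ ?_
  · exact ((((integrable_dens f).sub (integrable_dens g)).abs.const_mul C).indicator hA)
  · filter_upwards [ae_mem_velocities] with z hz
    rw [← mul_sub, norm_mul, Real.norm_eq_abs, Real.norm_eq_abs]
    by_cases h : z ∈ A
    · rw [indicator_of_mem h]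
      exact mul_le_mul_of_nonneg_right (hC z hz) (abs_nonneg _)
    · rw [indicator_of_notMem h, hψA z h, abs_zero, zero_mul]

/-- Weak solutions, as curves in the unweighted space `L¹`, defined for all times. -/
structure IsWeakCurve (V₀ χ : ℝ) (H : ℝ → Dens d V₀) : Prop where
  bounded : ∀ T : ℝ, ∃ M : ℝ, 0 ≤ M ∧ ∀ t ≤ T, ‖H t‖ ≤ M
  cont : ∀ A : Set (E d × E d), IsCompact A → A ⊆ univ ×ˢ velocities d V₀ → ∀ t : ℝ,
    Tendsto (fun s => ∫ z in A, |H s z - H t z| ∂(phase d V₀)) (𝓝 t) (𝓝 0)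
  eqn : ∀ φ, IsTest d V₀ φ → ∀ t : ℝ, 0 ≤ t →
    pair φ (H t) = pair φ (H 0) + ∫ s in (0 : ℝ)..t, pair (adjointOp V₀ χ φ) (H s)

namespace IsWeakCurve

variable {H : ℝ → Dens d V₀}

lemma continuous_pair (hH : IsWeakCurve V₀ χ H) {ψ : E d × E d → ℝ} (hψ : Bdd V₀ ψ)
    {A : Set (E d × E d)} (hA : IsCompact A) (hAV : A ⊆ univ ×ˢ velocities d V₀)
    (hψA : ∀ z, z ∉ A → ψ z = 0) : Continuous fun s => pair ψ (H s) := by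
  obtain ⟨C, hC⟩ := hψ.bound
  rw [continuous_iff_continuousAt]
  intro t
  rw [ContinuousAt, tendsto_iff_norm_sub_tendsto_zero]
  refine squeeze_zero (fun _ => norm_nonneg _)
    (fun s => abs_pair_sub_le hψ hC hA.measurableSet hψA (H s) (H t)) ?_
  simpa using (hH.cont A hA hAV t).const_mul C

/-- Local `L¹` continuity only sees compact subsets of the open phase space, whereas the adjoint
operator spreads a test function over all velocities. Cutoffs make the pairing a pointwise limit of
continuous functions, which suffices for the time integrals. -/
lemma measurable_pair (hH : IsWeakCurve V₀ χ H) {ψ : E d × E d → ℝ} (hψ : Bdd V₀ ψ) :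
    Measurable fun s => pair ψ (H s) := by
  refine measurable_of_tendsto_metrizable (f := fun (n : ℕ) s =>
    pair (fun z => cutoff V₀ n z * ψ z) (H s)) (fun n => ?_)
    (tendsto_pi_nhds.2 fun s => tendsto_pair_cutoff hψ (H s))
  have hc := isCc_cutoff (d := d) (V₀ := V₀) n
  refine (hH.continuous_pair (hc.bdd.mul hψ) hc.compact hc.support fun z hz => ?_).measurable
  rw [image_eq_zero_of_notMem_tsupport hz, zero_mul]

lemma intervalIntegrable_pair (hH : IsWeakCurve V₀ χ H) {ψ : E d × E d → ℝ} (hψ : Bdd V₀ ψ)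
    (a b : ℝ) : IntervalIntegrable (fun s => pair ψ (H s)) volume a b := by
  obtain ⟨C, hC0, hC⟩ := hψ.exists_nonneg_bound
  obtain ⟨M, hM0, hM⟩ := hH.bounded (max a b)
  refine (intervalIntegrable_const (c := C * M)).mono_fun
    (hH.measurable_pair hψ).aestronglyMeasurable ?_
  refine (ae_restrict_mem measurableSet_uIoc).mono fun s hs => ?_
  simp only [Real.norm_eq_abs, abs_of_nonneg (mul_nonneg hC0 hM0)]
  refine (RunTumble.abs_pair_le hψ hC _).trans (mul_le_mul_of_nonneg_left (hM s ?_) hC0)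
  rw [uIoc] at hs
  exact hs.2

/-- Uniform continuity of `ψ` with a local bound on the norm of `H` handles the transport time
uniformly in `H`; for a fixed transport time the local continuity of the curve applies. -/
lemma continuous_pair_flow (hH : IsWeakCurve V₀ χ H) {ψ : E d × E d → ℝ}
    (hψ : IsCc V₀ ψ) :
    Continuous fun p : ℝ × ℝ => pair (fun z => ψ (flow p.2 z)) (H p.1) := by
  have huc : UniformContinuous ψ := hψ.compact.uniformContinuous_of_continuous hψ.cont
  rw [continuous_iff_continuousAt]
  rintro ⟨s₀, r₀⟩
  obtain ⟨M, hM0, hM⟩ := hH.bounded (s₀ + 1)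
  have hψr := hψ.comp_flow r₀
  have h2 : Tendsto (fun p : ℝ × ℝ => pair (fun z => ψ (flow r₀ z)) (H p.1)) (𝓝 (s₀, r₀))
      (𝓝 (pair (fun z => ψ (flow r₀ z)) (H s₀))) := by
    have h3 := hH.continuous_pair hψr.bdd hψr.compact hψr.support
      (fun z hz => image_eq_zero_of_notMem_tsupport (f := fun z => ψ (flow r₀ z)) hz)
    exact (h3.comp continuous_fst).tendsto (s₀, r₀)
  have h1 : Tendsto (fun p : ℝ × ℝ => pair (fun z => ψ (flow p.2 z) - ψ (flow r₀ z)) (H p.1))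
      (𝓝 (s₀, r₀)) (𝓝 0) := by
    rw [Metric.tendsto_nhds]
    intro ε hε
    obtain ⟨δ, hδ, hδ'⟩ := Metric.uniformContinuous_iff.1 huc (ε / (M + 1)) (by positivity)
    have hn1 : ∀ᶠ p : ℝ × ℝ in 𝓝 (s₀, r₀), p.1 ≤ s₀ + 1 := by
      have : ∀ᶠ s in 𝓝 s₀, s ≤ s₀ + 1 := eventually_le_nhds (by linarith)
      exact (continuous_fst.tendsto (s₀, r₀)).eventually this
    have hn2 : ∀ᶠ p : ℝ × ℝ in 𝓝 (s₀, r₀), |p.2 - r₀| * V₀ < δ := by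
      have hc : Continuous fun p : ℝ × ℝ => |p.2 - r₀| * V₀ := by fun_prop
      exact (hc.tendsto (s₀, r₀)).eventually (eventually_lt_nhds (by simpa using hδ))
    filter_upwards [hn1, hn2] with p hp1 hp2
    rw [Real.dist_eq, sub_zero]
    have hle := abs_pair_le ((hψ.comp_flow p.2).bdd.sub hψr.bdd) (C := ε / (M + 1))
      (fun z hz => ?_) (H p.1)
    · refine hle.trans_lt ?_
      have := hM p.1 hp1
      calc ε / (M + 1) * ‖H p.1‖ ≤ ε / (M + 1) * M := mul_le_mul_of_nonneg_left this (by positivity)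
        _ < ε / (M + 1) * (M + 1) := mul_lt_mul_of_pos_left (by linarith) (by positivity)
        _ = ε := by field_simp
    · refine (hδ' ?_).le
      have h4 : flow p.2 z - flow r₀ z = ((p.2 - r₀) • z.2, 0) := by
        simp [flow, sub_smul]
      rw [dist_eq_norm, h4]
      simp only [Prod.norm_def, norm_zero, norm_smul, Real.norm_eq_abs]
      refine max_lt ?_ hδ
      exact (mul_le_mul_of_nonneg_left (norm_le_of_mem_velocities hz) (abs_nonneg _)).trans_lt hp2
  have h5 := h1.add h2
  rw [zero_add] at h5
  refine h5.congr fun p => ?_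
  rw [pair_sub (hψ.comp_flow p.2).bdd hψr.bdd]
  ring

end IsWeakCurve

variable [hV : Fact (volume (velocities d V₀) = 1)] [hχ : Fact (χ ∈ Ioo (0 : ℝ) 1)]

lemma adjointOp_eq {φ : E d × E d → ℝ} (hφ : Continuous φ) (z : E d × E d) :
    adjointOp V₀ χ φ z = flowDeriv φ z + turning χ z.1 z.2 * (avgFun V₀ φ z - φ z) := by
  have h1 : ∫ v' in velocities d V₀, (φ (z.1, v') - φ z) = avgFun V₀ φ z - φ z := by
    have hi : Integrable (fun v => φ (z.1, v)) (vel d V₀) :=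
      integrable_vel_of_continuous (hφ.comp (by fun_prop))
    have h2 := integral_sub hi (integrable_const (μ := vel d V₀) (φ z))
    rw [integral_const] at h2
    simpa [avgFun] using h2
  rw [adjointOp, h1]
  rfl

/-- The part of the adjoint operator that comes from the collisions. -/
noncomputable def collAdj (V₀ χ : ℝ) (φ : E d × E d → ℝ) (z : E d × E d) : ℝ :=
  turning χ z.1 z.2 * (avgFun V₀ φ z - φ z)

lemma bdd_collAdj {φ : E d × E d → ℝ} (h : Bdd V₀ φ) : Bdd V₀ (collAdj V₀ χ φ) :=
  Bdd.turning.mul (h.avg.sub h)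

lemma abs_collAdj_le {φ : E d × E d → ℝ} {c : ℝ} (hc : ∀ z, |φ z| ≤ c) (z : E d × E d) :
    |collAdj V₀ χ φ z| ≤ 4 * c := by
  have h1 := abs_avgFun_le (V₀ := V₀) (fun z _ => hc z) z
  have h2 : |avgFun V₀ φ z - φ z| ≤ 2 * c := by
    have := abs_sub (avgFun V₀ φ z) (φ z)
    linarith [hc z]
  rw [collAdj, abs_mul]
  calc _ ≤ 2 * (2 * c) := mul_le_mul (abs_turning_le _ _) h2 (abs_nonneg _) zero_le_two
    _ = _ := by ring

lemma IsTest.pair_adjointOp {φ : E d × E d → ℝ} (h : IsTest d V₀ φ) (g : Dens d V₀) :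
    pair (adjointOp V₀ χ φ) g = pair (flowDeriv φ) g + pair (collAdj V₀ χ φ) g := by
  have h1 : adjointOp V₀ χ φ = fun z => flowDeriv φ z + collAdj V₀ χ φ z :=
    funext fun z => adjointOp_eq h.contDiff.continuous z
  have hb := h.isCc_flowDeriv.bdd
  have hc := bdd_collAdj (χ := χ) h.isCc.bdd
  rw [h1, pair_apply (hb.add hc), pair_apply hb, pair_apply hc,
    ← integral_add (integrable_mul_dens hb g) (integrable_mul_dens hc g)]
  simp only [add_mul]

lemma IsTest.bdd_adjointOp {φ : E d × E d → ℝ} (h : IsTest d V₀ φ) :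
    Bdd V₀ (adjointOp V₀ χ φ) := by
  have h1 : adjointOp V₀ χ φ = fun z => flowDeriv φ z + collAdj V₀ χ φ z :=
    funext fun z => adjointOp_eq h.contDiff.continuous z
  rw [h1]
  exact h.isCc_flowDeriv.bdd.add (bdd_collAdj h.isCc.bdd)

lemma weight_zero (x : E d) : weight 0 x = 1 := by simp [weight]

/-- This is the case `γ = 0`, where the weight is 1, of `hasDerivAt_wpair_transOp`, moved from time
0 to time `r`. -/
lemma hasDerivAt_pair_flow {φ : E d × E d → ℝ} (h : IsTest d V₀ φ) (g : Dens d V₀) (r : ℝ) :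
    HasDerivAt (fun ρ => pair (fun z => φ (flow ρ z)) g)
      (pair (fun z => flowDeriv φ (flow r z)) g) r := by
  have h1 := hasDerivAt_wpair_transOp le_rfl ((h.comp_flow r).flowDiff le_rfl) g
  have h2 : ∀ ρ, wpair 0 (fun z => φ (flow r z)) (transOp 0 ρ g) =
      pair (fun z => φ (flow (r + ρ) z)) g := by
    intro ρ
    rw [wpair, pair_transOp le_rfl ((h.comp_flow r).flowDiff le_rfl).bdd]
    congr 2
    funext z
    rw [weightRatio_flow, weight_zero, weight_zero, weight_zero, flow_flow, add_comm ρ r]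
    simp
  have h3 : wpair 0 (flowDeriv fun z => φ (flow r z)) g =
      pair (fun z => flowDeriv φ (flow r z)) g := by
    rw [wpair]
    congr 2
    funext z
    rw [weight_zero, h.flowDeriv_comp]
    simp
  simp only [h2, h3] at h1
  have h4 : HasDerivAt (fun ρ => pair (fun z => φ (flow (r + ρ) z)) g)
      (pair (fun z => flowDeriv φ (flow r z)) g) (r - r) := by rwa [sub_self]
  refine (h4.comp_sub_const r r).congr_of_eventuallyEq (Eventually.of_forall fun ρ => ?_)
  simp

namespace IsWeakCurve

variable {H : ℝ → Dens d V₀}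

lemma pair_sub_pair (hH : IsWeakCurve V₀ χ H) {φ : E d × E d → ℝ} (hφ : IsTest d V₀ φ) {s t : ℝ}
    (hs : 0 ≤ s) (ht : 0 ≤ t) :
    pair φ (H t) - pair φ (H s) = ∫ σ in s..t, pair (adjointOp V₀ χ φ) (H σ) := by
  have hi := hH.intervalIntegrable_pair (hφ.bdd_adjointOp (χ := χ))
  rw [hH.eqn φ hφ t ht, hH.eqn φ hφ s hs, add_sub_add_left_eq_sub,
    intervalIntegral.integral_interval_sub_left (hi 0 t) (hi 0 s)]

/-- Integral form of the estimate `d/ds ⟨H(s), φ(T - s)⟩ ≤ 4 c ‖H(s)‖`, where `φ(r)` is the test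
function `φ` transported for the time `r`. -/
lemma abs_pair_le (hH : IsWeakCurve V₀ χ H) (h0 : H 0 = 0) {φ : E d × E d → ℝ}
    (hφ : IsTest d V₀ φ) {c : ℝ} (hc0 : 0 ≤ c) (hc : ∀ z, |φ z| ≤ c) {T : ℝ} (hT : 0 ≤ T)
    {β B : ℝ → ℝ} (hβ : Continuous β) (hB : ∀ s, HasDerivAt B (4 * c * β s) s) (hB0 : 0 ≤ B 0)
    (hle : ∀ s ∈ Icc 0 T, ‖H s‖ ≤ β s) : |pair φ (H T)| ≤ B T := by
  set a : ℝ → ℝ → ℝ := fun σ ρ => pair (fun z => flowDeriv φ (flow ρ z)) (H σ) with ha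
  have hac : Continuous fun p : ℝ × ℝ => a p.1 p.2 :=
    hH.continuous_pair_flow hφ.isCc_flowDeriv
  -- `Φ` vanishes at 0 and equals the wanted pairing at `T`. The transport in the equation is
  -- compensated by the motion of the test function, so that only the collision term contributes to
  -- its growth.
  set Φ : ℝ → ℝ := fun s => pair (fun z => φ (flow (T - s) z)) (H s) with hΦ
  have hΦc : Continuous Φ := by
    have := (hH.continuous_pair_flow hφ.isCc).comp
      (by fun_prop : Continuous fun s : ℝ => (s, T - s))
    exact this
  have hslope : ∀ s ∈ Ico 0 T, ∀ R, 4 * c * β s < R →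
      ∃ᶠ z in 𝓝[>] s, slope (norm ∘ Φ) s z < R := by
    intro s hs R hR
    refine Eventually.frequently ?_
    -- Three errors of size `ε` occur below; the fourth `ε` keeps the final inequality strict.
    set ε := (R - 4 * c * β s) / 4 with hε
    have hε0 : 0 < ε := by simp only [hε]; linarith
    have e1 : ∀ᶠ p : ℝ × ℝ in 𝓝 (s, T - s), |a p.1 p.2 - a s (T - s)| < ε := by
      have := (hac.tendsto (s, T - s)).eventually (Metric.ball_mem_nhds _ hε0)
      simpa [Real.dist_eq] using this
    obtain ⟨δ, hδ, hδ'⟩ := Metric.eventually_nhds_iff.1 e1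
    have e2 : ∀ᶠ σ in 𝓝 s, 4 * c * β σ < 4 * c * β s + ε :=
      ((by fun_prop : Continuous fun σ => 4 * c * β σ).tendsto s).eventually
        (eventually_lt_nhds (by linarith))
    obtain ⟨δ', hδ0', hδ2⟩ := Metric.eventually_nhds_iff.1 e2
    -- The increment of `Φ` is split in two: the test function moves with `H s` frozen, as here, and
    -- then `H` moves with the test function frozen at `T - z`, where the weak equation applies. The
    -- leading terms `(z - s) * a s (T - s)` cancel.
    have e3 : ∀ᶠ z in 𝓝 s, |pair (fun y => φ (flow (T - z) y)) (H s) -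
        pair (fun y => φ (flow (T - s) y)) (H s) + (z - s) * a s (T - s)| ≤ ε * |z - s| := by
      have h1 := (hasDerivAt_pair_flow hφ (H s) (T - s)).comp_const_sub T s
      have h2 := (hasDerivAt_iff_isLittleO.1 h1).def hε0
      filter_upwards [h2] with z hz
      simpa [ha] using hz
    have e4 : ∀ᶠ z in 𝓝[>] s, z < T := mem_nhdsWithin_of_mem_nhds (eventually_lt_nhds hs.2)
    have e5 : ∀ᶠ z in 𝓝[>] s, |z - s| < min δ δ' := by
      have := Metric.ball_mem_nhds s (lt_min hδ hδ0')
      exact mem_nhdsWithin_of_mem_nhds (by simpa [Metric.ball, Real.dist_eq] using this)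
    filter_upwards [mem_nhdsWithin_of_mem_nhds e3, e4, e5, self_mem_nhdsWithin] with z hz3 hz4 hz5 hz
    have hzs : 0 < z - s := sub_pos.2 hz
    rw [abs_of_pos hzs] at hz3 hz5
    have hφz := hφ.comp_flow (T - z)
    have hdiff := hH.pair_sub_pair hφz hs.1 (hs.1.trans (le_of_lt hz))
    have hi := hH.intervalIntegrable_pair (hφz.bdd_adjointOp (χ := χ)) s z
    have hbound : ‖∫ σ in s..z, (pair (adjointOp V₀ χ fun y => φ (flow (T - z) y)) (H σ) -
        a s (T - s))‖ ≤ (ε + (4 * c * β s + ε)) * |z - s| := by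
      refine intervalIntegral.norm_integral_le_of_norm_le_const fun σ hσ => ?_
      rw [uIoc_of_le (le_of_lt hz)] at hσ
      have hσs : |σ - s| < min δ δ' := by
        rw [abs_of_pos (by linarith [hσ.1])]; linarith [hσ.2]
      rw [hφz.pair_adjointOp]
      have h1 : pair (flowDeriv fun y => φ (flow (T - z) y)) (H σ) = a σ (T - z) := by
        simp only [ha]
        congr 2
        funext y
        exact hφ.flowDeriv_comp _ _
      rw [h1]
      have h2 : |a σ (T - z) - a s (T - s)| < ε := by
        refine hδ' (y := (σ, T - z)) ?_
        rw [Prod.dist_eq, Real.dist_eq, Real.dist_eq]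
        refine max_lt (hσs.trans_le (min_le_left _ _)) ?_
        have : T - z - (T - s) = -(z - s) := by ring
        rw [this, abs_neg, abs_of_pos hzs]
        exact hz5.trans_le (min_le_left _ _)
      have h3 : |pair (collAdj V₀ χ fun y => φ (flow (T - z) y)) (H σ)| ≤ 4 * c * β s + ε := by
        have h4 := RunTumble.abs_pair_le (bdd_collAdj (χ := χ) hφz.isCc.bdd)
          (fun y _ => abs_collAdj_le (χ := χ) (V₀ := V₀) (fun y => hc (flow (T - z) y)) y) (H σ)
        have h5 := mul_le_mul_of_nonneg_left
          (hle σ ⟨hs.1.trans hσ.1.le, hσ.2.trans hz4.le⟩) (by positivity : 0 ≤ 4 * c)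
        have h6 := hδ2 (y := σ) (by rw [Real.dist_eq]; exact hσs.trans_le (min_le_right _ _))
        linarith
      rw [Real.norm_eq_abs]
      have h7 := abs_add_le (a σ (T - z) - a s (T - s))
        (pair (collAdj V₀ χ fun y => φ (flow (T - z) y)) (H σ))
      have h8 : a σ (T - z) + pair (collAdj V₀ χ fun y => φ (flow (T - z) y)) (H σ) - a s (T - s) =
        a σ (T - z) - a s (T - s) + pair (collAdj V₀ χ fun y => φ (flow (T - z) y)) (H σ) := by ring
      rw [h8]
      linarith
    rw [intervalIntegral.integral_sub hi intervalIntegrable_const, ← hdiff,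
      intervalIntegral.integral_const, smul_eq_mul, Real.norm_eq_abs, abs_of_pos hzs] at hbound
    have hfin : |Φ z - Φ s| ≤ (4 * c * β s + 3 * ε) * (z - s) := by
      have h1 := abs_add_le
        (pair (fun y => φ (flow (T - z) y)) (H z) - pair (fun y => φ (flow (T - z) y)) (H s) -
          (z - s) * a s (T - s))
        (pair (fun y => φ (flow (T - z) y)) (H s) -
          pair (fun y => φ (flow (T - s) y)) (H s) + (z - s) * a s (T - s))
      have h2 : Φ z - Φ s = (pair (fun y => φ (flow (T - z) y)) (H z) -
          pair (fun y => φ (flow (T - z) y)) (H s) - (z - s) * a s (T - s)) +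
          (pair (fun y => φ (flow (T - z) y)) (H s) -
          pair (fun y => φ (flow (T - s) y)) (H s) + (z - s) * a s (T - s)) := by
        simp only [hΦ]; ring
      rw [h2]
      linarith
    rw [slope_def_field, div_lt_iff₀ hzs]
    have h1 : |Φ z| - |Φ s| ≤ |Φ z - Φ s| := abs_sub_abs_le_abs_sub _ _
    have h2 : (4 * c * β s + 3 * ε) * (z - s) < R * (z - s) :=
      mul_lt_mul_of_pos_right (by simp only [hε]; linarith) hzs
    simp only [Function.comp, Real.norm_eq_abs]
    linarith
  -- The comparison with a boundary function needs a strictly larger slope; `η * s` provides it and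
  -- then `η` tends to 0.
  have hfence : ∀ η : ℝ, 0 < η → |pair φ (H T)| ≤ B T + η * T := by
    intro η hη
    have hBd : ∀ s, HasDerivAt (fun s => B s + η * s) (4 * c * β s + η) s := fun s =>
      ((hB s).add ((hasDerivAt_id s).const_mul η)).congr_deriv (by simp)
    have h1 := image_norm_le_of_liminf_right_slope_norm_lt_deriv_boundary (a := 0) (b := T)
      hΦc.continuousOn hslope (B := fun s => B s + η * s) (B' := fun s => 4 * c * β s + η)
      (by simpa [hΦ, h0] using hB0) (fun s _ => (hBd s).continuousAt.continuousWithinAt)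
      (fun s _ => (hBd s).hasDerivWithinAt) (fun s _ _ => by linarith) (right_mem_Icc.2 hT)
    simpa [hΦ, flow_zero] using h1
  have hlim : Tendsto (fun η : ℝ => B T + η * T) (𝓝[>] 0) (𝓝 (B T + 0 * T)) :=
    ((by fun_prop : Continuous fun η : ℝ => B T + η * T).tendsto 0).mono_left nhdsWithin_le_nhds
  rw [zero_mul, add_zero] at hlim
  exact ge_of_tendsto hlim (eventually_nhdsWithin_of_forall fun η hη => hfence η hη)

/-- A weak solution that vanishes initially vanishes for all times. -/
theorem eq_zero (hH : IsWeakCurve V₀ χ H) (h0 : H 0 = 0) {t : ℝ} (ht : 0 ≤ t) : H t = 0 := by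
  obtain ⟨M, hM0, hM⟩ := hH.bounded t
  -- Iterated Gronwall: a bound on the norm is integrated against test functions and returned to the
  -- norm by duality. The 4 is `K ≤ 2` times 2 for the difference of average and function.
  have hn : ∀ n : ℕ, ∀ s ∈ Icc 0 t, ‖H s‖ ≤ M * ((4 * s) ^ n / n.factorial) := by
    intro n
    induction n with
    | zero => intro s hs; simpa using hM s hs.2
    | succ n ih =>
      intro s hs
      refine norm_le_of_isTest fun φ hφ c hc0 hc => ?_
      have h1 := hH.abs_pair_le h0 hφ hc0 hc hs.1
        (β := fun s => M * ((4 * s) ^ n / n.factorial))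
        (B := fun s => c * (M * ((4 * s) ^ (n + 1) / (n + 1).factorial))) (by fun_prop)
        (fun s => ?_) (by simp) (fun σ hσ => ih σ ⟨hσ.1, hσ.2.trans hs.2⟩)
      · exact h1
      · have h2 : HasDerivAt (fun s : ℝ => 4 * s) (4 * 1) s := (hasDerivAt_id s).const_mul 4
        have h3 := (((h2.pow (n + 1)).div_const ((n + 1).factorial : ℝ)).const_mul M).const_mul c
        refine h3.congr_deriv ?_
        rw [Nat.factorial_succ]
        push_cast
        have : (n.factorial : ℝ) ≠ 0 := by positivity
        field_simp
  have hlim : Tendsto (fun n : ℕ => M * ((4 * t) ^ n / n.factorial)) atTop (𝓝 (M * 0)) :=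
    (FloorSemiring.tendsto_pow_div_factorial_atTop (4 * t)).const_mul M
  rw [mul_zero] at hlim
  have := ge_of_tendsto' hlim fun n => hn n t (right_mem_Icc.2 ht)
  exact norm_le_zero_iff.1 this

lemma sub {H₁ H₂ : ℝ → Dens d V₀} (h₁ : IsWeakCurve V₀ χ H₁) (h₂ : IsWeakCurve V₀ χ H₂) :
    IsWeakCurve V₀ χ (fun t => H₁ t - H₂ t) where
  bounded T := by
    obtain ⟨M₁, h10, h1⟩ := h₁.bounded T
    obtain ⟨M₂, h20, h2⟩ := h₂.bounded T
    exact ⟨M₁ + M₂, by positivity, fun t ht =>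
      (norm_sub_le _ _).trans (add_le_add (h1 t ht) (h2 t ht))⟩
  cont A hA hAV t := by
    have h := (h₁.cont A hA hAV t).add (h₂.cont A hA hAV t)
    rw [zero_add] at h
    refine squeeze_zero (fun s => integral_nonneg fun z => abs_nonneg _) (fun s => ?_) h
    have hi1 := ((integrable_dens (H₁ s)).sub (integrable_dens (H₁ t))).abs.restrict (s := A)
    have hi2 := ((integrable_dens (H₂ s)).sub (integrable_dens (H₂ t))).abs.restrict (s := A)
    have hi := ((integrable_dens (H₁ s - H₂ s)).sub
      (integrable_dens (H₁ t - H₂ t))).abs.restrict (s := A)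
    refine le_trans (integral_mono_ae hi (hi1.add hi2) ?_) (integral_add hi1 hi2).le
    filter_upwards [ae_restrict_of_ae (Lp.coeFn_sub (H₁ s) (H₂ s)),
      ae_restrict_of_ae (Lp.coeFn_sub (H₁ t) (H₂ t))] with z hz1 hz2
    simp only [Pi.sub_apply, Pi.add_apply] at *
    rw [hz1, hz2]
    have := abs_sub (H₁ s z - H₁ t z) (H₂ s z - H₂ t z)
    refine le_trans (le_of_eq ?_) this
    congr 1
    ring
  eqn φ hφ t ht := by
    have hb := hφ.bdd_adjointOp (χ := χ)
    simp only [map_sub]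
    rw [h₁.eqn φ hφ t ht, h₂.eqn φ hφ t ht, intervalIntegral.integral_sub
      (h₁.intervalIntegrable_pair hb _ _) (h₂.intervalIntegrable_pair hb _ _)]
    ring

end IsWeakCurve

end Uniqueness

/-! ### Weak solutions in weighted form and consequences of uniqueness -/

section WeakSolutions

set_option linter.unusedSectionVars false

variable {d : ℕ} {V₀ χ γ : ℝ}

/-- The class `f = g / m`. -/
noncomputable def ofDens (γ : ℝ) (g : Dens d V₀) : E d × E d →ₘ[phase d V₀] ℝ :=
  (mulOp (fun z => (weight γ z.1)⁻¹) g).1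

variable [hV : Fact (volume (velocities d V₀) = 1)] [hχ : Fact (χ ∈ Ioo (0 : ℝ) 1)]

lemma ofDens_add (f g : Dens d V₀) : ofDens γ (f + g) = ofDens γ f + ofDens γ g := by
  simp only [ofDens, map_add]; rfl

lemma ofDens_sub (f g : Dens d V₀) : ofDens γ (f - g) = ofDens γ f - ofDens γ g := by
  simp only [ofDens, map_sub]; rfl

lemma ofDens_smul (c : ℝ) (g : Dens d V₀) : ofDens γ (c • g) = c • ofDens γ g := by
  simp only [ofDens, map_smul]; rfl

lemma coeFn_ofDens (hγ : 0 ≤ γ) (g : Dens d V₀) :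
    ofDens γ g =ᵐ[phase d V₀] fun z => (weight γ z.1)⁻¹ * g z :=
  coeFn_mulOp (bdd_inv_weight hγ) g

lemma weighted_ofDens (hγ : 0 ≤ γ) (g : Dens d V₀) :
    weighted γ (ofDens γ g) =ᵐ[phase d V₀] g := by
  filter_upwards [coeFn_ofDens hγ g] with z hz
  rw [weighted, hz, mul_inv_cancel_left₀ (weight_pos _).ne']

lemma ofDens_injective (hγ : 0 ≤ γ) {f g : Dens d V₀} (h : ofDens γ f = ofDens γ g) : f = g := by
  refine Lp.ext ((weighted_ofDens hγ f).symm.trans ?_)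
  rw [h]
  exact weighted_ofDens hγ g

lemma ofDens_toLp (hγ : 0 ≤ γ) {f : E d × E d →ₘ[phase d V₀] ℝ}
    (h : MemLp (weighted γ f) 1 (phase d V₀)) : ofDens γ (h.toLp _) = f := by
  refine AEEqFun.ext ?_
  filter_upwards [coeFn_ofDens hγ (h.toLp _), h.coeFn_toLp] with z hz hz2
  rw [hz, hz2, weighted, inv_mul_cancel_left₀ (weight_pos _).ne']

lemma aestronglyMeasurable_weighted (f : E d × E d →ₘ[phase d V₀] ℝ) :
    AEStronglyMeasurable (weighted γ f) (phase d V₀) :=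
  (continuous_weight.comp continuous_fst).aestronglyMeasurable.mul f.aestronglyMeasurable

lemma enorm_dens (g : Dens d V₀) : eLpNorm g 1 (phase d V₀) = ENNReal.ofReal ‖g‖ := by
  rw [ofReal_norm, Lp.enorm_def]

lemma eLpNorm_weighted_ofDens (hγ : 0 ≤ γ) (g : Dens d V₀) :
    eLpNorm (weighted γ (ofDens γ g)) 1 (phase d V₀) = ENNReal.ofReal ‖g‖ := by
  rw [eLpNorm_congr_ae (weighted_ofDens hγ g), enorm_dens]

lemma norm_inv_weight_mulOp_le (hγ : 0 ≤ γ) (g : Dens d V₀) :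
    ‖mulOp (fun z => (weight γ z.1)⁻¹) g‖ ≤ ‖g‖ := by
  have h := norm_mulOp_le (bdd_inv_weight hγ) (C := 1) (fun z _ => ?_) g
  · rwa [one_mul] at h
  · rw [abs_of_pos (inv_pos.2 (weight_pos _))]
    exact inv_le_one_of_one_le₀ (one_le_weight hγ _)

lemma integral_ofDens_mul (hγ : 0 ≤ γ) {ψ : E d × E d → ℝ}
    (h : Bdd V₀ fun z => (weight γ z.1)⁻¹ * ψ z) (g : Dens d V₀) :
    ∫ z, ofDens γ g z * ψ z ∂(phase d V₀) = wpair γ ψ g := by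
  rw [wpair, pair_apply h]
  refine integral_congr_ae ((coeFn_ofDens hγ g).mono fun z hz => ?_)
  simp only [hz]
  ring

/-- The weight depends on `x` only and leaves the velocity average, so the collision operator needs
no conjugation. -/
lemma wpair_adjointOp (hγ : 0 ≤ γ) {φ : E d × E d → ℝ} (hφ : IsTest d V₀ φ) (g : Dens d V₀) :
    wpair γ (adjointOp V₀ χ φ) g = wpair γ (flowDeriv φ) g + wpair γ φ (collOp χ g) := by
  have h1 : Bdd V₀ fun z => (weight γ z.1)⁻¹ * φ z := (hφ.flowDiff hγ).bdd
  have h2 := (hφ.flowDiff hγ).bdd_deriv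
  have h3 := bdd_inv_weight_mul hγ (hφ.bdd_adjointOp (χ := χ))
  have h4 : Bdd V₀ fun z => turning χ z.1 z.2 *
      (avgFun V₀ (fun z => (weight γ z.1)⁻¹ * φ z) z - (weight γ z.1)⁻¹ * φ z) :=
    Bdd.turning.mul (h1.avg.sub h1)
  rw [wpair, wpair, wpair, pair_collOp h1, pair_apply h3, pair_apply h2, pair_apply h4,
    ← integral_add (integrable_mul_dens h2 g) (integrable_mul_dens h4 g)]
  refine integral_congr_ae (Eventually.of_forall fun z => ?_)
  have h5 : avgFun V₀ (fun z => (weight γ z.1)⁻¹ * φ z) z = (weight γ z.1)⁻¹ * avgFun V₀ φ z :=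
    integral_const_mul (weight γ z.1)⁻¹ fun v => φ (z.1, v)
  simp only
  rw [adjointOp_eq hφ.contDiff.continuous, h5]
  ring

lemma integral_ofDens_mul_adjointOp (hγ : 0 ≤ γ) {φ : E d × E d → ℝ} (hφ : IsTest d V₀ φ)
    (g : Dens d V₀) : ∫ z, ofDens γ g z * adjointOp V₀ χ φ z ∂(phase d V₀) =
      wpair γ (flowDeriv φ) g + wpair γ φ (collOp χ g) := by
  rw [integral_ofDens_mul hγ (bdd_inv_weight_mul hγ hφ.bdd_adjointOp), wpair_adjointOp hγ hφ]

lemma tendsto_ofReal_norm_sub {F : Type*} [SeminormedAddCommGroup F] {u : ℝ → F}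
    (hu : Continuous u) (t : ℝ) :
    Tendsto (fun s => ENNReal.ofReal ‖u s - u t‖) (𝓝 t) (𝓝 0) := by
  have h := (ENNReal.continuous_ofReal.tendsto 0).comp
    (tendsto_iff_norm_sub_tendsto_zero.1 (hu.tendsto t))
  rwa [ENNReal.ofReal_zero] at h

variable (χ γ) in
/-- Curves of densities that solve the equation weakly in the differential sense. -/
structure IsDiffSolution (u : ℝ → Dens d V₀) : Prop where
  cont : Continuous u
  deriv : ∀ φ, IsTest d V₀ φ → ∀ t, HasDerivAt (fun t => wpair γ φ (u t))
    (wpair γ (flowDeriv φ) (u t) + wpair γ φ (collOp χ (u t))) t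

namespace IsDiffSolution

variable {u v : ℝ → Dens d V₀}

lemma add (hu : IsDiffSolution χ γ u) (hv : IsDiffSolution χ γ v) :
    IsDiffSolution χ γ (fun t => u t + v t) where
  cont := hu.cont.add hv.cont
  deriv φ hφ t := by
    simp only [map_add]
    exact ((hu.deriv φ hφ t).add (hv.deriv φ hφ t)).congr_deriv (by ring)

lemma smul (hu : IsDiffSolution χ γ u) (c : ℝ) : IsDiffSolution χ γ (fun t => c • u t) where
  cont := hu.cont.const_smul c
  deriv φ hφ t := by
    simp only [map_smul, smul_eq_mul]
    exact ((hu.deriv φ hφ t).const_mul c).congr_deriv (by ring)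

lemma comp_add_const (hu : IsDiffSolution χ γ u) (r : ℝ) :
    IsDiffSolution χ γ (fun t => u (t + r)) where
  cont := hu.cont.comp (by fun_prop)
  deriv φ hφ t := (hu.deriv φ hφ (t + r)).comp_add_const t r

lemma isWeakSolution (hγ : 0 ≤ γ) (hu : IsDiffSolution χ γ u) :
    IsWeakSolution V₀ χ γ (ofDens γ (u 0)) (fun t => ofDens γ (u t)) where
  bounded T := by
    obtain ⟨C, hC⟩ := isCompact_Icc.exists_bound_of_continuousOn (s := Icc 0 T) hu.cont.continuousOn
    refine ⟨C.toNNReal, fun t ht => ?_⟩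
    rw [eLpNorm_weighted_ofDens hγ]
    exact ENNReal.ofReal_le_ofReal (hC t ht)
  continuous A _ _ t _ := by
    refine tendsto_of_tendsto_of_tendsto_of_le_of_le tendsto_const_nhds
      ((tendsto_ofReal_norm_sub hu.cont t).mono_left nhdsWithin_le_nhds)
      (fun _ => zero_le) fun s => ?_
    rw [← ofDens_sub]
    refine (eLpNorm_mono_measure _ Measure.restrict_le_self).trans ?_
    refine (enorm_dens (mulOp (fun z => (weight γ z.1)⁻¹) (u s - u t))).le.trans ?_
    exact ENNReal.ofReal_le_ofReal (norm_inv_weight_mulOp_le hγ _)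
  initial := rfl
  equation φ hφ t _ := by
    have hd := hu.deriv φ hφ
    simp only [integral_ofDens_mul_adjointOp hγ hφ,
      integral_ofDens_mul hγ (hφ.flowDiff hγ).bdd]
    rw [intervalIntegral.integral_eq_sub_of_hasDerivAt (fun s _ => hd s)]
    · ring
    · refine Continuous.intervalIntegrable ?_ _ _
      exact ((wpair γ (flowDeriv φ)).continuous.comp hu.cont).add
        (((wpair γ φ).continuous.comp (collOp χ).continuous).comp hu.cont)

end IsDiffSolution

lemma isDiffSolution_sol (hγ : 0 ≤ γ) (g : Dens d V₀) : IsDiffSolution χ γ (sol χ γ g) where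
  cont := continuous_sol hγ g
  deriv _ hφ t := hasDerivAt_wpair_sol hγ (hφ.flowDiff hγ) g t

lemma IsWeakSolution.congr {f₀ : E d × E d →ₘ[phase d V₀] ℝ}
    {f g : ℝ → (E d × E d →ₘ[phase d V₀] ℝ)} (hf : IsWeakSolution V₀ χ γ f₀ f)
    (h : ∀ t, 0 ≤ t → g t = f t) : IsWeakSolution V₀ χ γ f₀ g where
  bounded T := by
    obtain ⟨M, hM⟩ := hf.bounded T
    exact ⟨M, fun t ht => by rw [h t ht.1]; exact hM t ht⟩
  continuous A hA hAV t ht := by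
    refine (hf.continuous A hA hAV t ht).congr' ?_
    filter_upwards [self_mem_nhdsWithin] with s hs
    rw [h s hs, h t ht]
  initial := by rw [h 0 le_rfl, hf.initial]
  equation φ hφ t ht := by
    rw [h t ht, hf.equation φ hφ t ht]
    congr 1
    refine intervalIntegral.integral_congr fun s hs => ?_
    rw [uIcc_of_le ht] at hs
    simp only [h s hs.1]

lemma integral_abs_eq_eLpNorm {μ : Measure (E d × E d)} {f : E d × E d → ℝ}
    (hf : AEStronglyMeasurable f μ) : ∫ z, |f z| ∂μ = (eLpNorm f 1 μ).toReal := by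
  rw [eLpNorm_one_eq_lintegral_enorm]
  exact integral_norm_eq_lintegral_enorm hf

lemma IsWeakSolution.exists_isWeakCurve (hγ : 0 ≤ γ) {f₀ : E d × E d →ₘ[phase d V₀] ℝ}
    {f : ℝ → (E d × E d →ₘ[phase d V₀] ℝ)} (hf : IsWeakSolution V₀ χ γ f₀ f) :
    ∃ H : ℝ → Dens d V₀, IsWeakCurve V₀ χ H ∧ ∀ t, 0 ≤ t → (H t).1 = f t := by
  have hmem : ∀ t, 0 ≤ t → MemLp (weighted γ (f t)) 1 (phase d V₀) := fun t ht => by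
    obtain ⟨M, hM⟩ := hf.bounded t
    exact ⟨aestronglyMeasurable_weighted _,
      (hM t (right_mem_Icc.2 ht)).trans_lt ENNReal.coe_lt_top⟩
  -- The curve is frozen at its initial value for negative times, so that continuity and bounds hold
  -- on the whole line without one-sided neighbourhoods.
  set g : ℝ → Dens d V₀ := fun t => (hmem (max t 0) (le_max_right _ _)).toLp _ with hg
  have hgf : ∀ t, ofDens γ (g t) = f (max t 0) := fun t => ofDens_toLp hγ _
  have hgf' : ∀ t, 0 ≤ t → ofDens γ (g t) = f t := fun t ht => by rw [hgf, max_eq_left ht]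
  set H : ℝ → Dens d V₀ := fun t => mulOp (fun z => (weight γ z.1)⁻¹) (g t) with hH
  have hpair : ∀ t, 0 ≤ t → ∀ ψ, Bdd V₀ ψ → pair ψ (H t) = ∫ z, f t z * ψ z ∂(phase d V₀) := by
    intro t ht ψ hψ
    have h1 : (H t).1 = f t := hgf' t ht
    rw [pair_apply hψ, ← h1]
    exact integral_congr_ae (Eventually.of_forall fun z => mul_comm _ _)
  refine ⟨H, ⟨fun T => ?_, fun A hA hAV t => ?_, fun φ hφ t ht => ?_⟩, hgf'⟩
  · obtain ⟨M, hM⟩ := hf.bounded (max T 0)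
    refine ⟨M, M.2, fun t ht => (norm_inv_weight_mulOp_le hγ _).trans ?_⟩
    have h1 := hM (max t 0) ⟨le_max_right _ _, max_le_max_right 0 ht⟩
    rw [← hgf t, eLpNorm_weighted_ofDens hγ] at h1
    exact (ENNReal.ofReal_le_iff_le_toReal ENNReal.coe_ne_top).1 h1
  · have h1 := hf.continuous A hA hAV (max t 0) (le_max_right _ _)
    have h2 : Tendsto (fun s : ℝ => max s 0) (𝓝 t) (𝓝[Ici 0] (max t 0)) :=
      tendsto_nhdsWithin_iff.2 ⟨(continuous_id.max continuous_const).tendsto t,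
        Eventually.of_forall fun s => mem_Ici.2 (le_max_right _ _)⟩
    have h3 := (ENNReal.tendsto_toReal ENNReal.zero_ne_top).comp (h1.comp h2)
    rw [ENNReal.toReal_zero] at h3
    refine h3.congr fun s => ?_
    simp only [Function.comp]
    rw [← hgf s, ← hgf t, ← ofDens_sub, ← integral_abs_eq_eLpNorm]
    · refine integral_congr_ae (ae_restrict_of_ae ?_)
      have h4 : ofDens γ (g s - g t) = (H s - H t : Dens d V₀).1 := by
        simp only [ofDens, map_sub, hH]
      rw [h4]
      filter_upwards [Lp.coeFn_sub (H s) (H t)] with z hz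
      exact congrArg _ hz
    · exact (AEEqFun.aestronglyMeasurable _).restrict
  · have h0 : f₀ = f 0 := hf.initial.symm
    rw [hpair t ht φ hφ.isCc.bdd, hpair 0 le_rfl φ hφ.isCc.bdd, hf.equation φ hφ t ht, h0]
    congr 1
    refine intervalIntegral.integral_congr fun s hs => ?_
    rw [uIcc_of_le ht] at hs
    exact (hpair s hs.1 _ hφ.bdd_adjointOp).symm

/-- Weak solutions are unique. -/
theorem IsWeakSolution.unique (hγ : 0 ≤ γ) {f₀ : E d × E d →ₘ[phase d V₀] ℝ}
    {f g : ℝ → (E d × E d →ₘ[phase d V₀] ℝ)} (hf : IsWeakSolution V₀ χ γ f₀ f)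
    (hg : IsWeakSolution V₀ χ γ f₀ g) {t : ℝ} (ht : 0 ≤ t) : f t = g t := by
  obtain ⟨F, hF, hFf⟩ := hf.exists_isWeakCurve hγ
  obtain ⟨G, hG, hGg⟩ := hg.exists_isWeakCurve hγ
  have h0 : F 0 - G 0 = 0 := by
    refine sub_eq_zero.2 (Subtype.ext ?_)
    rw [hFf 0 le_rfl, hGg 0 le_rfl, hf.initial, hg.initial]
  rw [← hFf t ht, ← hGg t ht, sub_eq_zero.1 ((hF.sub hG).eq_zero h0 ht)]

/-- Uniqueness in the form used from here on: a property of the flow is proved by exhibiting a curve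
that solves the equation. Sums, multiples, time shifts, rotations and constant curves are treated in
this way. -/
lemma IsDiffSolution.eq_sol (hγ : 0 ≤ γ) {u : ℝ → Dens d V₀} (hu : IsDiffSolution χ γ u)
    {t : ℝ} (ht : 0 ≤ t) : u t = sol χ γ (u 0) t := by
  have h1 := (isDiffSolution_sol (χ := χ) hγ (u 0)).isWeakSolution hγ
  rw [sol_zero hγ] at h1
  exact ofDens_injective hγ ((hu.isWeakSolution hγ).unique hγ h1 ht)

lemma sol_add (hγ : 0 ≤ γ) (f g : Dens d V₀) {t : ℝ} (ht : 0 ≤ t) :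
    sol χ γ (f + g) t = sol χ γ f t + sol χ γ g t := by
  have h := ((isDiffSolution_sol (χ := χ) hγ f).add (isDiffSolution_sol hγ g)).eq_sol hγ ht
  simpa only [sol_zero hγ] using h.symm

lemma sol_smul (hγ : 0 ≤ γ) (c : ℝ) (g : Dens d V₀) {t : ℝ} (ht : 0 ≤ t) :
    sol χ γ (c • g) t = c • sol χ γ g t := by
  have h := ((isDiffSolution_sol (χ := χ) hγ g).smul c).eq_sol hγ ht
  simpa only [sol_zero hγ] using h.symm

lemma sol_sol (hγ : 0 ≤ γ) (g : Dens d V₀) (s : ℝ) {t : ℝ} (ht : 0 ≤ t) :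
    sol χ γ (sol χ γ g s) t = sol χ γ g (t + s) := by
  have h := ((isDiffSolution_sol (χ := χ) hγ g).comp_add_const s).eq_sol hγ ht
  simpa only [zero_add] using h.symm

end WeakSolutions

/-! ### The semigroup on `X` and its bound -/

section Semigroup

set_option linter.unusedSectionVars false

variable {d : ℕ} {V₀ χ γ : ℝ}

/-- Positive and negative part; the uniform bounds rest on positivity and reach signed data only
through this splitting. -/
lemma exists_sub_eq (g : Dens d V₀) : ∃ p q : Dens d V₀, 0 ≤ p ∧ 0 ≤ q ∧ p - q = g ∧
    ‖p‖ ≤ ‖g‖ ∧ ‖q‖ ≤ ‖g‖ ∧ ∀ N, (∀ᵐ z ∂(phase d V₀), |g z| ≤ N) →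
      (∀ᵐ z ∂(phase d V₀), p z ≤ N) ∧ ∀ᵐ z ∂(phase d V₀), q z ≤ N := by
  have hp := Lp.coeFn_posPart g
  have hq := Lp.coeFn_negPart_eq_max g
  refine ⟨Lp.posPart g, Lp.negPart g, ?_, ?_, ?_, ?_, ?_, fun N hN => ⟨?_, ?_⟩⟩
  · exact (Lp.coeFn_nonneg _).1 (hp.mono fun z hz => by rw [hz]; exact le_max_right _ _)
  · exact (Lp.coeFn_nonneg _).1 (hq.mono fun z hz => by rw [hz]; exact le_max_right _ _)
  · refine Lp.ext ((Lp.coeFn_sub _ _).trans ?_)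
    filter_upwards [hp, hq] with z hz hz2
    rw [Pi.sub_apply, hz, hz2, max_zero_sub_eq_self]
  · rw [norm_dens, norm_dens]
    refine integral_mono_ae (integrable_dens _).abs (integrable_dens _).abs (hp.mono fun z hz => ?_)
    simp only [hz, abs_of_nonneg (le_max_right (g z) 0)]
    exact max_le (le_abs_self _) (abs_nonneg _)
  · rw [norm_dens, norm_dens]
    refine integral_mono_ae (integrable_dens _).abs (integrable_dens _).abs (hq.mono fun z hz => ?_)
    simp only [hz, abs_of_nonneg (le_max_right (-g z) 0)]
    exact max_le (neg_le_abs _) (abs_nonneg _)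
  · filter_upwards [hp, hN] with z hz hz2
    rw [hz]
    exact (max_le (le_abs_self _) (abs_nonneg _)).trans hz2
  · filter_upwards [hq, hN] with z hz hz2
    rw [hz]
    exact (max_le (neg_le_abs _) (abs_nonneg _)).trans hz2

variable [hV : Fact (volume (velocities d V₀) = 1)] [hχ : Fact (χ ∈ Ioo (0 : ℝ) 1)]

variable (d V₀ χ γ) in
/-- Uniform bound with constant `C` for the nonnegative solutions. -/
structure SolBound (C : ℝ) : Prop where
  nonneg : 0 ≤ C
  norm_le : ∀ g : Dens d V₀, 0 ≤ g → ∀ t, 0 ≤ t → ‖sol χ γ g t‖ ≤ C * ‖g‖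
  le : ∀ g : Dens d V₀, 0 ≤ g → ∀ N, 0 ≤ N → (∀ᵐ z ∂(phase d V₀), g z ≤ N) → ∀ t, 0 ≤ t →
    ∀ᵐ z ∂(phase d V₀), sol χ γ g t z ≤ C * (‖g‖ + N)

namespace SolBound

variable {C : ℝ}

lemma sol_sub (hγ : 0 ≤ γ) (p q : Dens d V₀) {t : ℝ} (ht : 0 ≤ t) :
    sol χ γ (p - q) t = sol χ γ p t - sol χ γ q t := by
  rw [sub_eq_add_neg, ← neg_one_smul ℝ q, sol_add hγ _ _ ht, sol_smul hγ _ _ ht, neg_one_smul,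
    sub_eq_add_neg]

lemma norm_sol_le (hC : SolBound d V₀ χ γ C) (hγ : 0 ≤ γ) (g : Dens d V₀) {t : ℝ} (ht : 0 ≤ t) :
    ‖sol χ γ g t‖ ≤ 2 * C * ‖g‖ := by
  obtain ⟨p, q, hp, hq, hpq, hpn, hqn, -⟩ := exists_sub_eq g
  rw [← hpq, sol_sub hγ _ _ ht, hpq]
  have h1 := (hC.norm_le p hp t ht).trans (mul_le_mul_of_nonneg_left hpn hC.nonneg)
  have h2 := (hC.norm_le q hq t ht).trans (mul_le_mul_of_nonneg_left hqn hC.nonneg)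
  linarith [norm_sub_le (sol χ γ p t) (sol χ γ q t)]

lemma abs_sol_le (hC : SolBound d V₀ χ γ C) (hγ : 0 ≤ γ) {g : Dens d V₀} {N : ℝ} (hN : 0 ≤ N)
    (hg : ∀ᵐ z ∂(phase d V₀), |g z| ≤ N) {t : ℝ} (ht : 0 ≤ t) :
    ∀ᵐ z ∂(phase d V₀), |sol χ γ g t z| ≤ C * (‖g‖ + N) := by
  obtain ⟨p, q, hp, hq, hpq, hpn, hqn, hpqN⟩ := exists_sub_eq g
  have h0 : sol χ γ g t = sol χ γ p t - sol χ γ q t := by rw [← hpq, sol_sub hγ _ _ ht]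
  rw [h0]
  filter_upwards [Lp.coeFn_sub (sol χ γ p t) (sol χ γ q t), hC.le p hp N hN (hpqN N hg).1 t ht,
    hC.le q hq N hN (hpqN N hg).2 t ht, (Lp.coeFn_nonneg _).2 (sol_nonneg (χ := χ) hγ hp ht),
    (Lp.coeFn_nonneg _).2 (sol_nonneg (χ := χ) hγ hq ht)] with z hz h1 h2 h3 h4
  rw [hz, Pi.sub_apply, abs_le]
  rw [Pi.zero_apply] at h3 h4
  have h5 : C * (‖p‖ + N) ≤ C * (‖g‖ + N) := mul_le_mul_of_nonneg_left (by linarith) hC.nonneg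
  have h6 : C * (‖q‖ + N) ≤ C * (‖g‖ + N) := mul_le_mul_of_nonneg_left (by linarith) hC.nonneg
  constructor <;> linarith

end SolBound

/-- Approximating `h` in `L¹` by bounded continuous functions gives pairings that are continuous by
`L¹` continuity of `u`, and the sup bound `K` makes the convergence uniform on `s`. The denominator
`|K| + 1` below avoids the case `K = 0`. -/
lemma continuousOn_integral_mul {u : ℝ → Dens d V₀} (hu : Continuous u) {K : ℝ} {s : Set ℝ}
    (hK : ∀ t ∈ s, ∀ᵐ z ∂(phase d V₀), |u t z| ≤ K) {h : E d × E d → ℝ}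
    (hh : Integrable h (phase d V₀)) :
    ContinuousOn (fun t => ∫ z, u t z * h z ∂(phase d V₀)) s := by
  refine continuousOn_of_uniform_approx_of_continuousOn fun U hU => ?_
  obtain ⟨ε, hε, hεU⟩ := Metric.mem_uniformity_dist.1 hU
  obtain ⟨k, hk, hki⟩ := hh.exists_boundedContinuous_integral_sub_le
    (ε := ε / (|K| + 1)) (by positivity)
  have hkb : Bdd V₀ (fun z => k z) := ⟨k.continuous.measurable, ‖k‖, fun z _ => k.norm_coe_le_norm z⟩
  refine ⟨fun t => pair (fun z => k z) (u t), ((pair _).continuous.comp hu).continuousOn,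
    fun t ht => hεU ?_⟩
  have hint : Integrable (fun z => u t z * h z) (phase d V₀) :=
    hh.bdd_mul (integrable_dens _).aestronglyMeasurable ((hK t ht).mono fun z hz => hz)
  simp only [Real.dist_eq]
  rw [pair_apply hkb, ← integral_sub hint (integrable_mul_dens hkb _)]
  calc |∫ z, (u t z * h z - k z * u t z) ∂(phase d V₀)|
      ≤ ∫ z, |K| * ‖h z - k z‖ ∂(phase d V₀) := by
        rw [← Real.norm_eq_abs]
        refine norm_integral_le_of_norm_le ((hh.sub hki).norm.const_mul _) ?_
        filter_upwards [hK t ht] with z hz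
        have : u t z * h z - k z * u t z = u t z * (h z - k z) := by ring
        rw [this, norm_mul]
        exact mul_le_mul_of_nonneg_right (hz.trans (le_abs_self _)) (norm_nonneg _)
    _ = |K| * ∫ z, ‖h z - k z‖ ∂(phase d V₀) := integral_const_mul _ _
    _ ≤ |K| * (ε / (|K| + 1)) := mul_le_mul_of_nonneg_left hk (abs_nonneg _)
    _ < (|K| + 1) * (ε / (|K| + 1)) := mul_lt_mul_of_pos_right (by linarith) (by positivity)
    _ = ε := by field_simp

/-- The element `m f` of `L¹`, for `f` in `X`. -/
noncomputable def toDens (f : X d V₀ γ) : Dens d V₀ := f.2.1.toLp _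

lemma ofDens_toDens (hγ : 0 ≤ γ) (f : X d V₀ γ) : ofDens γ (toDens f) = f.1 :=
  ofDens_toLp hγ f.2.1

lemma coeFn_toDens (f : X d V₀ γ) : toDens f =ᵐ[phase d V₀] weighted γ f.1 := f.2.1.coeFn_toLp

lemma toDens_add (f g : X d V₀ γ) (hγ : 0 ≤ γ) : toDens (f + g) = toDens f + toDens g := by
  refine ofDens_injective hγ ?_
  rw [ofDens_add, ofDens_toDens hγ, ofDens_toDens hγ, ofDens_toDens hγ]
  rfl

lemma toDens_smul (c : ℝ) (f : X d V₀ γ) (hγ : 0 ≤ γ) : toDens (c • f) = c • toDens f := by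
  refine ofDens_injective hγ ?_
  rw [ofDens_smul, ofDens_toDens hγ, ofDens_toDens hγ]
  rfl

/-- The supremum norm of `m f`. -/
noncomputable def supNorm (f : X d V₀ γ) : ℝ := (eLpNorm (weighted γ f.1) ⊤ (phase d V₀)).toReal

lemma ofReal_supNorm (f : X d V₀ γ) :
    ENNReal.ofReal (supNorm f) = eLpNorm (weighted γ f.1) ⊤ (phase d V₀) :=
  ENNReal.ofReal_toReal f.2.2.eLpNorm_ne_top

lemma abs_toDens_le (f : X d V₀ γ) : ∀ᵐ z ∂(phase d V₀), |toDens f z| ≤ supNorm f := by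
  filter_upwards [coeFn_toDens f, enorm_ae_le_eLpNormEssSup (weighted γ f.1) (phase d V₀)]
    with z hz hz2
  rw [hz, ← Real.norm_eq_abs, ← toReal_enorm]
  rw [← eLpNorm_exponent_top] at hz2
  exact ENNReal.toReal_mono f.2.2.eLpNorm_ne_top hz2

lemma normX_eq (hγ : 0 ≤ γ) (f : X d V₀ γ) :
    normX γ f.1 = ENNReal.ofReal (‖toDens f‖ + supNorm f) := by
  rw [ENNReal.ofReal_add (norm_nonneg _) (show 0 ≤ supNorm f from ENNReal.toReal_nonneg), ofReal_supNorm,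
    ← eLpNorm_weighted_ofDens hγ, ofDens_toDens hγ, normX]

lemma eLpNorm_top_weighted_ofDens_le (hγ : 0 ≤ γ) {g : Dens d V₀} {N : ℝ}
    (hg : ∀ᵐ z ∂(phase d V₀), |g z| ≤ N) :
    eLpNorm (weighted γ (ofDens γ g)) ⊤ (phase d V₀) ≤ ENNReal.ofReal N := by
  rw [eLpNorm_congr_ae (weighted_ofDens hγ g), eLpNorm_exponent_top]
  exact eLpNormEssSup_le_of_ae_bound hg

lemma ofDens_mem_X (hγ : 0 ≤ γ) {g : Dens d V₀} {N : ℝ}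
    (hg : ∀ᵐ z ∂(phase d V₀), |g z| ≤ N) : ofDens γ g ∈ X d V₀ γ :=
  ⟨⟨aestronglyMeasurable_weighted _, by
      rw [eLpNorm_weighted_ofDens hγ]; exact ENNReal.ofReal_lt_top⟩,
    ⟨aestronglyMeasurable_weighted _,
      (eLpNorm_top_weighted_ofDens_le hγ hg).trans_lt ENNReal.ofReal_lt_top⟩⟩

lemma toDens_eq_of_eq_ofDens (hγ : 0 ≤ γ) {f : X d V₀ γ} {g : Dens d V₀} (h : f.1 = ofDens γ g) :
    toDens f = g :=
  ofDens_injective hγ (by rw [ofDens_toDens hγ, h])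

variable {C : ℝ}

lemma abs_sol_toDens_le (hC : SolBound d V₀ χ γ C) (hγ : 0 ≤ γ) (f : X d V₀ γ) {t : ℝ}
    (ht : 0 ≤ t) : ∀ᵐ z ∂(phase d V₀),
      |sol χ γ (toDens f) t z| ≤ C * (‖toDens f‖ + supNorm f) :=
  hC.abs_sol_le hγ ENNReal.toReal_nonneg (abs_toDens_le f) ht

/-- The semigroup on `X`. It is extended by the identity to negative times. -/
noncomputable def semigroup (hC : SolBound d V₀ χ γ C) (hγ : 0 ≤ γ) (t : ℝ) :
    X d V₀ γ →ₗ[ℝ] X d V₀ γ where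
  toFun f := ⟨ofDens γ (sol χ γ (toDens f) (max t 0)),
    ofDens_mem_X hγ (abs_sol_toDens_le hC hγ f (le_max_right _ _))⟩
  map_add' f g := Subtype.ext <| by
    change ofDens γ (sol χ γ (toDens (f + g)) _) = ofDens γ (sol χ γ (toDens f) _) +
      ofDens γ (sol χ γ (toDens g) _)
    rw [toDens_add f g hγ, sol_add hγ _ _ (le_max_right _ _), ofDens_add]
  map_smul' c f := Subtype.ext <| by
    change ofDens γ (sol χ γ (toDens (c • f)) _) = c • ofDens γ (sol χ γ (toDens f) _)
    rw [toDens_smul c f hγ, sol_smul hγ _ _ (le_max_right _ _), ofDens_smul]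

variable (hC : SolBound d V₀ χ γ C) (hγ : 0 ≤ γ)

lemma semigroup_apply (f : X d V₀ γ) {t : ℝ} (ht : 0 ≤ t) :
    (semigroup hC hγ t f).1 = ofDens γ (sol χ γ (toDens f) t) := by
  have h : (semigroup hC hγ t f).1 = ofDens γ (sol χ γ (toDens f) (max t 0)) := rfl
  rw [h, max_eq_left ht]

lemma toDens_semigroup (f : X d V₀ γ) {t : ℝ} (ht : 0 ≤ t) :
    toDens (semigroup hC hγ t f) = sol χ γ (toDens f) t :=
  toDens_eq_of_eq_ofDens hγ (semigroup_apply hC hγ f ht)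

lemma isWeakSolution_semigroup (f : X d V₀ γ) :
    IsWeakSolution V₀ χ γ f.1 (fun t => (semigroup hC hγ t f).1) := by
  have h := (isDiffSolution_sol (χ := χ) hγ (toDens f)).isWeakSolution hγ
  rw [sol_zero hγ, ofDens_toDens hγ] at h
  exact h.congr fun t ht => semigroup_apply hC hγ f ht

theorem isFlow_semigroup : IsFlow V₀ χ γ (semigroup hC hγ) where
  solution := isWeakSolution_semigroup hC hγ
  unique f g hg t ht := hg.unique hγ (isWeakSolution_semigroup hC hγ f) ht
  zero := by
    refine LinearMap.ext fun f => Subtype.ext ?_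
    rw [semigroup_apply hC hγ f le_rfl, sol_zero hγ, ofDens_toDens hγ]
    rfl
  add s t hs ht := by
    refine LinearMap.ext fun f => Subtype.ext ?_
    rw [LinearMap.comp_apply, semigroup_apply hC hγ _ (add_nonneg hs ht),
      semigroup_apply hC hγ _ hs, toDens_semigroup hC hγ _ ht, sol_sol hγ _ _ hs]
  strong f t ht := by
    have h := (tendsto_ofReal_norm_sub (continuous_sol (χ := χ) hγ (toDens f)) t).mono_left
      (nhdsWithin_le_nhds (s := Ici 0))
    refine h.congr' ?_
    filter_upwards [self_mem_nhdsWithin] with s hs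
    have h1 : (semigroup hC hγ s f - semigroup hC hγ t f : X d V₀ γ).1 =
        ofDens γ (sol χ γ (toDens f) s - sol χ γ (toDens f) t) := by
      rw [ofDens_sub, ← semigroup_apply hC hγ f hs, ← semigroup_apply hC hγ f ht]
      rfl
    rw [h1, eLpNorm_weighted_ofDens hγ]
  weakStar f ψ hψ := by
    refine (continuousOn_integral_mul (continuous_sol (χ := χ) hγ (toDens f))
      (fun t ht => abs_sol_toDens_le hC hγ f ht) hψ).congr fun t ht => ?_
    simp only
    rw [semigroup_apply hC hγ f ht]
    refine integral_congr_ae ((coeFn_ofDens hγ (sol χ γ (toDens f) t)).mono fun z hz => ?_)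
    simp only [hz]
    ring

/-- The constant `3 C` adds `2 C` from the `L¹` norms of positive and negative part and `C` from the
sup norm, which itself involves the initial `L¹` norm. -/
theorem normX_semigroup_le (f : X d V₀ γ) {t : ℝ} (ht : 0 ≤ t) :
    normX γ (semigroup hC hγ t f).1 ≤ ((3 * C).toNNReal : ENNReal) * normX γ f.1 := by
  have hN : 0 ≤ supNorm f := ENNReal.toReal_nonneg
  have hC0 := hC.nonneg
  rw [normX_eq hγ f, ENNReal.ofNNReal_toNNReal, ← ENNReal.ofReal_mul (by positivity), normX,
    semigroup_apply hC hγ f ht, eLpNorm_weighted_ofDens hγ]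
  refine (add_le_add (ENNReal.ofReal_le_ofReal (hC.norm_sol_le hγ (toDens f) ht))
    (eLpNorm_top_weighted_ofDens_le hγ (abs_sol_toDens_le hC hγ f ht))).trans ?_
  rw [← ENNReal.ofReal_add (by positivity) (by positivity)]
  refine ENNReal.ofReal_le_ofReal ?_
  have := mul_nonneg hC0 hN
  linarith

end Semigroup

/-! ### Weak compactness without loss of mass -/

section WeakLimit

set_option linter.unusedSectionVars false

/-- Bounded sequences in a Hilbert space converge weakly along every ultrafilter. -/
lemma exists_weak_limit_hilbert {H : Type*} [NormedAddCommGroup H] [InnerProductSpace ℝ H]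
    [CompleteSpace H] {b : ℕ → H} {K : ℝ} (hb : ∀ n, ‖b n‖ ≤ K) (U : Ultrafilter ℕ) :
    ∃ g : H, ∀ h : H, Tendsto (fun n => inner ℝ (b n) h) U (𝓝 (inner ℝ g h)) := by
  -- Riesz representation turns weak convergence into weak-star convergence, and Banach–Alaoglu
  -- provides the limit.
  set T : ℕ → WeakDual ℝ H := fun n => StrongDual.toWeakDual (InnerProductSpace.toDual ℝ H (b n))
    with hT
  obtain ⟨L, -, hL⟩ := (WeakDual.isCompact_closedBall (0 : StrongDual ℝ H) K).ultrafilter_le_nhds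
    (U.map T) (by
      rw [Ultrafilter.coe_map, le_principal_iff, mem_map]
      refine Filter.univ_mem' fun n => ?_
      rw [mem_preimage, mem_preimage, mem_closedBall_zero_iff]
      exact ((InnerProductSpace.toDual ℝ H).norm_map (b n)).le.trans (hb n))
  refine ⟨(InnerProductSpace.toDual ℝ H).symm (WeakDual.toStrongDual L), fun h => ?_⟩
  rw [InnerProductSpace.toDual_symm_apply]
  have h1 : Tendsto T U (𝓝 L) := hL
  exact ((WeakDual.eval_continuous h).tendsto L).comp h1

variable {d : ℕ} {V₀ χ γ : ℝ}

lemma integrable_sq_dens {g : Dens d V₀} {K : ℝ} (hK : ∀ᵐ z ∂(phase d V₀), |g z| ≤ K) :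
    Integrable (fun z => g z ^ 2) (phase d V₀) := by
  simp only [pow_two]
  exact (integrable_dens g).bdd_mul (integrable_dens g).aestronglyMeasurable hK

lemma memLp_two_dens {g : Dens d V₀} {K : ℝ} (hK : ∀ᵐ z ∂(phase d V₀), |g z| ≤ K) :
    MemLp g 2 (phase d V₀) :=
  (memLp_two_iff_integrable_sq (integrable_dens g).aestronglyMeasurable).2 (integrable_sq_dens hK)

lemma inner_toLp {f g : E d × E d → ℝ} (hf : MemLp f 2 (phase d V₀)) (hg : MemLp g 2 (phase d V₀)) :
    inner ℝ (hf.toLp f) (hg.toLp g) = ∫ z, g z * f z ∂(phase d V₀) := by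
  rw [L2.inner_def]
  refine integral_congr_ae ?_
  filter_upwards [hf.coeFn_toLp, hg.coeFn_toLp] with z hz hz2
  rw [hz, hz2]
  rfl

/-- Interpolation: the squared `L²` norm is at most the sup norm times the `L¹` norm. -/
lemma norm_toLp_two_le {g : Dens d V₀} {K : ℝ} (hK0 : 0 ≤ K)
    (hK : ∀ᵐ z ∂(phase d V₀), |g z| ≤ K) (hn : ‖g‖ ≤ K) : ‖(memLp_two_dens hK).toLp g‖ ≤ K := by
  refine le_of_sq_le_sq ?_ hK0
  rw [← real_inner_self_eq_norm_sq, inner_toLp]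
  calc ∫ z, g z * g z ∂(phase d V₀) ≤ ∫ z, K * |g z| ∂(phase d V₀) := by
        refine integral_mono_ae ?_ ((integrable_dens g).abs.const_mul K) (hK.mono fun z hz => ?_)
        · simpa only [pow_two] using integrable_sq_dens hK
        · have := mul_le_mul_of_nonneg_right hz (abs_nonneg (g z))
          simpa only [abs_mul_abs_self] using this
    _ = K * ‖g‖ := by rw [integral_const_mul, norm_dens]
    _ ≤ K ^ 2 := by rw [pow_two]; exact mul_le_mul_of_nonneg_left hn hK0

/-- The square of the inverse weight is integrable. -/
lemma integrable_inv_weight_sq [hV : Fact (volume (velocities d V₀) = 1)] (hγ : 0 < γ) :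
    Integrable (fun z : E d × E d => (weight γ z.1)⁻¹ ^ 2) (phase d V₀) := by
  -- The exponent `d + 1` exceeds the dimension, and a single term of the exponential series shows
  -- that `m²` dominates a multiple of `(1 + ‖x‖)^(d + 1)`.
  have h1 : Integrable (fun x : E d => (1 + ‖x‖) ^ (-((d + 1 : ℕ) : ℝ))) :=
    integrable_one_add_norm (by simp)
  have h2 : Integrable fun x : E d => (weight γ x)⁻¹ ^ 2 := by
    refine (h1.const_mul ((d + 1).factorial / γ ^ (d + 1))).mono' ?_
      (Eventually.of_forall fun x => ?_)
    · exact ((continuous_weight.inv₀ fun x => (weight_pos x).ne').pow 2).aestronglyMeasurable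
    · have h3 : (1 : ℝ) + ‖x‖ ≤ 2 * bracket x := by linarith [one_le_bracket x, norm_le_bracket x]
      have h4 := Real.pow_div_factorial_le_exp (2 * γ * bracket x)
        (by have := bracket_pos x; positivity) (d + 1)
      have h5 : weight γ x ^ 2 = Real.exp (2 * γ * bracket x) := by
        rw [weight_eq, ← Real.exp_nat_mul]; congr 1; push_cast; ring
      have h6 : (γ * (1 + ‖x‖)) ^ (d + 1) ≤ (2 * γ * bracket x) ^ (d + 1) := by
        refine pow_le_pow_left₀ (by positivity) ?_ _
        nlinarith
      have h7 : (γ * (1 + ‖x‖)) ^ (d + 1) / (d + 1).factorial ≤ weight γ x ^ 2 := by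
        rw [h5]
        exact (div_le_div_of_nonneg_right h6 (by positivity)).trans h4
      rw [Real.norm_eq_abs, abs_of_nonneg (by have := weight_pos (γ := γ) x; positivity), inv_pow,
        Real.rpow_neg (by positivity), Real.rpow_natCast]
      refine (inv_anti₀ (by positivity) h7).trans (le_of_eq ?_)
      rw [mul_pow]
      field_simp
  exact h2.comp_fst (vel d V₀)

variable [hV : Fact (volume (velocities d V₀) = 1)]

/-- Bounded functions, constants included, thus become admissible in weak `L²` limits of `g = m f`.
This tightness prevents the escape of mass. -/
lemma memLp_two_inv_weight_mul (hγ : 0 < γ) {ψ : E d × E d → ℝ} (hψ : Bdd V₀ ψ) :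
    MemLp (fun z => (weight γ z.1)⁻¹ * ψ z) 2 (phase d V₀) := by
  have hm := (bdd_inv_weight_mul hγ.le hψ).meas
  rw [memLp_two_iff_integrable_sq hm.aestronglyMeasurable]
  obtain ⟨C, hC0, hC⟩ := hψ.exists_nonneg_bound
  refine ((integrable_inv_weight_sq hγ).const_mul (C ^ 2)).mono'
    (hm.pow_const 2).aestronglyMeasurable ?_
  filter_upwards [ae_mem_velocities] with z hz
  rw [Real.norm_eq_abs, abs_of_nonneg (sq_nonneg _), mul_pow, mul_comm]
  refine mul_le_mul_of_nonneg_right ?_ (sq_nonneg _)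
  rw [← sq_abs]
  exact pow_le_pow_left₀ (abs_nonneg _) (hC z hz) 2

lemma sign_mul_self_eq_norm (r : ℝ) : Real.sign r * r = ‖r‖ := by
  rw [Real.norm_eq_abs]
  rcases lt_trichotomy r 0 with h | rfl | h
  · rw [Real.sign_of_neg h, abs_of_neg h, neg_one_mul]
  · simp
  · rw [Real.sign_of_pos h, abs_of_pos h, one_mul]

lemma bdd_indicator_sign {g : E d × E d → ℝ} (hg : Measurable g) {S : Set (E d × E d)}
    (hS : MeasurableSet S) : Bdd V₀ (S.indicator fun z => Real.sign (g z)) := by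
  refine ⟨(measurable_sign.comp hg).indicator hS, 1, fun z _ => ?_⟩
  by_cases h : z ∈ S
  · rw [indicator_of_mem h]
    exact abs_le.2 ⟨neg_one_le_sign _, sign_le_one _⟩
  · rw [indicator_of_notMem h, abs_zero]
    exact zero_le_one

/-- Weak compactness of bounded sequences of nonnegative elements of `L¹ ∩ L^∞`. -/
theorem exists_weak_limit (hγ : 0 < γ) {a : ℕ → Dens d V₀} {K : ℝ} (hK0 : 0 ≤ K)
    (h0 : ∀ n, 0 ≤ a n) (hn : ∀ n, ‖a n‖ ≤ K) (hK : ∀ n, ∀ᵐ z ∂(phase d V₀), a n z ≤ K)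
    (U : Ultrafilter ℕ) : ∃ g : Dens d V₀, 0 ≤ g ∧ (∀ᵐ z ∂(phase d V₀), g z ≤ K) ∧
      ∀ ψ, Bdd V₀ ψ → Tendsto (fun n => wpair γ ψ (a n)) U (𝓝 (wpair γ ψ g)) := by
  have hK' : ∀ n, ∀ᵐ z ∂(phase d V₀), |a n z| ≤ K := fun n => by
    filter_upwards [hK n, (Lp.coeFn_nonneg _).2 (h0 n)] with z hz hz2
    rwa [abs_of_nonneg hz2]
  obtain ⟨G, hG⟩ := exists_weak_limit_hilbert
    (fun n => norm_toLp_two_le hK0 (hK' n) (hn n)) U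
  have hGm : MemLp G 2 (phase d V₀) := Lp.memLp G
  have hlim : ∀ ψ : E d × E d → ℝ, MemLp ψ 2 (phase d V₀) →
      Tendsto (fun n => ∫ z, ψ z * a n z ∂(phase d V₀)) U (𝓝 (∫ z, ψ z * G z ∂(phase d V₀))) := by
    intro ψ hψ
    have h1 := hG (hψ.toLp ψ)
    simp only [inner_toLp] at h1
    have h2 : inner ℝ G (hψ.toLp ψ) = ∫ z, ψ z * G z ∂(phase d V₀) := by
      conv_lhs => rw [← Lp.toLp_coeFn G hGm]
      exact inner_toLp hGm hψ
    rwa [h2] at h1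
  have hset : ∀ {S : Set (E d × E d)} {ψ : E d × E d → ℝ}, MeasurableSet S → phase d V₀ S < ⊤ →
      Bdd V₀ (S.indicator ψ) → MemLp (S.indicator ψ) 2 (phase d V₀) := by
    intro S ψ hS hS' hb
    obtain ⟨C, hC⟩ := hb.bound
    refine (memLp_indicator_const (E := ℝ) 2 hS C (Or.inr hS'.ne)).mono
      hb.meas.aestronglyMeasurable ?_
    filter_upwards [ae_mem_velocities] with z hz
    by_cases h : z ∈ S
    · rw [indicator_of_mem (f := fun _ => C) h]
      exact (hC z hz).trans (le_abs_self _)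
    · rw [indicator_of_notMem h, indicator_of_notMem h]
  -- The limit is a priori only in `L²`. Testing with the sign of `G` on a set of finite measure
  -- bounds its `L¹` norm there by `K`, uniformly in the set.
  have hGi : Integrable G (phase d V₀) := by
    refine integrable_of_forall_fin_meas_le (ENNReal.ofReal K) ENNReal.ofReal_lt_top
      hGm.aestronglyMeasurable fun S hS hS' => ?_
    have hGS : IntegrableOn G S (phase d V₀) := by
      have : IsFiniteMeasure ((phase d V₀).restrict S) := ⟨by simpa using hS'.lt_top⟩
      exact (hGm.restrict S).integrable one_le_two
    have hb := bdd_indicator_sign (V₀ := V₀) (Lp.stronglyMeasurable G).measurable hS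
    have h1 := hlim _ (hset hS hS'.lt_top hb)
    have h2 : ∫ z, S.indicator (fun z => Real.sign (G z)) z * G z ∂(phase d V₀) =
        ∫ z in S, ‖G z‖ ∂(phase d V₀) := by
      rw [← integral_indicator hS]
      refine integral_congr_ae (Eventually.of_forall fun z => ?_)
      by_cases h : z ∈ S
      · simp only [indicator_of_mem h]
        rw [sign_mul_self_eq_norm]
      · simp only [indicator_of_notMem h, zero_mul]
    rw [h2] at h1
    have h3 : ∫ z in S, ‖G z‖ ∂(phase d V₀) ≤ K := by
      refine le_of_tendsto' h1 fun n => ?_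
      rw [← pair_apply hb]
      refine (le_abs_self _).trans ((abs_pair_le hb (C := 1) (fun z _ => ?_) _).trans ?_)
      · by_cases h : z ∈ S
        · rw [indicator_of_mem h]
          exact abs_le.2 ⟨neg_one_le_sign _, sign_le_one _⟩
        · rw [indicator_of_notMem h, abs_zero]
          exact zero_le_one
      · rw [one_mul]; exact hn n
    rw [← ofReal_integral_norm_eq_lintegral_enorm hGS]
    exact ENNReal.ofReal_le_ofReal h3
  set g : Dens d V₀ := hGi.toL1 G with hg
  have hgG : g =ᵐ[phase d V₀] G := hGi.coeFn_toL1
  have hlim' : ∀ ψ, Bdd V₀ ψ → MemLp ψ 2 (phase d V₀) →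
      Tendsto (fun n => pair ψ (a n)) U (𝓝 (pair ψ g)) := by
    intro ψ hb hψ
    have h1 : pair ψ g = ∫ z, ψ z * G z ∂(phase d V₀) := by
      rw [pair_apply hb]
      exact integral_congr_ae (hgG.mono fun z hz => by simp only [hz])
    simp only [h1, pair_apply hb]
    exact hlim ψ hψ
  have hlimS : ∀ S, MeasurableSet S → phase d V₀ S < ⊤ →
      Tendsto (fun n => setPair S (a n)) U (𝓝 (setPair S g)) := fun S hS hS' =>
    hlim' _ (Bdd.indicator_one hS) (hset hS hS' (Bdd.indicator_one hS))
  refine ⟨g, ?_, ?_, fun ψ hψ => hlim' _ (bdd_inv_weight_mul hγ.le hψ)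
    (memLp_two_inv_weight_mul hγ hψ)⟩
  · have h1 : ∀ᵐ z ∂(phase d V₀), (-g : Dens d V₀) z ≤ 0 := by
      refine ae_le_of_setPair_le fun S hS hS' => ?_
      rw [map_neg, zero_mul, neg_nonpos]
      exact ge_of_tendsto' (hlimS S hS hS') fun n => setPair_nonneg hS (h0 n)
    refine (Lp.coeFn_nonneg _).1 ?_
    filter_upwards [h1, Lp.coeFn_neg g] with z hz hz2
    rw [hz2, Pi.neg_apply] at hz
    exact neg_nonpos.1 hz
  · refine ae_le_of_setPair_le fun S hS hS' => ?_
    exact le_of_tendsto' (hlimS S hS hS') fun n => setPair_le hS hS' (hK n)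

end WeakLimit

/-! ### Invariance of the equation under linear isometries -/

section Rotations

set_option linter.unusedSectionVars false

variable {d : ℕ} {V₀ χ γ : ℝ}

/-- The action of the linear isometries on the phase space. -/
noncomputable def rot (R : E d ≃ₗᵢ[ℝ] E d) : (E d × E d) ≃L[ℝ] (E d × E d) :=
  R.toContinuousLinearEquiv.prodCongr R.toContinuousLinearEquiv

lemma rot_apply (R : E d ≃ₗᵢ[ℝ] E d) (z : E d × E d) : rot R z = (R z.1, R z.2) := rfl

lemma rot_symm_rot (R : E d ≃ₗᵢ[ℝ] E d) (z : E d × E d) : rot R.symm (rot R z) = z := by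
  simp [rot_apply]

lemma mem_velocities_iff (R : E d ≃ₗᵢ[ℝ] E d) (v : E d) :
    R v ∈ velocities d V₀ ↔ v ∈ velocities d V₀ := by
  simp [velocities]

lemma preimage_velocities (R : E d ≃ₗᵢ[ℝ] E d) : R ⁻¹' velocities d V₀ = velocities d V₀ :=
  Set.ext fun v => mem_velocities_iff R v

lemma measurePreserving_vel (R : E d ≃ₗᵢ[ℝ] E d) : MeasurePreserving R (vel d V₀) (vel d V₀) := by
  have h := R.measurePreserving.restrict_preimage (measurableSet_velocities (d := d) (V₀ := V₀))
  rwa [preimage_velocities] at h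

lemma measurePreserving_rot (R : E d ≃ₗᵢ[ℝ] E d) :
    MeasurePreserving (rot R) (phase d V₀) (phase d V₀) :=
  R.measurePreserving.prod (measurePreserving_vel R)

lemma integral_rot (R : E d ≃ₗᵢ[ℝ] E d) (f : E d × E d → ℝ) :
    ∫ z, f (rot R z) ∂(phase d V₀) = ∫ z, f z ∂(phase d V₀) :=
  (measurePreserving_rot R).integral_comp
    (rot R).toHomeomorph.isClosedEmbedding.measurableEmbedding f

lemma weight_rot (R : E d ≃ₗᵢ[ℝ] E d) (x : E d) : weight γ (R x) = weight γ x := by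
  simp [weight]

lemma turning_rot (R : E d ≃ₗᵢ[ℝ] E d) (x v : E d) : turning χ (R x) (R v) = turning χ x v := by
  simp [turning]

lemma Bdd.comp_rot {ψ : E d × E d → ℝ} (h : Bdd V₀ ψ) (R : E d ≃ₗᵢ[ℝ] E d) :
    Bdd V₀ (fun z => ψ (rot R z)) := by
  obtain ⟨C, hC⟩ := h.bound
  exact ⟨h.meas.comp (rot R).continuous.measurable, C,
    fun z hz => hC _ ((mem_velocities_iff R z.2).2 hz)⟩

lemma IsTest.comp_rot {φ : E d × E d → ℝ} (h : IsTest d V₀ φ) (R : E d ≃ₗᵢ[ℝ] E d) :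
    IsTest d V₀ (fun z => φ (rot R z)) where
  contDiff := h.contDiff.comp (rot R).contDiff
  compact := h.compact.comp_homeomorph (rot R).toHomeomorph
  support := by
    have h1 : tsupport (fun z => φ (rot R z)) = rot R ⁻¹' tsupport φ :=
      tsupport_comp_eq_preimage φ (rot R).toHomeomorph
    rw [h1]
    exact fun z hz => ⟨mem_univ _, (mem_velocities_iff R z.2).1 (h.support hz).2⟩

/-- The operator is built from inner products and from Lebesgue measure on a centered ball, all
invariant under isometries; orientation plays no role. -/
lemma adjointOp_comp_rot (R : E d ≃ₗᵢ[ℝ] E d) (φ : E d × E d → ℝ) (z : E d × E d) :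
    adjointOp V₀ χ (fun z => φ (rot R z)) z = adjointOp V₀ χ φ (rot R z) := by
  have h1 : fderiv ℝ (fun z => φ (rot R z)) z (z.2, 0) =
      fderiv ℝ φ (rot R z) ((rot R z).2, 0) := by
    have h := (rot R).comp_right_fderiv (f := φ) (x := z)
    have h' : fderiv ℝ (fun z => φ (rot R z)) z = _ := h
    rw [h', ContinuousLinearMap.comp_apply]
    simp [rot_apply]
  have h2 : ∫ v' in velocities d V₀, (φ (rot R (z.1, v')) - φ (rot R z)) =
      ∫ v' in velocities d V₀, (φ ((rot R z).1, v') - φ (rot R z)) :=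
    (measurePreserving_vel R).integral_comp R.toHomeomorph.isClosedEmbedding.measurableEmbedding
      fun v => φ ((rot R z).1, v) - φ (rot R z)
  rw [adjointOp, adjointOp, h1, h2, rot_apply, turning_rot]

/-- Composition with a linear isometry. -/
noncomputable def rotOp (R : E d ≃ₗᵢ[ℝ] E d) : Dens d V₀ →L[ℝ] Dens d V₀ :=
  (Lp.compMeasurePreservingₗᵢ ℝ (rot R) (measurePreserving_rot R)).toContinuousLinearMap

lemma coeFn_rotOp (R : E d ≃ₗᵢ[ℝ] E d) (g : Dens d V₀) :
    rotOp R g =ᵐ[phase d V₀] fun z => g (rot R z) :=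
  Lp.coeFn_compMeasurePreserving g (measurePreserving_rot R)

lemma wpair_rotOp (hγ : 0 ≤ γ) {ψ : E d × E d → ℝ} (h : Bdd V₀ ψ) (R : E d ≃ₗᵢ[ℝ] E d)
    (g : Dens d V₀) : wpair γ ψ (rotOp R g) = wpair γ (fun z => ψ (rot R.symm z)) g := by
  rw [wpair, wpair, pair_apply (bdd_inv_weight_mul hγ h),
    pair_apply (bdd_inv_weight_mul hγ (h.comp_rot R.symm)),
    ← integral_rot R fun z => (weight γ z.1)⁻¹ * ψ (rot R.symm z) * g z]
  refine integral_congr_ae ((coeFn_rotOp R g).mono fun z hz => ?_)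
  simp only [hz, rot_symm_rot]
  rw [rot_apply, weight_rot]

variable [hV : Fact (volume (velocities d V₀) = 1)]

lemma eq_of_wpair_eq (hγ : 0 ≤ γ) {f g : Dens d V₀}
    (h : ∀ ψ, Bdd V₀ ψ → wpair γ ψ f = wpair γ ψ g) : f = g := by
  refine ofDens_injective hγ (sub_eq_zero.1 ?_)
  rw [← ofDens_sub]
  have h1 := ae_abs_le_of_setPair_le (g := mulOp (fun z => (weight γ z.1)⁻¹) (f - g)) (N := 0)
    fun S hS _ => by
      have hb := Bdd.indicator_one (V₀ := V₀) hS
      have h2 : setPair S (mulOp (fun z => (weight γ z.1)⁻¹) (f - g)) =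
          wpair γ (S.indicator fun _ => 1) (f - g) := pair_mulOp (bdd_inv_weight hγ) hb _
      rw [h2, map_sub, h _ hb, sub_self, abs_zero, zero_mul]
  refine AEEqFun.ext ?_
  filter_upwards [h1, AEEqFun.coeFn_zero (β := ℝ) (μ := phase d V₀)] with z hz hz2
  rw [hz2]
  exact abs_nonpos_iff.1 hz

variable [hχ : Fact (χ ∈ Ioo (0 : ℝ) 1)]

lemma IsDiffSolution.hasDerivAt (hγ : 0 ≤ γ) {u : ℝ → Dens d V₀} (hu : IsDiffSolution χ γ u)
    {φ : E d × E d → ℝ} (hφ : IsTest d V₀ φ) (t : ℝ) :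
    HasDerivAt (fun t => wpair γ φ (u t)) (wpair γ (adjointOp V₀ χ φ) (u t)) t := by
  rw [wpair_adjointOp hγ hφ]
  exact hu.deriv φ hφ t

lemma IsDiffSolution.rotOp (hγ : 0 ≤ γ) {u : ℝ → Dens d V₀} (hu : IsDiffSolution χ γ u)
    (R : E d ≃ₗᵢ[ℝ] E d) : IsDiffSolution χ γ (fun t => RunTumble.rotOp R (u t)) where
  cont := (RunTumble.rotOp R).continuous.comp hu.cont
  deriv φ hφ t := by
    rw [← wpair_adjointOp hγ hφ, wpair_rotOp hγ hφ.bdd_adjointOp]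
    simp only [wpair_rotOp hγ hφ.isCc.bdd, ← adjointOp_comp_rot]
    exact hu.hasDerivAt hγ (hφ.comp_rot R.symm) t

/-- The solution with a rotation invariant initial datum is rotation invariant. -/
lemma rotOp_sol (hγ : 0 ≤ γ) (R : E d ≃ₗᵢ[ℝ] E d) {g : Dens d V₀} (hg : rotOp R g = g) {t : ℝ}
    (ht : 0 ≤ t) : rotOp R (sol χ γ g t) = sol χ γ g t := by
  have h := ((isDiffSolution_sol (χ := χ) hγ g).rotOp hγ R).eq_sol hγ ht
  rwa [sol_zero hγ, hg] at h

end Rotations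

/-! ### The stationary state as a weak limit of time means -/

section Stationary

set_option linter.unusedSectionVars false

variable {d : ℕ} {V₀ χ γ C : ℝ}

/-- Time average over `[0, T]`. -/
noncomputable def timeMean (u : ℝ → Dens d V₀) (T : ℝ) : Dens d V₀ :=
  T⁻¹ • ∫ t in (0 : ℝ)..T, u t

lemma map_timeMean {F : Type*} [NormedAddCommGroup F] [NormedSpace ℝ F] [CompleteSpace F]
    (L : Dens d V₀ →L[ℝ] F) {u : ℝ → Dens d V₀} (hu : Continuous u) (T : ℝ) :
    L (timeMean u T) = T⁻¹ • ∫ t in (0 : ℝ)..T, L (u t) := by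
  rw [timeMean, map_smul, L.intervalIntegral_comp_comm (hu.intervalIntegrable _ _)]

lemma norm_timeMean_le {u : ℝ → Dens d V₀} {K T : ℝ} (hT : 0 < T)
    (h : ∀ t, 0 ≤ t → ‖u t‖ ≤ K) : ‖timeMean u T‖ ≤ K := by
  have h1 : ‖∫ t in (0 : ℝ)..T, u t‖ ≤ K * |T - 0| := by
    refine intervalIntegral.norm_integral_le_of_norm_le_const fun t ht => h t ?_
    rw [uIoc_of_le hT.le] at ht
    exact ht.1.le
  rw [sub_zero, abs_of_pos hT] at h1
  rw [timeMean, norm_smul, norm_inv, Real.norm_eq_abs, abs_of_pos hT, inv_mul_le_iff₀ hT, mul_comm T]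
  exact h1

lemma map_timeMean_le (L : Dens d V₀ →L[ℝ] ℝ) {u : ℝ → Dens d V₀} (hu : Continuous u) {K T : ℝ}
    (hT : 0 < T) (h : ∀ t, 0 ≤ t → L (u t) ≤ K) : L (timeMean u T) ≤ K := by
  rw [map_timeMean L hu, smul_eq_mul, inv_mul_le_iff₀ hT]
  have h1 : ∫ t in (0 : ℝ)..T, L (u t) ≤ ∫ _ in (0 : ℝ)..T, K :=
    intervalIntegral.integral_mono_on hT.le ((L.continuous.comp hu).intervalIntegrable _ _)
      intervalIntegrable_const fun t ht => h t ht.1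
  rwa [intervalIntegral.integral_const, sub_zero, smul_eq_mul] at h1

lemma timeMean_le {u : ℝ → Dens d V₀} (hu : Continuous u) {K T : ℝ} (hT : 0 < T)
    (h : ∀ t, 0 ≤ t → ∀ᵐ z ∂(phase d V₀), u t z ≤ K) : ∀ᵐ z ∂(phase d V₀), timeMean u T z ≤ K :=
  ae_le_of_setPair_le fun S hS hS' =>
    map_timeMean_le (setPair S) hu hT fun t ht => setPair_le hS hS' (h t ht)

lemma timeMean_nonneg {u : ℝ → Dens d V₀} (hu : Continuous u) {T : ℝ} (hT : 0 < T)
    (h : ∀ t, 0 ≤ t → 0 ≤ u t) : 0 ≤ timeMean u T := by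
  have h1 : ∀ᵐ z ∂(phase d V₀), (-timeMean u T : Dens d V₀) z ≤ 0 := by
    refine ae_le_of_setPair_le fun S hS hS' => ?_
    have h2 := map_timeMean_le (-setPair S) hu hT (K := 0) fun t ht =>
      neg_nonpos.2 (setPair_nonneg hS (h t ht))
    rw [map_neg, zero_mul]
    exact h2
  refine (Lp.coeFn_nonneg _).1 ?_
  filter_upwards [h1, Lp.coeFn_neg (timeMean u T)] with z hz hz2
  rw [hz2, Pi.neg_apply] at hz
  exact neg_nonpos.1 hz

lemma map_timeMean_eq {F : Type*} [NormedAddCommGroup F] [NormedSpace ℝ F] [CompleteSpace F]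
    (L M : Dens d V₀ →L[ℝ] F) {u : ℝ → Dens d V₀} (hu : Continuous u) {T : ℝ} (hT : 0 < T)
    (h : ∀ t, 0 ≤ t → L (u t) = M (u t)) : L (timeMean u T) = M (timeMean u T) := by
  rw [map_timeMean L hu, map_timeMean M hu]
  congr 1
  refine intervalIntegral.integral_congr fun t ht => ?_
  rw [uIcc_of_le hT.le] at ht
  exact h t ht.1

variable [hV : Fact (volume (velocities d V₀) = 1)]

/-- A bounded, rotation invariant density of unit mass. -/
lemma exists_initial (hγ : 0 < γ) : ∃ g : Dens d V₀, 0 ≤ g ∧ (∃ N, 0 ≤ N ∧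
    ∀ᵐ z ∂(phase d V₀), g z ≤ N) ∧ wpair γ (fun _ => 1) g = 1 ∧
      ∀ R : E d ≃ₗᵢ[ℝ] E d, rotOp R g = g := by
  -- Up to normalisation the initial density is `g = m^{-2}`: bounded, integrable, and dependent on
  -- `‖x‖` only.
  set f : Dens d V₀ := (integrable_inv_weight_sq hγ).toL1 _ with hf
  have hff : f =ᵐ[phase d V₀] fun z => (weight γ z.1)⁻¹ ^ 2 := Integrable.coeFn_toL1 _
  have hf0 : 0 ≤ f := (Lp.coeFn_nonneg _).1 (hff.mono fun z hz => by
    rw [hz]; exact sq_nonneg _)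
  have hf1 : ∀ᵐ z ∂(phase d V₀), f z ≤ 1 := hff.mono fun z hz => by
    rw [hz]
    exact pow_le_one₀ (inv_pos.2 (weight_pos _)).le (inv_le_one_of_one_le₀ (one_le_weight hγ.le _))
  have hb : Bdd V₀ fun z : E d × E d => (weight γ z.1)⁻¹ * 1 :=
    bdd_inv_weight_mul hγ.le (Bdd.const 1)
  have hm : 0 < wpair γ (fun _ => 1) f := by
    rw [wpair, pair_apply hb]
    have h1 : ∫ z, (weight γ z.1)⁻¹ * 1 * f z ∂(phase d V₀) =
        ∫ z, (weight γ z.1)⁻¹ * 1 * (weight γ z.1)⁻¹ ^ 2 ∂(phase d V₀) :=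
      integral_congr_ae (hff.mono fun z hz => by simp only [hz])
    have hpos : ∀ z : E d × E d, 0 < (weight γ z.1)⁻¹ * 1 * (weight γ z.1)⁻¹ ^ 2 := fun z => by
      have := weight_pos (γ := γ) z.1
      positivity
    rw [h1, integral_pos_iff_support_of_nonneg (fun z => (hpos z).le)]
    · have h2 : Function.support (fun z : E d × E d =>
          (weight γ z.1)⁻¹ * 1 * (weight γ z.1)⁻¹ ^ 2) = univ ×ˢ univ := by
        rw [univ_prod_univ]
        exact eq_univ_of_forall fun z => (hpos z).ne'
      rw [h2, phase, Measure.prod_prod, Measure.restrict_apply_univ, hV.out, mul_one]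
      exact isOpen_univ.measure_pos _ univ_nonempty
    · exact (integrable_mul_dens hb f).congr (hff.mono fun z hz => by simp only [hz])
  set c := wpair γ (fun _ => 1) f with hc
  refine ⟨c⁻¹ • f, dens_smul_nonneg (inv_pos.2 hm).le hf0, ⟨c⁻¹, (inv_pos.2 hm).le, ?_⟩, ?_,
    fun R => ?_⟩
  · filter_upwards [Lp.coeFn_smul c⁻¹ f, hf1] with z hz hz2
    rw [hz, Pi.smul_apply, smul_eq_mul]
    exact mul_le_of_le_one_right (inv_pos.2 hm).le hz2
  · rw [map_smul, smul_eq_mul, ← hc, inv_mul_cancel₀ hm.ne']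
  · rw [map_smul]
    congr 1
    refine Lp.ext ((coeFn_rotOp R f).trans ?_)
    filter_upwards [hff, (measurePreserving_rot R).quasiMeasurePreserving.ae_eq_comp hff]
      with z hz hz2
    simp only [Function.comp] at hz2
    rw [hz, hz2, rot_apply, weight_rot]

variable [hχ : Fact (χ ∈ Ioo (0 : ℝ) 1)]

/-- The integrand is a time derivative, so the mean is the difference of two bounded values divided
by `T`. This makes weak limits of time means stationary. -/
lemma abs_wpair_adjointOp_timeMean_le (hγ : 0 ≤ γ) {u : ℝ → Dens d V₀}
    (hu : IsDiffSolution χ γ u) {K : ℝ} (hK : ∀ t, 0 ≤ t → ‖u t‖ ≤ K) {φ : E d × E d → ℝ}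
    (hφ : IsTest d V₀ φ) {T : ℝ} (hT : 0 < T) :
    |wpair γ (adjointOp V₀ χ φ) (timeMean u T)| ≤
      T⁻¹ * (2 * (‖(wpair γ φ : Dens d V₀ →L[ℝ] ℝ)‖ * K)) := by
  have hc : Continuous fun t => wpair γ (adjointOp V₀ χ φ) (u t) :=
    (wpair γ (adjointOp V₀ χ φ)).continuous.comp hu.cont
  rw [map_timeMean _ hu.cont, intervalIntegral.integral_eq_sub_of_hasDerivAt
    (fun t _ => hu.hasDerivAt hγ hφ t) (hc.intervalIntegrable _ _), smul_eq_mul, abs_mul,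
    abs_of_pos (inv_pos.2 hT)]
  refine mul_le_mul_of_nonneg_left ?_ (inv_pos.2 hT).le
  have h1 : ∀ t, 0 ≤ t → |wpair γ φ (u t)| ≤ ‖(wpair γ φ : Dens d V₀ →L[ℝ] ℝ)‖ * K := fun t ht =>
    ((wpair γ φ).le_opNorm (u t)).trans (mul_le_mul_of_nonneg_left (hK t ht) (norm_nonneg _))
  have h2 := abs_sub (wpair γ φ (u T)) (wpair γ φ (u 0))
  linarith [h1 T hT.le, h1 0 le_rfl]

/-- Existence of a stationary density. -/
theorem exists_stationary_dens (hC : SolBound d V₀ χ γ C) (hγ : 0 < γ) :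
    ∃ g : Dens d V₀, 0 ≤ g ∧ (∃ K, ∀ᵐ z ∂(phase d V₀), g z ≤ K) ∧ wpair γ (fun _ => 1) g = 1 ∧
      (∀ R : E d ≃ₗᵢ[ℝ] E d, rotOp R g = g) ∧
      ∀ φ, IsTest d V₀ φ → wpair γ (adjointOp V₀ χ φ) g = 0 := by
  obtain ⟨g₀, h0, ⟨N, hN0, hN⟩, hmass, hrot⟩ := exists_initial (d := d) (V₀ := V₀) hγ
  set u := sol χ γ g₀ with hu
  have hu' : IsDiffSolution χ γ u := isDiffSolution_sol hγ.le g₀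
  set K := C * (‖g₀‖ + N) with hK
  have hK0 : 0 ≤ K := mul_nonneg hC.nonneg (by positivity)
  have hun : ∀ t, 0 ≤ t → ‖u t‖ ≤ K := fun t ht =>
    (hC.norm_le g₀ h0 t ht).trans (mul_le_mul_of_nonneg_left (by linarith) hC.nonneg)
  -- Means over `[0, n + 1]`, so that the length is positive also for `n = 0`. A free ultrafilter
  -- then replaces the extraction of a subsequence.
  set a : ℕ → Dens d V₀ := fun n => timeMean u (n + 1 : ℝ) with ha
  have hT : ∀ n : ℕ, (0 : ℝ) < n + 1 := fun n => by positivity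
  set U : Ultrafilter ℕ := hyperfilter ℕ with hU
  have hUtop : (U : Filter ℕ) ≤ atTop := Nat.hyperfilter_le_atTop
  obtain ⟨g, hg0, hgK, hlim⟩ := exists_weak_limit hγ (a := a) hK0
    (fun n => timeMean_nonneg hu'.cont (hT n) fun t ht => sol_nonneg hγ.le h0 ht)
    (fun n => norm_timeMean_le (hT n) hun)
    (fun n => timeMean_le hu'.cont (hT n) fun t ht => hC.le g₀ h0 N hN0 hN t ht) U
  refine ⟨g, hg0, ⟨K, hgK⟩, ?_, fun R => ?_, fun φ hφ => ?_⟩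
  -- The constant 1 is an admissible test function for the weak limit, so the unit mass of the time
  -- means is kept.
  · refine tendsto_nhds_unique (hlim _ (Bdd.const 1)) (tendsto_const_nhds.congr fun n => ?_)
    rw [ha, map_timeMean _ hu'.cont]
    simp only [hu, wpair_one_sol hγ.le, hmass]
    rw [intervalIntegral.integral_const, sub_zero, smul_smul, inv_mul_cancel₀ (hT n).ne', one_smul]
  · refine eq_of_wpair_eq hγ.le fun ψ hψ => ?_
    rw [wpair_rotOp hγ.le hψ]
    refine tendsto_nhds_unique (hlim _ (hψ.comp_rot R.symm)) ((hlim ψ hψ).congr fun n => ?_)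
    rw [← wpair_rotOp hγ.le hψ]
    have h1 : rotOp R (a n) = a n := map_timeMean_eq (rotOp R) (ContinuousLinearMap.id ℝ _)
      hu'.cont (hT n) fun t ht => rotOp_sol hγ.le R (hrot R) ht
    rw [h1]
  · refine tendsto_nhds_unique (hlim _ hφ.bdd_adjointOp) ?_
    refine squeeze_zero_norm (fun n => abs_wpair_adjointOp_timeMean_le hγ.le hu' hun hφ (hT n)) ?_
    have h1 : Tendsto (fun n : ℕ => ((n : ℝ) + 1)⁻¹) U (𝓝 0) := by
      have := tendsto_one_div_add_atTop_nhds_zero_nat (𝕜 := ℝ)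
      simp only [one_div] at this
      exact this.mono_left hUtop
    simpa using h1.mul_const (2 * (‖(wpair γ φ : Dens d V₀ →L[ℝ] ℝ)‖ * K))

theorem exists_stationary (hC : SolBound d V₀ χ γ C) (hγ : 0 < γ) :
    ∃ G : X d V₀ γ, 0 ≤ G.1 ∧ ∫ z, G.1 z ∂(phase d V₀) = 1 ∧ RotationInvariant G.1 ∧
      IsStationary V₀ χ G.1 ∧ ∀ t : ℝ, 0 ≤ t → semigroup hC hγ.le t G = G := by
  obtain ⟨g, hg0, ⟨K, hgK⟩, hmass, hrot, hstat⟩ := exists_stationary_dens hC hγ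
  have hgK' : ∀ᵐ z ∂(phase d V₀), |g z| ≤ K := by
    filter_upwards [hgK, (Lp.coeFn_nonneg _).2 hg0] with z hz hz2
    rwa [abs_of_nonneg hz2]
  set G : X d V₀ γ := ⟨ofDens γ g, ofDens_mem_X hγ.le hgK'⟩ with hG
  have hGg : toDens G = g := toDens_eq_of_eq_ofDens hγ.le rfl
  have hm := coeFn_ofDens hγ.le g
  refine ⟨G, ?_, ?_, fun R _ => ?_, fun φ hφ => ?_, fun t ht => Subtype.ext ?_⟩
  · refine AEEqFun.coeFn_le.1 ?_
    filter_upwards [hm, (Lp.coeFn_nonneg _).2 hg0, AEEqFun.coeFn_zero (β := ℝ) (μ := phase d V₀)]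
      with z hz hz2 hz3
    rw [hz3, Pi.zero_apply]
    refine le_of_le_of_eq ?_ hz.symm
    exact mul_nonneg (inv_pos.2 (weight_pos _)).le hz2
  · have h1 := integral_ofDens_mul hγ.le (bdd_inv_weight_mul hγ.le (Bdd.const 1)) g
    simpa only [mul_one, hmass] using h1
  · filter_upwards [hm, (measurePreserving_rot R).quasiMeasurePreserving.ae_eq_comp hm,
      coeFn_rotOp R g] with z hz hz2 hz3
    simp only [Function.comp] at hz2
    rw [hrot R] at hz3
    change ofDens γ g (rot R z) = ofDens γ g z
    rw [hz, hz2, hz3, rot_apply, weight_rot]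
  · rw [← hstat φ hφ]
    exact integral_ofDens_mul hγ.le (bdd_inv_weight_mul hγ.le hφ.bdd_adjointOp) g
  -- Stationarity in the sense of distributions says that the constant curve is a solution; by
  -- uniqueness it is the trajectory of the semigroup.
  · have hconst : IsDiffSolution χ γ (fun _ : ℝ => g) := ⟨continuous_const, fun φ hφ s => by
      rw [← wpair_adjointOp hγ.le hφ, hstat φ hφ]
      exact hasDerivAt_const _ _⟩
    rw [semigroup_apply hC hγ.le G ht, hGg]
    exact congrArg (ofDens γ) (hconst.eq_sol hγ.le ht).symm

end Stationary

end RunTumble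

theorem lemma3p6 (d : ℕ) (hd : 1 ≤ d) (V₀ : ℝ)
    (hV₀ : volume (RunTumble.velocities d V₀) = 1) (χ : ℝ) (hχ : χ ∈ Ioo (0 : ℝ) 1) :
    ∃ γs : ℝ, 0 < γs ∧ ∀ γ ∈ Ioo (0 : ℝ) γs,
      ∃ S : ℝ → (RunTumble.X d V₀ γ →ₗ[ℝ] RunTumble.X d V₀ γ),
        RunTumble.IsFlow V₀ χ γ S ∧
        (∃ C : NNReal, ∀ t : ℝ, 0 ≤ t → ∀ f : RunTumble.X d V₀ γ,
          RunTumble.normX γ (S t f).1 ≤ C * RunTumble.normX γ f.1) ∧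
        ∃ G : RunTumble.X d V₀ γ,
          0 ≤ G.1 ∧
          ∫ z, G.1 z ∂(RunTumble.phase d V₀) = 1 ∧
          RunTumble.RotationInvariant G.1 ∧
          RunTumble.IsStationary V₀ χ G.1 ∧
          ∀ t : ℝ, 0 ≤ t → S t G = G := by
  have : Fact (volume (RunTumble.velocities d V₀) = 1) := ⟨hV₀⟩
  have : Fact (χ ∈ Ioo (0 : ℝ) 1) := ⟨hχ⟩
  obtain ⟨γs, hγs, H⟩ := RunTumble.exists_sol_le d V₀ χ
  refine ⟨γs, hγs, fun γ hγ => ?_⟩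
  obtain ⟨C, hC0, hC⟩ := H γ hγ
  have hB : RunTumble.SolBound d V₀ χ γ C := ⟨hC0, fun g hg => (hC g hg).1, fun g hg => (hC g hg).2⟩
  exact ⟨RunTumble.semigroup hB hγ.1.le, RunTumble.isFlow_semigroup hB hγ.1.le,
    ⟨(3 * C).toNNReal, fun t ht f => RunTumble.normX_semigroup_le hB hγ.1.le f ht⟩,
    RunTumble.exists_stationary hB hγ.1⟩
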